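/- Let $G$ be a finite connected graph, loops and multiple edges allowed, with fixed total orders on the vertex set $V$ and on the edge set $E$; let $v_0$ be the least vertex. For $S\subseteq E$ let $\mathrm{Conn}(S)$ be the set of connected components of the spanning graph $[G:S]=(V,S)$, and for $e\notin S$ put $\epsilon^{S,e}=(-1)^{|\{e'\in S\,:\,e'<e\}|}$. *The chromatic complex of $G$ (Helme-Guizon and Rong).* $C^{i,j}(G)$ is the free abelian group on the pairs $(S,c)$ with $|S|=i$ and $c:\mathrm{Conn}(S)\to\{1,x\}\subset\mathbb Z[x]/(x^2)$ taking the value $x$ exactly $j$ times, and $d(S,c)=\sum_{e\notin S}\epsilon^{S,e}(S\cup e,c_e)$, where $c_e=c$ if $e$ joins a component to itself, and if $e$ joins two components the new component is labelled by the product of their labels in $\mathbb Z[x]/(x^2)$ (so the term is $0$ if both labels are $x$). Its cohomology is $H^{i,j}(G)$. *The characteristic complex of the graphic matroid $M(G)$ with its canonical quasi-representation.* Let $\tilde N=\bigoplus_{v\in V}\mathbb Z v$, $N=\tilde N/\langle v_0\rangle$, and let $\rho(S)\subseteq N$ be spanned by the classes of $v-v'$ for the edges in $S$ with endpoints $v,v'$.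 Then $C^{i,j}(M(G))=\bigoplus_{|S|=i}\bigwedge^j N/\rho(S)$, and $d$ is the sum over $e\notin S$ of $\epsilon^{S,e}$ times the map induced by $N/\rho(S)\to N/\rho(S\cup e)$. Its cohomology is $H^{i,j}(M(G))$. All groups with $i<0$ or $j<0$ are $0$. For a set $X=\{F_1,\dots,F_k\}\subseteq\mathrm{Conn}(S)$ with $\min V(F_1)<\dots<\min V(F_k)$ let $v_{S,X}=v_{S,F_1}\wedge\dots\wedge v_{S,F_k}\in\bigwedge^k N/\rho(S)$, where $v_{S,F}$ is the class of $\min V(F)$, and let $F_0\in\mathrm{Conn}(S)$ be the component of $v_0$. Let $\theta:C^{i,j}(G)\to C^{i,j}(M(G))$ be the linear map with $\theta(S,c)=v_{S,c^{-1}(x)}$. **Theorem.** There is a linear map $\tau:C^{i,j-1}(M(G))\to C^{i,j}(G)$ (for all $i,j$) with $\tau(v_{S,X})=(S,c)$, $c^{-1}(x)=X\cup\{F_0\}$, if $F_0\notin X$, and $\tau(v_{S,X})=0$ if $F_0\in X$. The sequences of abelian groups $0\to C^{i,j-1}(M(G))\xrightarrow{\tau}C^{i,j}(G)\xrightarrow{\theta}C^{i,j}(M(G))\to0$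 are exact. Moreover, for every $j$ there is a short exact sequence of cochain complexes $$0\to C^{\bullet,j-1}(M(G))\xrightarrow{f}C^{\bullet,j}(G)\xrightarrow{g}C^{\bullet,j}(M(G))\to0$$ with $\operatorname{im} f=\operatorname{im}\tau$ and $\ker g=\ker\theta$ in every degree $i$. With the maps induced by $f$ and $g$ and the connecting homomorphisms of this sequence, there is a long exact sequence $$\cdots\to H^{i,j-1}(M(G))\to H^{i,j}(G)\to H^{i,j}(M(G))\to H^{i+1,j-1}(M(G))\to\cdots.$$ -/

import Mathlib

open CategoryTheory
open scoped Graph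

noncomputable section

/-! ### Cubes of modules and their cochain complexes -/

/-- The sign `ε^{S,e}`: it is `-1` if `#{e' ∈ S | e' < e}` is odd and `1` otherwise. -/
def edgeSign {E : Type*} [LinearOrder E] (S : Finset E) (e : E) : ℤ :=
  (-1) ^ (S.filter (fun e' => e' < e)).card

/-- A commutative cube of graded `R`-modules over the subsets of a finite set `E`: a module for
every subset, a map for every inclusion, and a grading by `j : ℤ` which the maps preserve. -/
structure GradedCube (R : Type*) [CommRing R] (E : Type*) where
  obj : Finset E → Type*
  [addCommGroup : ∀ S, AddCommGroup (obj S)]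
  [module : ∀ S, Module R (obj S)]
  map : ∀ {S T : Finset E}, S ⊆ T → (obj S →ₗ[R] obj T)
  map_map : ∀ {S T U : Finset E} (h : S ⊆ T) (h' : T ⊆ U) (x : obj S),
    map h' (map h x) = map (h.trans h') x
  deg : ∀ (_ : ℤ) (S : Finset E), Submodule R (obj S)
  map_mem : ∀ {S T : Finset E} (h : S ⊆ T) (j : ℤ) (x : obj S), x ∈ deg j S → map h x ∈ deg j T

namespace GradedCube

attribute [instance] GradedCube.addCommGroup GradedCube.module

variable {R : Type*} [CommRing R] {E : Type*} [LinearOrder E]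

/-- The total differential on `⨁_S obj S`. The component of `d x` at `T` is
`∑_{e ∈ T} ε^{T∖e,e} map (x_{T∖e})`; that is, `d` sends `x ∈ obj S` to
`∑_{e ∉ S} ε^{S,e} map_{S ⊆ S∪e} x`. -/
def diff (K : GradedCube R E) : (∀ S, K.obj S) →ₗ[R] (∀ S, K.obj S) :=
  LinearMap.pi fun T => ∑ e ∈ T, edgeSign (T.erase e) e •
    (K.map (T.erase_subset e) ∘ₗ LinearMap.proj (T.erase e))


theorem diff_apply (K : GradedCube R E) (x : ∀ S, K.obj S) (T : Finset E) :
    K.diff x T = ∑ e ∈ T, edgeSign (T.erase e) e • K.map (T.erase_subset e) (x (T.erase e)) := by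
  simp [diff]

theorem edgeSign_swap (T : Finset E) {e f : E} (he : e ∈ T) (hef : e < f) :
    edgeSign (T.erase e) e * edgeSign ((T.erase e).erase f) f =
      -(edgeSign (T.erase f) f * edgeSign ((T.erase f).erase e) e) := by
  have h1 : (T.erase e).filter (fun x => x < e) = ((T.erase f).erase e).filter (fun x => x < e) := by
    ext x
    simp only [Finset.mem_filter, Finset.mem_erase]
    constructor
    · rintro ⟨⟨h1, h2⟩, h3⟩
      exact ⟨⟨h1, (h3.trans hef).ne, h2⟩, h3⟩
    · rintro ⟨⟨h1, -, h2⟩, h3⟩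
      exact ⟨⟨h1, h2⟩, h3⟩
  have h2 : (T.erase f).filter (fun x => x < f) =
      insert e (((T.erase e).erase f).filter (fun x => x < f)) := by
    ext x
    simp only [Finset.mem_filter, Finset.mem_erase, Finset.mem_insert]
    constructor
    · rintro ⟨⟨h1, h2⟩, h3⟩
      by_cases hx : x = e
      · exact Or.inl hx
      · exact Or.inr ⟨⟨h1, hx, h2⟩, h3⟩
    · rintro (rfl | ⟨⟨h1, -, h2⟩, h3⟩)
      · exact ⟨⟨hef.ne, he⟩, hef⟩
      · exact ⟨⟨h1, h2⟩, h3⟩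
  have h3 : e ∉ ((T.erase e).erase f).filter (fun x => x < f) := by simp
  unfold edgeSign
  rw [h1, h2, Finset.card_insert_of_notMem h3, pow_succ]
  ring

theorem map_congr {R E : Type*} [CommRing R] (K : GradedCube R E) (x : ∀ S, K.obj S) {S S' T : Finset E} (hS : S = S')
    (h : S ⊆ T) (h' : S' ⊆ T) : K.map h (x S) = K.map h' (x S') := by
  subst hS
  rfl

theorem diff_diff (K : GradedCube R E) (x : ∀ S, K.obj S) : K.diff (K.diff x) = 0 := by
  funext T
  rw [diff_apply]
  simp only [diff_apply, map_sum, Finset.smul_sum, map_zsmul, K.map_map, smul_smul, Pi.zero_apply]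
  rw [Finset.sum_sigma']
  refine Finset.sum_involution (fun p _ => ⟨p.2, p.1⟩) ?_ ?_ ?_ ?_
  · rintro ⟨e, f⟩ hp
    simp only [Finset.mem_sigma, Finset.mem_erase] at hp
    obtain ⟨he, hfe, hf⟩ := hp
    have hS : (T.erase e).erase f = (T.erase f).erase e := Finset.erase_right_comm
    have hsub : (T.erase e).erase f ⊆ T := (Finset.erase_subset _ _).trans (Finset.erase_subset _ _)
    have hsub' : (T.erase f).erase e ⊆ T :=
      (Finset.erase_subset _ _).trans (Finset.erase_subset _ _)
    have hx := K.map_congr x hS hsub hsub'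
    have hs : edgeSign (T.erase e) e * edgeSign ((T.erase e).erase f) f =
        -(edgeSign (T.erase f) f * edgeSign ((T.erase f).erase e) e) := by
      rcases lt_or_gt_of_ne hfe with h | h
      · rw [edgeSign_swap T hf h, neg_neg]
      · exact edgeSign_swap T he h
    dsimp only
    rw [hx, hs, neg_smul, neg_add_cancel]
  · rintro ⟨e, f⟩ hp - h
    simp only [Finset.mem_sigma, Finset.mem_erase] at hp
    simp only [Sigma.mk.injEq, heq_eq_eq] at h
    exact hp.2.1 h.1
  · rintro ⟨e, f⟩ hp
    simp only [Finset.mem_sigma, Finset.mem_erase] at hp ⊢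
    exact ⟨hp.2.2, hp.2.1.symm, hp.1⟩
  · rintro ⟨e, f⟩ _
    rfl

/-- The chain group `C^{i,j} = ⨁_{#S = i} (obj S)_j`, as a submodule of `⨁_S obj S`. It is zero
if `i` is negative. -/
def chain (K : GradedCube R E) (i j : ℤ) : Submodule R (∀ S, K.obj S) where
  carrier := {x | ∀ S, x S ∈ K.deg j S ∧ ((S.card : ℤ) ≠ i → x S = 0)}
  zero_mem' := fun S => ⟨Submodule.zero_mem _, fun _ => rfl⟩
  add_mem' := fun {x y} hx hy S => ⟨Submodule.add_mem _ (hx S).1 (hy S).1, fun h => by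
    rw [Pi.add_apply, (hx S).2 h, (hy S).2 h, add_zero]⟩
  smul_mem' := fun c x hx S => ⟨Submodule.smul_mem _ _ (hx S).1, fun h => by
    rw [Pi.smul_apply, (hx S).2 h, smul_zero]⟩

theorem diff_mem (K : GradedCube R E) {i i' : ℤ} (h : i + 1 = i') (j : ℤ) :
    ∀ x ∈ K.chain i j, K.diff x ∈ K.chain i' j := by
  intro x hx T
  rw [diff_apply]
  refine ⟨Submodule.sum_mem _ fun e _ => ?_, fun hT => Finset.sum_eq_zero fun e he => ?_⟩
  · exact zsmul_mem (K.map_mem _ _ _ (hx _).1) _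
  · rw [(hx (T.erase e)).2, map_zero, smul_zero]
    have := Finset.card_erase_add_one he
    omega

/-- The cochain complex `C^{•,j}` of a graded cube, for a fixed degree `j`. -/
def complex (K : GradedCube R E) (j : ℤ) : CochainComplex (ModuleCat R) ℤ where
  X i := ModuleCat.of R (K.chain i j)
  d i i' := if h : i + 1 = i' then ModuleCat.ofHom (K.diff.restrict (K.diff_mem h j)) else 0
  shape i i' h := dif_neg h
  d_comp_d' i i' i'' h h' := by
    have h1 : i + 1 = i' := h
    have h2 : i' + 1 = i'' := h'
    rw [dif_pos h1, dif_pos h2]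
    ext x
    exact congrArg (fun y : ∀ S, K.obj S => y _) (K.diff_diff x.1)

end GradedCube

/-! ### Matroids, quasi-representations and the characteristic complex -/

section RankFunction

variable {E : Type*} [Finite E] {r : Set E → ℕ}

theorem rank_union_eq_of_insert (mono : ∀ S T, S ⊆ T → r S ≤ r T)
    (submod : ∀ S T, r (S ∩ T) + r (S ∪ T) ≤ r S + r T) {I : Set E} (J : Set E)
    (h : ∀ e ∈ J, r (insert e I) = r I) : r (I ∪ J) = r I := by
  induction J, J.toFinite using Set.Finite.induction_on with
  | empty => simp
  | @insert e K _ _ ih =>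
    have h1 := ih fun f hf => h f (Set.mem_insert_of_mem _ hf)
    have h2 := h e (Set.mem_insert _ _)
    have h3 := submod (I ∪ K) (insert e I)
    have h4 : (I ∪ K) ∪ insert e I = I ∪ insert e K := by
      ext x
      simp only [Set.mem_union, Set.mem_insert_iff]
      tauto
    have h5 : r I ≤ r ((I ∪ K) ∩ insert e I) :=
      mono _ _ (Set.subset_inter Set.subset_union_left (Set.subset_insert _ _))
    have h6 : r I ≤ r (I ∪ insert e K) := mono _ _ Set.subset_union_left
    rw [h4] at h3
    omega

theorem rank_insert_eq (card : ∀ S, r S ≤ S.ncard) (mono : ∀ S T, S ⊆ T → r S ≤ r T)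
    (submod : ∀ S T, r (S ∩ T) + r (S ∪ T) ≤ r S + r T) {I : Set E} (hI : r I = I.ncard) {e : E}
    (he : e ∉ I) (h : r (insert e I) ≠ (insert e I).ncard) : r (insert e I) = r I := by
  have h1 := submod {e} I
  have h2 := card {e}
  have h3 := mono I (insert e I) (Set.subset_insert _ _)
  rw [Set.ncard_singleton] at h2
  rw [Set.singleton_union] at h1
  rw [Set.ncard_insert_of_notMem he] at h
  omega

/-- The matroid on a finite ground set `E` with a given rank function. -/
def matroidOfRank (r : Set E → ℕ) (card : ∀ S, r S ≤ S.ncard) (mono : ∀ S T, S ⊆ T → r S ≤ r T)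
    (submod : ∀ S T, r (S ∩ T) + r (S ∪ T) ≤ r S + r T) : Matroid E :=
  (IndepMatroid.ofFinite (E := Set.univ) Set.finite_univ (fun I => r I = I.ncard)
    (by simpa using card ∅)
    (by
      intro I J hJ hIJ
      have h1 := submod I (J \ I)
      have h2 := card (J \ I)
      have h3 := card I
      have h4 := Set.ncard_sdiff_add_ncard_of_subset hIJ
      rw [Set.union_sdiff_cancel hIJ] at h1
      omega)
    (by
      intro I J hI hJ hIJ
      by_contra hcon
      push Not at hcon
      have h1 : r (I ∪ J) = r I := rank_union_eq_of_insert mono submod J fun e he => by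
        by_cases heI : e ∈ I
        · rw [Set.insert_eq_of_mem heI]
        · exact rank_insert_eq card mono submod hI heI (hcon e he heI)
      have h2 := mono J (I ∪ J) Set.subset_union_right
      omega)
    (fun _ _ => Set.subset_univ _)).matroid

theorem matroidOfRank_rk (card : ∀ S, r S ≤ S.ncard) (mono : ∀ S T, S ⊆ T → r S ≤ r T)
    (submod : ∀ S T, r (S ∩ T) + r (S ∪ T) ≤ r S + r T) (S : Set E) :
    (matroidOfRank r card mono submod).eRk S = r S := by
  obtain ⟨B, hB⟩ := (matroidOfRank r card mono submod).exists_isBasis S (Set.subset_univ _)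
  have hBi : r B = B.ncard := hB.indep
  rw [← hB.encard_eq_eRk, ← B.toFinite.cast_ncard_eq, ← hBi]
  congr 1
  have h : r (B ∪ S) = r B := rank_union_eq_of_insert mono submod S fun e he => by
    by_cases heB : e ∈ B
    · rw [Set.insert_eq_of_mem heB]
    · refine rank_insert_eq card mono submod hBi heB fun h => heB ?_
      exact hB.mem_of_insert_indep he h
  rw [← h, Set.union_eq_right.2 hB.subset]

end RankFunction

/-- An `R`-quasi-representation, for a principal ideal domain `R`, in the finitely generated
`R`-module `N` of a matroid `M` whose ground set is `E`. -/
structure QuasiRepresentation (R : Type*) [CommRing R] [IsDomain R]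
    [IsPrincipalIdealRing R] (N : Type*) [AddCommGroup N] [Module R N] [Module.Finite R N]
    {E : Type*} (M : Matroid E) where
  ground_eq : M.E = Set.univ
  ρ : Set E → Submodule R N
  finrank_eq : ∀ S, (Module.finrank R (ρ S) : ℕ∞) = M.eRk S
  empty : ρ ∅ = ⊥
  univ : ρ Set.univ = ⊤
  mono : ∀ {S T}, S ⊆ T → ρ S ≤ ρ T
  eq_of_rank_eq : ∀ {S T}, S ⊆ T → M.eRk S = M.eRk T → ρ S = ρ T

/-- The degree `j` part of an exterior algebra, for `j : ℤ`; it is zero for negative `j`. -/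
def exteriorDegree (R : Type*) [CommRing R] (N : Type*) [AddCommGroup N] [Module R N] :
    ℤ → Submodule R (ExteriorAlgebra R N)
  | Int.ofNat n => ⋀[R]^n N
  | Int.negSucc _ => ⊥

theorem exteriorDegree_map {R : Type*} [CommRing R] {N N' : Type*} [AddCommGroup N] [Module R N]
    [AddCommGroup N'] [Module R N'] (φ : N →ₗ[R] N') (j : ℤ) (x : ExteriorAlgebra R N)
    (hx : x ∈ exteriorDegree R N j) :
    ExteriorAlgebra.map φ x ∈ exteriorDegree R N' j := by
  cases j with
  | ofNat n =>
    have h : Submodule.map (ExteriorAlgebra.map φ).toLinearMap (⋀[R]^n N) ≤ ⋀[R]^n N' := by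
      rw [ExteriorAlgebra.exteriorPower, Submodule.map_pow, ExteriorAlgebra.ι_range_map_map]
      exact pow_le_pow_left' LinearMap.map_le_range n
    exact h ⟨x, hx, rfl⟩
  | negSucc n =>
    have : x = 0 := hx
    rw [this, map_zero]
    exact Submodule.zero_mem _

/-- The cube `S ↦ ⋀ (N / ρ(S))` of a matroid with a quasi-representation, with the algebra maps
induced by the projections `N / ρ(S) → N / ρ(T)` and graded by exterior degree. -/
def QuasiRepresentation.cube {R : Type*} [CommRing R] [IsDomain R]
    [IsPrincipalIdealRing R] {N : Type*} [AddCommGroup N] [Module R N] [Module.Finite R N]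
    {E : Type*} {M : Matroid E} (Q : QuasiRepresentation R N M) : GradedCube R E where
  obj S := ExteriorAlgebra R (N ⧸ Q.ρ S)
  map h := (ExteriorAlgebra.map
    (Submodule.factor (Q.mono (Finset.coe_subset.2 h)))).toLinearMap
  map_map h h' x := by
    have := ExteriorAlgebra.map_comp_map (Submodule.factor (Q.mono (Finset.coe_subset.2 h)))
      (Submodule.factor (Q.mono (Finset.coe_subset.2 h')))
    rw [Submodule.factor_comp] at this
    exact DFunLike.congr_fun this x
  deg j S := exteriorDegree R (N ⧸ Q.ρ S) j
  map_mem _ j x hx := exteriorDegree_map _ j x hx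

/-- The complex `C^{•,j}(M, ρ)` computing the characteristic cohomology `H^{•,j}(M, ρ)`. -/
def QuasiRepresentation.complex {R : Type*} [CommRing R] [IsDomain R]
    [IsPrincipalIdealRing R] {N : Type*} [AddCommGroup N] [Module R N] [Module.Finite R N]
    {E : Type*} [LinearOrder E] {M : Matroid E} (Q : QuasiRepresentation R N M)
    (j : ℤ) : CochainComplex (ModuleCat R) ℤ :=
  Q.cube.complex j

/-! ### Graphs and graphic matroids -/

namespace Graph

variable {α β : Type*} (G : Graph α β)

/-- The spanning graph `[G:S]`, with vertex set `V(G)` and edge set `S ⊆ E(G)`. Loops and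
multiplicities are forgotten, as only its connected components are used. -/
def spanning (S : Set E(G)) : SimpleGraph V(G) where
  Adj u v := u ≠ v ∧ ∃ e ∈ S, G.IsLink e u v
  symm := ⟨fun _ _ ⟨h, e, he, hl⟩ => ⟨h.symm, e, he, hl.symm⟩⟩
  loopless := ⟨fun _ h => h.1 rfl⟩

/-- A graph is connected if it has a vertex and any two vertices are joined by a path. -/
def IsConn : Prop := (G.spanning Set.univ).Connected

/-- `Conn(S)`, the set of connected components of `[G:S]`. -/
abbrev Conn (S : Set E(G)) : Type _ := (G.spanning S).ConnectedComponent

theorem spanning_mono {S T : Set E(G)} (h : S ⊆ T) : G.spanning S ≤ G.spanning T :=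
  fun _ _ ⟨hne, e, he, hl⟩ => ⟨hne, e, h he, hl⟩

/-- The map `Conn(S) → Conn(T)` for `S ⊆ T`, sending a component to the one which contains it. -/
def connMap {S T : Set E(G)} (h : S ⊆ T) : G.Conn S → G.Conn T :=
  SimpleGraph.ConnectedComponent.map (SimpleGraph.Hom.ofLE (G.spanning_mono h))

theorem connMap_mk {S T : Set E(G)} (h : S ⊆ T) (v : V(G)) :
    G.connMap h ((G.spanning S).connectedComponentMk v) = (G.spanning T).connectedComponentMk v :=
  rfl

theorem connMap_connMap {S T U : Set E(G)} (h : S ⊆ T) (h' : T ⊆ U) (F : G.Conn S) :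
    G.connMap h' (G.connMap h F) = G.connMap (h.trans h') F := by
  induction F using SimpleGraph.ConnectedComponent.ind
  rfl

theorem connMap_surjective {S T : Set E(G)} (h : S ⊆ T) : Function.Surjective (G.connMap h) := by
  intro F
  induction F using SimpleGraph.ConnectedComponent.ind with
  | h v => exact ⟨(G.spanning S).connectedComponentMk v, rfl⟩

/-- `ρ̃(S) = ⟨v - v' | v, v' are the endpoints of some edge in S⟩` in `Ñ = ⨁_{v ∈ V(G)} ℤ v`. -/
def rhoTilde (S : Set E(G)) : Submodule ℤ (V(G) →₀ ℤ) :=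
  Submodule.span ℤ {x | ∃ e ∈ S, ∃ v v' : V(G), G.IsLink e v v' ∧
    x = Finsupp.single v 1 - Finsupp.single v' 1}

theorem rhoTilde_mono {S T : Set E(G)} (h : S ⊆ T) : G.rhoTilde S ≤ G.rhoTilde T :=
  Submodule.span_mono fun _ ⟨e, he, hx⟩ => ⟨e, h he, hx⟩

/-- The map `Ñ → ⨁_{F ∈ Conn(S)} ℤ F` sending a vertex to its component. -/
def toConn (S : Set E(G)) : (V(G) →₀ ℤ) →ₗ[ℤ] (G.Conn S →₀ ℤ) :=
  Finsupp.lmapDomain ℤ ℤ (G.spanning S).connectedComponentMk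

theorem toConn_single (S : Set E(G)) (v : V(G)) (a : ℤ) : G.toConn S (Finsupp.single v a) =
    Finsupp.single ((G.spanning S).connectedComponentMk v) a :=
  Finsupp.mapDomain_single

theorem single_sub_mem_rhoTilde {S : Set E(G)} {u v : V(G)} (h : (G.spanning S).Reachable u v) :
    (Finsupp.single u 1 - Finsupp.single v 1 : V(G) →₀ ℤ) ∈ G.rhoTilde S := by
  obtain ⟨p⟩ := h
  induction p with
  | nil => simp
  | @cons a b c hab _ ih =>
    obtain ⟨_, e, he, hl⟩ := hab
    have h1 : (Finsupp.single a 1 - Finsupp.single b 1 : V(G) →₀ ℤ) ∈ G.rhoTilde S :=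
      Submodule.subset_span ⟨e, he, a, b, hl, rfl⟩
    simpa using add_mem h1 ih

theorem ker_toConn (S : Set E(G)) : LinearMap.ker (G.toConn S) = G.rhoTilde S := by
  apply le_antisymm
  · intro x hx
    let s : (G.Conn S →₀ ℤ) →ₗ[ℤ] (V(G) →₀ ℤ) := Finsupp.lmapDomain ℤ ℤ Quot.out
    have key : ∀ y : V(G) →₀ ℤ, y - s (G.toConn S y) ∈ G.rhoTilde S := by
      intro y
      induction y using Finsupp.induction_linear with
      | zero => simp
      | add f g hf hg =>
        rw [map_add, map_add, add_sub_add_comm]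
        exact add_mem hf hg
      | single v a =>
        have hv : (G.spanning S).Reachable v
            (Quot.out ((G.spanning S).connectedComponentMk v)) :=
          (SimpleGraph.ConnectedComponent.exact (Quot.out_eq _)).symm
        have := Submodule.smul_mem _ a (G.single_sub_mem_rhoTilde hv)
        rw [toConn_single]
        have hs : s (Finsupp.single ((G.spanning S).connectedComponentMk v) a) =
            Finsupp.single (Quot.out ((G.spanning S).connectedComponentMk v)) a :=
          Finsupp.mapDomain_single
        rw [hs]
        simpa [smul_sub] using this
    have := key x
    rwa [LinearMap.mem_ker.1 hx, map_zero, sub_zero] at this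
  · refine Submodule.span_le.2 ?_
    rintro x ⟨e, he, v, v', hl, rfl⟩
    rw [SetLike.mem_coe, LinearMap.mem_ker, map_sub, toConn_single, toConn_single, sub_eq_zero]
    congr 1
    by_cases h : v = v'
    · rw [h]
    · exact SimpleGraph.ConnectedComponent.sound
        (SimpleGraph.Adj.reachable (G := G.spanning S) ⟨h, e, he, hl⟩)

section Rank

variable [Finite V(G)]

instance (S : Set E(G)) : Finite (G.Conn S) := Quot.finite _

/-- The rank function `|V| - k([G:S])` of the graphic matroid; the number `k([G:S])` of connected
components of `[G:S]` never exceeds `|V|`. -/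
def graphicRank (S : Set E(G)) : ℕ := Nat.card V(G) - Nat.card (G.Conn S)

theorem card_conn_le (S : Set E(G)) : Nat.card (G.Conn S) ≤ Nat.card V(G) :=
  Nat.card_le_card_of_surjective (G.spanning S).connectedComponentMk Quot.mk_surjective

theorem finrank_rhoTilde (S : Set E(G)) :
    Module.finrank ℤ (G.rhoTilde S) = G.graphicRank S := by
  have hsurj : Function.Surjective (G.toConn S) :=
    Finsupp.mapDomain_surjective Quot.mk_surjective
  have h1 := Submodule.finrank_quotient_add_finrank (G.rhoTilde S)
  rw [← ker_toConn, ((G.toConn S).quotKerEquivOfSurjective hsurj).finrank_eq, ker_toConn] at h1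
  have := Fintype.ofFinite V(G)
  have := Fintype.ofFinite (G.Conn S)
  rw [Module.finrank_finsupp_self, Module.finrank_finsupp_self] at h1
  rw [graphicRank, Nat.card_eq_fintype_card, Nat.card_eq_fintype_card]
  omega

theorem rhoTilde_eq_of_rank_eq {S T : Set E(G)} (h : S ⊆ T)
    (hr : G.graphicRank S = G.graphicRank T) : G.rhoTilde S = G.rhoTilde T := by
  refine le_antisymm (G.rhoTilde_mono h) (Submodule.span_le.2 ?_)
  rintro x ⟨e, he, v, v', hl, rfl⟩
  refine G.single_sub_mem_rhoTilde (SimpleGraph.ConnectedComponent.exact ?_)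
  have hc : Nat.card (G.Conn S) = Nat.card (G.Conn T) := by
    have h1 := G.card_conn_le S
    have h2 := G.card_conn_le T
    unfold graphicRank at hr
    omega
  have hb : Function.Bijective (G.connMap h) :=
    (Nat.bijective_iff_surjective_and_card _).2 ⟨G.connMap_surjective h, hc⟩
  apply hb.1
  rw [connMap_mk, connMap_mk]
  by_cases hv : v = v'
  · rw [hv]
  · exact SimpleGraph.ConnectedComponent.sound
      (SimpleGraph.Adj.reachable (G := G.spanning T) ⟨hv, e, he, hl⟩)

theorem graphicRank_mono (S T : Set E(G)) (h : S ⊆ T) : G.graphicRank S ≤ G.graphicRank T := by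
  rw [← finrank_rhoTilde, ← finrank_rhoTilde]
  exact Submodule.finrank_mono (G.rhoTilde_mono h)

theorem graphicRank_submod (S T : Set E(G)) :
    G.graphicRank (S ∩ T) + G.graphicRank (S ∪ T) ≤ G.graphicRank S + G.graphicRank T := by
  simp only [← finrank_rhoTilde]
  have h1 : G.rhoTilde (S ∪ T) ≤ G.rhoTilde S ⊔ G.rhoTilde T := by
    refine Submodule.span_le.2 ?_
    rintro x ⟨e, he | he, hx⟩
    · exact (le_sup_left : G.rhoTilde S ≤ _) (Submodule.subset_span ⟨e, he, hx⟩)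
    · exact (le_sup_right : G.rhoTilde T ≤ _) (Submodule.subset_span ⟨e, he, hx⟩)
  have h2 : G.rhoTilde (S ∩ T) ≤ G.rhoTilde S ⊓ G.rhoTilde T :=
    le_inf (G.rhoTilde_mono Set.inter_subset_left) (G.rhoTilde_mono Set.inter_subset_right)
  have h3 := Submodule.finrank_mono h1
  have h4 := Submodule.finrank_mono h2
  have h5 := Submodule.rank_sup_add_rank_inf_eq (G.rhoTilde S) (G.rhoTilde T)
  simp only [← Module.finrank_eq_rank] at h5
  norm_cast at h5
  omega

theorem graphicRank_le_ncard [Finite E(G)] (S : Set E(G)) : G.graphicRank S ≤ S.ncard := by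
  choose a b hab using fun e : E(G) => G.exists_isLink_of_mem_edgeSet e.2
  let f : E(G) → (V(G) →₀ ℤ) := fun e =>
    Finsupp.single ⟨a e, (hab e).left_mem⟩ 1 - Finsupp.single ⟨b e, (hab e).right_mem⟩ 1
  have h : G.rhoTilde S ≤ Submodule.span ℤ (f '' S) := by
    refine Submodule.span_le.2 ?_
    rintro x ⟨e, he, v, v', hl, rfl⟩
    have hf : f e ∈ Submodule.span ℤ (f '' S) := Submodule.subset_span ⟨e, he, rfl⟩
    rcases hl.eq_and_eq_or_eq_and_eq (hab e) with ⟨h1, h2⟩ | ⟨h1, h2⟩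
    · have : (Finsupp.single v 1 - Finsupp.single v' 1 : V(G) →₀ ℤ) = f e := by
        simp only [f]
        congr 2 <;> exact Subtype.ext (by assumption)
      rw [this]
      exact hf
    · have : (Finsupp.single v 1 - Finsupp.single v' 1 : V(G) →₀ ℤ) = -f e := by
        simp only [f, neg_sub]
        congr 2 <;> exact Subtype.ext (by assumption)
      rw [this]
      exact neg_mem hf
  rw [← finrank_rhoTilde]
  refine (Submodule.finrank_mono h).trans ?_
  have := (f '' S).toFinite.fintype
  refine (finrank_span_le_card (R := ℤ) (f '' S)).trans ?_
  rw [Set.toFinset_card, ← Nat.card_eq_fintype_card, Nat.card_coe_set_eq]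
  exact Set.ncard_image_le S.toFinite

/-- The graphic matroid `M(G)`, on the ground set `E(G)`. -/
def graphicMatroid [Finite E(G)] : Matroid E(G) :=
  matroidOfRank G.graphicRank G.graphicRank_le_ncard G.graphicRank_mono G.graphicRank_submod

end Rank

/-! ### The canonical quasi-representation -/

section Canonical

variable [LinearOrder V(G)]

/-- `v` is the minimal vertex `v_{S,F}` of its connected component `F` in `[G:S]`. -/
def IsMinVertex (S : Set E(G)) (v : V(G)) : Prop := ∀ w, (G.spanning S).Reachable v w → v ≤ w

/-- The submodule `I_G = ⟨min V(F) | F ∈ Conn(E(G))⟩` of `Ñ`. -/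
def minSubmodule : Submodule ℤ (V(G) →₀ ℤ) :=
  Submodule.span ℤ ((fun v => Finsupp.single v 1) '' {v | G.IsMinVertex Set.univ v})

theorem disjoint_rhoTilde_minSubmodule (S : Set E(G)) :
    Disjoint (G.rhoTilde S) G.minSubmodule := by
  rw [Submodule.disjoint_def]
  intro x hx hx'
  have h0 : G.toConn Set.univ x = 0 := by
    have := G.rhoTilde_mono (Set.subset_univ S) hx
    rwa [← ker_toConn, LinearMap.mem_ker] at this
  rw [minSubmodule, ← Finsupp.supported_eq_span_single] at hx'
  have hinj : Set.InjOn (G.spanning Set.univ).connectedComponentMk {v | G.IsMinVertex Set.univ v} := by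
    intro v hv w hw h
    have hr := SimpleGraph.ConnectedComponent.exact h
    exact le_antisymm (hv w hr) (hw v hr.symm)
  exact Finsupp.mapDomain_injOn _ hinj hx' (Submodule.zero_mem _ : (0 : V(G) →₀ ℤ) ∈
    Finsupp.supported ℤ ℤ {v | G.IsMinVertex Set.univ v}) (h0.trans (map_zero (G.toConn Set.univ)).symm)

variable [Finite V(G)]

theorem rhoTilde_sup_minSubmodule : G.rhoTilde Set.univ ⊔ G.minSubmodule = ⊤ := by
  rw [eq_top_iff]
  rintro x -
  induction x using Finsupp.induction_linear with
  | zero => exact Submodule.zero_mem _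
  | add f g hf hg => exact add_mem hf hg
  | single v a =>
    obtain ⟨w, hw, hmin⟩ := Set.exists_min_image {w | (G.spanning Set.univ).Reachable v w} id
      (Set.toFinite _) ⟨v, SimpleGraph.Reachable.refl v⟩
    have hw' : G.IsMinVertex Set.univ w := fun u hu => hmin u (SimpleGraph.Reachable.trans hw hu)
    have h1 := Submodule.mem_sup_left (T := G.minSubmodule) (G.single_sub_mem_rhoTilde hw)
    have h2 : (Finsupp.single w 1 : V(G) →₀ ℤ) ∈ G.rhoTilde Set.univ ⊔ G.minSubmodule :=
      Submodule.mem_sup_right (Submodule.subset_span ⟨w, hw', rfl⟩)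
    have := Submodule.smul_mem _ a (add_mem h1 h2)
    simpa using this

/-- The canonical `ℤ`-quasi-representation `ρ(S) = (ρ̃(S) + I_G) / I_G` of `M(G)`, with
`N = ρ(E(G)) = Ñ / I_G`. -/
def canonical [Finite E(G)] :
    QuasiRepresentation ℤ ((V(G) →₀ ℤ) ⧸ G.minSubmodule) G.graphicMatroid where
  ground_eq := rfl
  ρ S := (G.rhoTilde S).map G.minSubmodule.mkQ
  finrank_eq S := by
    have hinj : Function.Injective (G.minSubmodule.mkQ.domRestrict (G.rhoTilde S)) := by
      rw [← LinearMap.ker_eq_bot, eq_bot_iff]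
      rintro ⟨x, hx⟩ h
      have hx' : x ∈ G.minSubmodule := (Submodule.Quotient.mk_eq_zero _).1 h
      exact Subtype.ext (Submodule.disjoint_def.1 (G.disjoint_rhoTilde_minSubmodule S) x hx hx')
    have h := LinearMap.finrank_range_of_inj hinj
    rw [LinearMap.range_domRestrict, finrank_rhoTilde] at h
    rw [h, graphicMatroid, matroidOfRank_rk]
  empty := by
    have : G.rhoTilde ∅ = ⊥ := by simp [rhoTilde]
    rw [this, Submodule.map_bot]
  univ := by
    have h := congrArg (Submodule.map G.minSubmodule.mkQ) G.rhoTilde_sup_minSubmodule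
    rwa [Submodule.map_sup, Submodule.mkQ_map_self, sup_bot_eq, Submodule.map_top,
      Submodule.range_mkQ] at h
  mono h := Submodule.map_mono (G.rhoTilde_mono h)
  eq_of_rank_eq {S T} h hr := by
    rw [graphicMatroid, matroidOfRank_rk, matroidOfRank_rk, Nat.cast_inj] at hr
    rw [G.rhoTilde_eq_of_rank_eq h hr]

/-- The complex `C^{•,j}(M(G))` of the graphic matroid with its canonical quasi-representation. -/
def matroidComplex [Finite E(G)] [LinearOrder E(G)] (j : ℤ) : CochainComplex (ModuleCat ℤ) ℤ :=
  G.canonical.complex j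

end Canonical

/-! ### The chromatic complex -/

open Classical in
/-- For `S ⊆ T`, multiply the labels of the components of `[G:S]` which lie in the same component
of `[G:T]`. A labelling `c : Conn(S) → {1, x}` is encoded by the set `X = c⁻¹(x)`. If two
components labelled `x` lie in the same component of `[G:T]` the result is `0`, because `x * x = 0`;
otherwise the components of `[G:T]` labelled `x` are those which contain one labelled `x`. -/
def mergeLabels {S T : Set E(G)} (h : S ⊆ T) :
    (Finset (G.Conn S) →₀ ℤ) →ₗ[ℤ] (Finset (G.Conn T) →₀ ℤ) :=
  Finsupp.linearCombination ℤ fun X =>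
    if Set.InjOn (G.connMap h) X then Finsupp.single (X.image (G.connMap h)) 1 else 0

theorem mergeLabels_mergeLabels {S T U : Set E(G)} (h : S ⊆ T) (h' : T ⊆ U)
    (x : Finset (G.Conn S) →₀ ℤ) :
    G.mergeLabels h' (G.mergeLabels h x) = G.mergeLabels (h.trans h') x := by
  classical
  have hcomp : G.connMap h' ∘ G.connMap h = G.connMap (h.trans h') :=
    funext (G.connMap_connMap h h')
  induction x using Finsupp.induction_linear with
  | zero => simp
  | add f g hf hg => simp only [map_add, hf, hg]
  | single X a =>
    simp only [mergeLabels, Finsupp.linearCombination_single, map_smul]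
    congr 1
    by_cases h1 : Set.InjOn (G.connMap h) X
    · rw [if_pos h1, Finsupp.linearCombination_single, one_smul]
      have h2 : Set.InjOn (G.connMap h') (G.connMap h '' X) ↔
          Set.InjOn (G.connMap (h.trans h')) X := by
        rw [← hcomp]
        exact ⟨fun h2 => (Set.InjOn.comp_iff h1).2 h2, fun h2 => (Set.InjOn.comp_iff h1).1 h2⟩
      simp only [Finset.coe_image, h2, Finset.image_image, hcomp]
    · rw [if_neg h1, map_zero, if_neg]
      intro h2
      rw [← hcomp] at h2
      exact h1 (Set.InjOn.of_comp h2)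

/-- The module with basis the enhanced states `(S, c)` for every `S`, graded by
`j(S, c) = #c⁻¹(x)`. -/
def chromaticCube : GradedCube ℤ E(G) where
  obj S := Finset (G.Conn (S : Set E(G))) →₀ ℤ
  map h := G.mergeLabels (Finset.coe_subset.2 h)
  map_map h h' x := G.mergeLabels_mergeLabels _ _ x
  deg j _ := Finsupp.supported ℤ ℤ {X | (X.card : ℤ) = j}
  map_mem {S T} h j x hx := by
    classical
    rw [Finsupp.mem_supported] at hx
    rw [mergeLabels, Finsupp.linearCombination_apply]
    refine Submodule.sum_mem _ fun X hX => Submodule.smul_mem _ _ ?_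
    have hXj : (X.card : ℤ) = j := hx hX
    split_ifs with hinj
    · refine Finsupp.single_mem_supported ℤ _ ?_
      rw [Set.mem_ofPred_eq, Finset.card_image_of_injOn hinj, hXj]
    · exact Submodule.zero_mem _

/-- The chromatic complex `C^{•,j}(G)` of Helme-Guizon and Rong. -/
def chromaticComplex [LinearOrder E(G)] (j : ℤ) : CochainComplex (ModuleCat ℤ) ℤ :=
  G.chromaticCube.complex j

/-! ### The map from enhanced states to exterior products -/

section Theta

variable [LinearOrder V(G)] [Finite V(G)] [Finite E(G)]

/-- The product `v_{S,F₁} ∧ ⋯ ∧ v_{S,F_j}` in `⋀ (N / ρ(S))` of the classes of the minimal vertices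
of the components `X = {F₁, …, F_j}` of `[G:S]`, ordered so that `v_{S,F₁} < ⋯ < v_{S,F_j}`. -/
def wedge (S : Set E(G)) (X : Finset (G.Conn S)) :
    ExteriorAlgebra ℤ (((V(G) →₀ ℤ) ⧸ G.minSubmodule) ⧸ G.canonical.ρ S) :=
  ((((Set.toFinite {v | G.IsMinVertex S v ∧
    (G.spanning S).connectedComponentMk v ∈ X}).toFinset.sort (· ≤ ·)).map fun v =>
      ExteriorAlgebra.ι ℤ ((G.canonical.ρ S).mkQ (G.minSubmodule.mkQ (Finsupp.single v 1))))).prod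

/-- The linear map `θ : ⨁ C^{i,j}(G) → ⨁ C^{i,j}(M(G))` with `θ (S, X) = wedge S X`. -/
def theta : (∀ S, G.chromaticCube.obj S) →ₗ[ℤ] (∀ S, G.canonical.cube.obj S) :=
  LinearMap.pi fun S =>
    (Finsupp.linearCombination ℤ (G.wedge S) : (Finset (G.Conn (S : Set E(G))) →₀ ℤ) →ₗ[ℤ]
      ExteriorAlgebra ℤ (((V(G) →₀ ℤ) ⧸ G.minSubmodule) ⧸ G.canonical.ρ S)) ∘ₗ
        LinearMap.proj S

/-- The enhanced state `(S, c)` with `c⁻¹(x) = X`, as an element of `⨁ C^{i,j}(G)`. -/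
def state [DecidableEq E(G)] (S : Finset E(G)) (X : Finset (G.Conn (S : Set E(G)))) :
    ∀ S, G.chromaticCube.obj S :=
  Pi.single S (Finsupp.single X 1 : Finset (G.Conn (S : Set E(G))) →₀ ℤ)

open Classical in
/-- The linear map `τ : ⨁ C^{i,j-1}(M(G)) → ⨁ C^{i,j}(G)` is given by sending the exterior product
of the components in `X` to the enhanced state whose components labelled `x` are those in `X` and
the component of `v₀`, if the latter is not in `X`, and to `0` otherwise. -/
def IsTau (v₀ : V(G)) (τ : (∀ S, G.canonical.cube.obj S) →ₗ[ℤ] (∀ S, G.chromaticCube.obj S)) :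
    Prop :=
  ∀ (S : Finset E(G)) (X : Finset (G.Conn (S : Set E(G)))),
    τ (Pi.single S (G.wedge S X)) =
      if (G.spanning S).connectedComponentMk v₀ ∈ X then 0
      else G.state S (insert ((G.spanning S).connectedComponentMk v₀) X)

end Theta

end Graph

end

/-! Let F₀ be the component of v₀. The states in which F₀ carries x form a subcomplex of the
chromatic complex, because merging keeps that label; this is the complex of `rootedCube`, with
degrees shifted by one. Multiplying the label of F₀ by x is a chain map onto the rooted states, and
since x² = 0 its kernel is again the rooted states. This gives a short exact sequence rooted →
chromatic → rooted (`shortExact_rooted`).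

For each S the components other than F₀ index a basis of N/ρ(S), while v_{S,F₀} = 0. Hence the
products v_{S,X} with F₀ ∉ X form a basis of the exterior algebra, τ is well defined and injective
with the rooted states as image, and τ ∘ θ is multiplication by x at F₀ (`exists_tau`). So ker θ =
im τ, which is exactness at the level of groups.

In general θ is not a chain map: merging can change the order of the minimal vertices, and then the
exterior product acquires a sign that the commutative product of labels does not see. The maps f and
g therefore come from an abstract isomorphism, for each j, between the matroid complex and the
rooted complex. Both are bounded complexes of finitely generated free groups with the same ranks
(compared by τ), and both have torsion-free cohomology concentrated in degree ρ - j, where ρ is the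
rank of M(G). Over a principal ideal domain such complexes are determined by their ranks
(`CochainComplex.IsConcentrated.nonempty_iso`).

Concentration (`IsMatroidal.concentratedOn`) is proved for both cubes at once, by induction over
intervals [A, B], with A contracted and the complement of B deleted. Let e be the largest element of
B ∖ A. If e is a loop after contracting A, the interval is acyclic. If e is neither a loop nor a
bridge, deletion and contraction have cohomology in the same degree. If e is a bridge, the kernel of
obj S → obj (S ∪ e) is a copy of obj (S ∪ e) shifted by one, and the interval reduces to the
contraction. The shift is described by `KoszulOperators`: for exterior algebras, product and
contraction with the vector of the bridge; for labellings, a signed multiplication by the difference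
of the labels at its two ends. -/

noncomputable section

/-! ### Cohomology of intervals in a cube -/

namespace GradedCube

variable {R : Type*} [CommRing R] {E : Type*}

/-- The cochains of bidegree `(i, j)` supported on the sets which contain `A`. -/
def chainAbove (K : GradedCube R E) (A : Finset E) (i j : ℤ) : Submodule R (∀ S, K.obj S) :=
  K.chain i j ⊓ ⨅ S : {S : Finset E // ¬ A ⊆ S}, LinearMap.ker (LinearMap.proj S.1)

theorem mem_chainAbove {K : GradedCube R E} {A : Finset E} {i j : ℤ} {x : ∀ S, K.obj S} :
    x ∈ K.chainAbove A i j ↔ x ∈ K.chain i j ∧ ∀ S, ¬ A ⊆ S → x S = 0 := by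
  simp [chainAbove]

variable [LinearOrder E]

theorem diff_mem_chainAbove {K : GradedCube R E} {A : Finset E} {i i' j : ℤ} (h : i + 1 = i')
    {x : ∀ S, K.obj S} (hx : x ∈ K.chainAbove A i j) : K.diff x ∈ K.chainAbove A i' j := by
  rw [mem_chainAbove] at hx ⊢
  refine ⟨K.diff_mem h j x hx.1, fun T hT => ?_⟩
  rw [diff_apply]
  refine Finset.sum_eq_zero fun e _ => ?_
  rw [hx.2 _ fun h => hT (h.trans (Finset.erase_subset _ _)), map_zero, smul_zero]

theorem diff_congr (K : GradedCube R E) {B : Finset E} {x y : ∀ S, K.obj S}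
    (h : ∀ T ⊆ B, x T = y T) {T : Finset E} (hT : T ⊆ B) : K.diff x T = K.diff y T := by
  rw [diff_apply, diff_apply]
  exact Finset.sum_congr rfl fun e _ => by rw [h _ ((Finset.erase_subset _ _).trans hT)]

theorem diff_eq_zero_of_diff_eq (K : GradedCube R E) {B : Finset E} {x y : ∀ S, K.obj S}
    (h : ∀ T ⊆ B, K.diff y T = x T) {T : Finset E} (hT : T ⊆ B) : K.diff x T = 0 := by
  rw [← K.diff_congr h hT, diff_diff, Pi.zero_apply]

/-- The differential on sets containing e splits into the map which adds e and the differential of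
the contraction by e. All arguments with a distinguished edge use this form. -/
theorem diff_insert (K : GradedCube R E) (x : ∀ S, K.obj S) {S : Finset E} {e : E} (he : e ∉ S) :
    K.diff x (insert e S) = edgeSign S e • K.map (Finset.subset_insert e S) (x S) +
      ∑ f ∈ S, edgeSign (insert e (S.erase f)) f •
        K.map (Finset.insert_subset_insert e (Finset.erase_subset f S))
          (x (insert e (S.erase f))) := by
  rw [diff_apply, Finset.sum_insert he]
  congr 1
  · rw [K.map_congr x (Finset.erase_insert he) _ (Finset.subset_insert e S),
      Finset.erase_insert he]
  · refine Finset.sum_congr rfl fun f hf => ?_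
    have hne : e ≠ f := fun h => he (h ▸ hf)
    have hS : (insert e S).erase f = insert e (S.erase f) := Finset.erase_insert_of_ne hne
    rw [K.map_congr x hS _ (Finset.insert_subset_insert e (Finset.erase_subset f S)), hS]

/-- This is why the distinguished edge is always the largest one: contracting it leaves the signs of
the remaining edges unchanged. -/
theorem edgeSign_insert_of_lt {S : Finset E} {e f : E} (h : f < e) :
    edgeSign (insert e S) f = edgeSign S f := by
  rw [edgeSign, Finset.filter_insert, if_neg h.not_gt, edgeSign]

theorem edgeSign_mul_self (S : Finset E) (e : E) : edgeSign S e * edgeSign S e = 1 := by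
  rw [edgeSign, ← pow_add, Even.neg_one_pow (Even.add_self _)]

/-- The interval `[A, B]` of the cube `K` has its degree `j` cohomology concentrated in the
cohomological degree `k`, and this cohomology is torsion-free. -/
structure ConcentratedOn (K : GradedCube R E) (A B : Finset E) (j k : ℤ) : Prop where
  exact : ∀ i, i ≠ k → ∀ x ∈ K.chainAbove A i j, (∀ T ⊆ B, K.diff x T = 0) →
    ∃ y ∈ K.chainAbove A (i - 1) j, ∀ T ⊆ B, K.diff y T = x T
  saturated : ∀ n : R, n ≠ 0 → ∀ x ∈ K.chainAbove A k j, ∀ y ∈ K.chainAbove A (k - 1) j,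
    (∀ T ⊆ B, K.diff y T = n • x T) → ∃ z ∈ K.chainAbove A (k - 1) j, ∀ T ⊆ B, K.diff z T = x T

/-- Operators which identify the kernel of `K.obj S → K.obj (S ∪ e)` with `K.obj (S ∪ e)`, with
the degree shifted by one, naturally in `S ⊆ B`. -/
structure KoszulOperators (K : GradedCube R E) (B : Finset E) (e : E) where
  mul : ∀ S, K.obj S →ₗ[R] K.obj S
  contract : ∀ S, K.obj S →ₗ[R] K.obj S
  lift : ∀ S, K.obj (insert e S) →ₗ[R] K.obj S
  mul_mem : ∀ {S}, S ⊆ B → ∀ {j x}, x ∈ K.deg j S → mul S x ∈ K.deg (j + 1) S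
  contract_mem : ∀ {S}, S ⊆ B → ∀ {j x}, x ∈ K.deg j S → contract S x ∈ K.deg (j - 1) S
  lift_mem : ∀ {S}, S ⊆ B → ∀ {j x}, x ∈ K.deg j (insert e S) → lift S x ∈ K.deg j S
  map_mul : ∀ {S T} (h : S ⊆ T), T ⊆ B → ∀ x, K.map h (mul S x) = mul T (K.map h x)
  map_lift : ∀ {S}, S ⊆ B → ∀ x, K.map (Finset.subset_insert e S) (lift S x) = x
  lift_map : ∀ {S}, S ⊆ B → ∀ x,
    lift S (K.map (Finset.subset_insert e S) x) = x - mul S (contract S x)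
  map_insert_mul : ∀ {S}, S ⊆ B → ∀ x, K.map (Finset.subset_insert e S) (mul S x) = 0
  mul_contract_add : ∀ {S}, S ⊆ B → ∀ x, mul S (contract S x) + contract S (mul S x) = x

namespace KoszulOperators

variable {K : GradedCube R E} {B : Finset E} {e : E} (O : K.KoszulOperators B e) {S : Finset E}

theorem eq_mul_contract (hS : S ⊆ B) {x : K.obj S}
    (hx : K.map (Finset.subset_insert e S) x = 0) : O.mul S (O.contract S x) = x := by
  have := O.lift_map hS x
  rw [hx, map_zero] at this
  exact (sub_eq_zero.1 this.symm).symm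

/-- Not an axiom but a consequence: write M, C for `mul` and `contract`. As M y lies in the kernel
of the map adding e, MCM = M; comparing with M(MC + CM) = M gives MMC = 0, and MM = MM(MC + CM) then
vanishes. -/
theorem mul_mul (hS : S ⊆ B) (x : K.obj S) : O.mul S (O.mul S x) = 0 := by
  have h1 : ∀ y, O.mul S (O.mul S (O.contract S y)) = 0 := fun y => by
    have h2 := congrArg (O.mul S) (O.mul_contract_add hS y)
    rw [map_add, O.eq_mul_contract hS (O.map_insert_mul hS y)] at h2
    simpa using h2
  have h2 := congrArg (fun y => O.mul S (O.mul S y)) (O.mul_contract_add hS x)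
  simp only [map_add, h1, zero_add] at h2
  exact h2.symm

theorem map_eq_zero_of_mul_eq_zero (hS : S ⊆ B) {x : K.obj S} (hx : O.mul S x = 0) :
    K.map (Finset.subset_insert e S) x = 0 := by
  have := O.mul_contract_add hS x
  rw [hx, map_zero, add_zero] at this
  rw [← this, O.map_insert_mul hS]

theorem mul_lift_map (hS : S ⊆ B) (x : K.obj S) :
    O.mul S (O.lift S (K.map (Finset.subset_insert e S) x)) = O.mul S x := by
  rw [O.lift_map hS, map_sub, O.mul_mul hS, sub_zero]

end KoszulOperators

/-! ### Loops, and edges that are neither loops nor bridges -/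

section Interval

variable {K : GradedCube R E} {A B : Finset E} {e : E} {i j k : ℤ}

/-- A cochain can be modified by a coboundary so that it vanishes on the sets containing `e`. -/
theorem exists_sub_diff_insert_eq_zero (heA : e ∉ A) (heB : e ∉ B)
    (hsurj : ∀ S, A ⊆ S → S ⊆ B → ∀ y ∈ K.deg j (insert e S), ∃ x ∈ K.deg j S,
      K.map (Finset.subset_insert e S) x = y) {x : ∀ S, K.obj S} (hx : x ∈ K.chainAbove A i j) :
    ∃ a ∈ K.chainAbove A (i - 1) j, ∀ S ⊆ B, (x - K.diff a) (insert e S) = 0 := by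
  classical
  rw [mem_chainAbove] at hx
  choose s hs1 hs2 using fun (S : Finset E) (h : A ⊆ S) (h' : S ⊆ B) =>
    hsurj S h h' _ (hx.1 (insert e S)).1
  -- The factor `edgeSign S e` cancels the same sign in the differential. As `a` vanishes on all
  -- sets containing `e`, the contraction part of `diff_insert` contributes nothing.
  let a : ∀ S, K.obj S := fun S =>
    if h : A ⊆ S ∧ S ⊆ B ∧ (S.card : ℤ) = i - 1 then edgeSign S e • s S h.1 h.2.1 else 0
  have hins : ∀ S, ¬ insert e S ⊆ B := fun S h => heB (h (Finset.mem_insert_self e S))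
  refine ⟨a, mem_chainAbove.2 ⟨fun S => ⟨?_, fun h => dif_neg fun h' => h h'.2.2⟩,
    fun S h => dif_neg fun h' => h h'.1⟩, fun S hS => ?_⟩
  · simp only [a]
    split_ifs with h
    · exact zsmul_mem (hs1 _ _ _) _
    · exact Submodule.zero_mem _
  · have heS : e ∉ S := fun h => heB (hS h)
    rw [Pi.sub_apply, diff_insert K a heS, Finset.sum_eq_zero, add_zero]
    · by_cases hc : A ⊆ S ∧ (S.card : ℤ) = i - 1
      · have : a S = edgeSign S e • s S hc.1 hS := dif_pos ⟨hc.1, hS, hc.2⟩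
        rw [this, map_zsmul, smul_smul, edgeSign_mul_self, one_smul, hs2, sub_self]
      · have h0 : a S = 0 := dif_neg fun h => hc ⟨h.1, h.2.2⟩
        rw [h0, map_zero, smul_zero, sub_zero]
        by_cases hA : A ⊆ S
        · refine (hx.1 _).2 fun h => hc ⟨hA, ?_⟩
          rw [Finset.card_insert_of_notMem heS] at h
          push_cast at h
          omega
        · exact hx.2 _ fun h => hA ((Finset.subset_insert_iff_of_notMem heA).1 h)
    · intro f _
      have h0 : a (insert e (S.erase f)) = 0 := dif_neg fun h => hins _ h.2.1
      rw [h0, map_zero, smul_zero]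

theorem diff_insert_of_forall_eq_zero (heB : e ∉ B) {x : ∀ S, K.obj S}
    (hx : ∀ S ⊆ B, x (insert e S) = 0) {S : Finset E} (hS : S ⊆ B) :
    K.diff x (insert e S) = edgeSign S e • K.map (Finset.subset_insert e S) (x S) := by
  rw [diff_insert K x fun h => heB (hS h), Finset.sum_eq_zero, add_zero]
  intro f _
  rw [hx _ ((Finset.erase_subset _ _).trans hS), map_zero, smul_zero]

theorem map_eq_zero_of_forall_eq_zero (heB : e ∉ B) {x : ∀ S, K.obj S}
    (hx : ∀ S ⊆ B, x (insert e S) = 0) {S : Finset E} (hS : S ⊆ B)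
    (hd : K.diff x (insert e S) = 0) : K.map (Finset.subset_insert e S) (x S) = 0 := by
  rw [diff_insert_of_forall_eq_zero heB hx hS] at hd
  have := congrArg (edgeSign S e • ·) hd
  simpa only [smul_smul, edgeSign_mul_self, one_smul, smul_zero] using this

/-- It is enough to compare cochains on the sets `S` and `S ∪ e` for `S ⊆ B`. -/
theorem forall_subset_insert {P : Finset E → Prop} (h : ∀ S ⊆ B, P S)
    (h' : ∀ S ⊆ B, P (insert e S)) : ∀ T ⊆ insert e B, P T := by
  intro T hT
  by_cases he : e ∈ T
  · rw [← Finset.insert_erase he]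
    refine h' _ ?_
    rwa [← Finset.subset_insert_iff]
  · exact h _ ((Finset.subset_insert_iff_of_notMem he).1 hT)

/-- If n x is a coboundary, torsion-freeness makes x a cocycle, so full exactness already yields
saturation and k is arbitrary. -/
theorem ConcentratedOn.of_exact
    (htf : ∀ (S : Finset E) (n : R) (x : K.obj S), n ≠ 0 → n • x = 0 → x = 0)
    (h : ∀ i, ∀ x ∈ K.chainAbove A i j, (∀ T ⊆ B, K.diff x T = 0) →
      ∃ y ∈ K.chainAbove A (i - 1) j, ∀ T ⊆ B, K.diff y T = x T) : K.ConcentratedOn A B j k := by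
  refine ⟨fun i _ => h i, fun n hn x hx y _ hxy => h _ x hx fun T hT => htf _ n _ hn ?_⟩
  rw [← Pi.smul_apply, ← map_smul]
  exact K.diff_eq_zero_of_diff_eq hxy hT

/-- The interval `[A, B ∪ e]` is exact if `e` does not change the modules above `A`. -/
theorem concentratedOn_of_bijective
    (htf : ∀ (S : Finset E) (n : R) (x : K.obj S), n ≠ 0 → n • x = 0 → x = 0)
    (heA : e ∉ A) (heB : e ∉ B)
    (hinj : ∀ S, A ⊆ S → Function.Injective (K.map (Finset.subset_insert e S)))
    (hsurj : ∀ S, A ⊆ S → ∀ y ∈ K.deg j (insert e S), ∃ x ∈ K.deg j S,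
      K.map (Finset.subset_insert e S) x = y) : K.ConcentratedOn A (insert e B) j k := by
  refine .of_exact htf fun i x hx hd => ?_
  obtain ⟨a, ha, hxa⟩ := exists_sub_diff_insert_eq_zero heA heB (fun S h _ => hsurj S h) hx
  refine ⟨a, ha, ?_⟩
  have hx' : x - K.diff a ∈ K.chainAbove A i j :=
    sub_mem hx (diff_mem_chainAbove (by ring) ha)
  have key : ∀ T ⊆ insert e B, (x - K.diff a) T = 0 := by
    refine forall_subset_insert (fun S hS => ?_) hxa
    by_cases hA : A ⊆ S
    · refine (map_eq_zero_iff _ (hinj S hA)).1 (map_eq_zero_of_forall_eq_zero heB hxa hS ?_)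
      rw [map_sub, diff_diff, sub_zero]
      exact hd _ (Finset.insert_subset_insert e hS)
    · exact (mem_chainAbove.1 hx').2 S hA
  exact fun T hT => (sub_eq_zero.1 (key T hT)).symm

/-- The long exact sequence of deletion and contraction, for cohomology concentrated in the same
degree. -/
theorem ConcentratedOn.of_delete_contract (heB : e ∉ B)
    (hc : K.ConcentratedOn (insert e A) (insert e B) j k) (hd : K.ConcentratedOn A B j k) :
    K.ConcentratedOn A (insert e B) j k := by
  have hle : ∀ {i} {x : ∀ S, K.obj S}, x ∈ K.chainAbove (insert e A) i j →
      x ∈ K.chainAbove A i j := fun {i x} hx => by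
    rw [mem_chainAbove] at hx ⊢
    exact ⟨hx.1, fun S hS => hx.2 S fun h => hS ((Finset.subset_insert _ _).trans h)⟩
  have hsub : B ⊆ insert e B := Finset.subset_insert e B
  -- the part supported on the sets containing `e`
  have hpart : ∀ {i} {x : ∀ S, K.obj S}, x ∈ K.chainAbove A i j → ∃ x' ∈
      K.chainAbove (insert e A) i j, ∀ S, e ∈ S → x' S = x S := by
    intro i x hx
    rw [mem_chainAbove] at hx
    refine ⟨fun S => if e ∈ S then x S else 0, mem_chainAbove.2 ⟨fun S => ⟨?_, fun h => ?_⟩,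
      fun S hS => ?_⟩, fun S hS => if_pos hS⟩
    · dsimp only
      split_ifs
      · exact (hx.1 S).1
      · exact Submodule.zero_mem _
    · simp [(hx.1 S).2 h]
    · by_cases he : e ∈ S
      · rw [if_pos he]
        exact hx.2 S fun h => hS (Finset.insert_subset he h)
      · exact if_neg he
  have hpart' : ∀ {i} {x : ∀ S, K.obj S}, x ∈ K.chainAbove A i j → (∀ S ⊆ B, x S = 0) → ∃ x' ∈
      K.chainAbove (insert e A) i j, ∀ T ⊆ insert e B, x' T = x T := by
    intro i x hx h0
    obtain ⟨x', hx', h⟩ := hpart hx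
    refine ⟨x', hx', forall_subset_insert (fun S hS => ?_) fun S _ =>
      h _ (Finset.mem_insert_self _ _)⟩
    rw [h0 S hS]
    exact (mem_chainAbove.1 hx').2 S fun h => heB (hS (h (Finset.mem_insert_self _ _)))
  constructor
  · intro i hi x hx hdx
    obtain ⟨a, ha, hxa⟩ := hd.exact i hi x hx fun T hT => hdx T (hT.trans hsub)
    have hmem : x - K.diff a ∈ K.chainAbove A i j := sub_mem hx (diff_mem_chainAbove (by ring) ha)
    obtain ⟨x', hx', hxx⟩ := hpart' hmem fun S hS => by rw [Pi.sub_apply, hxa S hS, sub_self]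
    obtain ⟨b, hb, hxb⟩ := hc.exact i hi x' hx' fun T hT => by
      rw [K.diff_congr hxx hT, map_sub, diff_diff, sub_zero, hdx T hT]
    refine ⟨a + b, add_mem ha (hle hb), fun T hT => ?_⟩
    rw [map_add, Pi.add_apply, hxb T hT, hxx T hT, Pi.sub_apply, add_sub_cancel]
  · intro n hn x hx y hy hxy
    obtain ⟨a, ha, hxa⟩ := hd.saturated n hn x hx y hy fun T hT => hxy T (hT.trans hsub)
    have hmem : x - K.diff a ∈ K.chainAbove A k j := sub_mem hx (diff_mem_chainAbove (by ring) ha)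
    obtain ⟨x', hx', hxx⟩ := hpart' hmem fun S hS => by rw [Pi.sub_apply, hxa S hS, sub_self]
    -- On [A, B] both y and n a have differential n x, so y - n a is a cocycle there in degree k -
    -- 1. It is exact because the deletion is concentrated in k; correcting by c moves the equation
    -- to the contraction.
    have hya : y - n • a ∈ K.chainAbove A (k - 1) j := sub_mem hy (Submodule.smul_mem _ _ ha)
    obtain ⟨c, hc', hyc⟩ := hd.exact (k - 1) (by omega) _ hya fun T hT => by
      rw [map_sub, map_smul, Pi.sub_apply, Pi.smul_apply, hxa T hT, hxy T (hT.trans hsub),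
        sub_self]
    have hmem' : y - n • a - K.diff c ∈ K.chainAbove A (k - 1) j :=
      sub_mem hya (diff_mem_chainAbove (by ring) hc')
    obtain ⟨y', hy', hyy⟩ := hpart' hmem' fun S hS => by rw [Pi.sub_apply, hyc S hS, sub_self]
    obtain ⟨b, hb, hxb⟩ := hc.saturated n hn x' hx' y' hy' fun T hT => by
      rw [K.diff_congr hyy hT, map_sub, diff_diff, sub_zero, map_sub, map_smul, Pi.sub_apply,
        Pi.smul_apply, hxy T hT, hxx T hT, Pi.sub_apply, smul_sub]
    refine ⟨a + b, add_mem ha (hle hb), fun T hT => ?_⟩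
    rw [map_add, Pi.add_apply, hxb T hT, hxx T hT, Pi.sub_apply, add_sub_cancel]

end Interval

end GradedCube

namespace GradedCube

variable {R : Type*} [CommRing R] {E : Type*} [LinearOrder E]

/-! ### Bridges -/

section Bridge

variable {K : GradedCube R E} {A B : Finset E} {e : E} {i j k : ℤ}

theorem subset_insert_of_mem_chainAbove_eq_zero {x : ∀ S, K.obj S} (heB : e ∉ B)
    (hx : x ∈ K.chainAbove (insert e A) i j) {S : Finset E} (hS : S ⊆ B) : x S = 0 :=
  (mem_chainAbove.1 hx).2 S fun h => heB (hS (h (Finset.mem_insert_self e A)))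

/-- The shift of a cochain of the contraction of a bridge. -/
theorem KoszulOperators.exists_shift_down (O : K.KoszulOperators B e) (heA : e ∉ A) (heB : e ∉ B)
    (hlt : ∀ f ∈ B, f ∉ A → f < e) {v : ∀ S, K.obj S}
    (hv : v ∈ K.chainAbove (insert e A) i (j - 1)) :
    ∃ a ∈ K.chainAbove A (i - 1) j,
      (∀ S ⊆ B, K.diff a S = O.mul S (O.lift S (K.diff v (insert e S)))) ∧
        ∀ S ⊆ B, K.diff a (insert e S) = 0 := by
  classical
  have hv' := mem_chainAbove.1 hv
  -- `lift` brings v (S ∪ e) down to S and `mul` places it in the kernel of the map back to S ∪ e.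
  -- This lowers the cochain degree by one and raises the internal degree by one.
  let a : ∀ S, K.obj S := fun S => if S ⊆ B then O.mul S (O.lift S (v (insert e S))) else 0
  have ha : ∀ S ⊆ B, a S = O.mul S (O.lift S (v (insert e S))) := fun S hS => if_pos hS
  have ha' : ∀ S, ¬ S ⊆ B → a S = 0 := fun S hS => if_neg hS
  have hins : ∀ S, ¬ insert e S ⊆ B := fun S h => heB (h (Finset.mem_insert_self e S))
  refine ⟨a, mem_chainAbove.2 ⟨fun S => ?_, fun S hS => ?_⟩, fun S hS => ?_, fun S hS => ?_⟩
  · by_cases hS : S ⊆ B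
    · rw [ha S hS]
      refine ⟨?_, fun h => ?_⟩
      · have := O.mul_mem hS (O.lift_mem hS (hv'.1 (insert e S)).1)
        rwa [sub_add_cancel] at this
      · rw [(hv'.1 (insert e S)).2, map_zero, map_zero]
        rw [Finset.card_insert_of_notMem fun h => heB (hS h)]
        push_cast
        omega
    · rw [ha' S hS]
      exact ⟨Submodule.zero_mem _, fun _ => rfl⟩
  · by_cases hSB : S ⊆ B
    · rw [ha S hSB, hv'.2, map_zero, map_zero]
      intro h
      refine hS fun f hf => ?_
      rcases Finset.mem_insert.1 (h (Finset.mem_insert_of_mem hf)) with rfl | h'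
      · exact absurd hf heA
      · exact h'
    · exact ha' S hSB
  · have heS : e ∉ S := fun h => heB (hS h)
    rw [diff_insert K v heS, subset_insert_of_mem_chainAbove_eq_zero heB hv hS, map_zero, smul_zero,
      zero_add, diff_apply, map_sum, map_sum]
    refine Finset.sum_congr rfl fun f hf => ?_
    have hSf : S.erase f ⊆ B := (Finset.erase_subset _ _).trans hS
    rw [ha _ hSf, map_zsmul, map_zsmul]
    by_cases hA : insert e A ⊆ insert e (S.erase f)
    · have hfe : f < e := by
        refine hlt f (hS hf) fun hfA => ?_
        rcases Finset.mem_insert.1 (hA (Finset.mem_insert_of_mem hfA)) with rfl | h'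
        · exact heS hf
        · exact Finset.notMem_erase f S h'
      rw [edgeSign_insert_of_lt hfe, O.map_mul _ hS]
      congr 1
      -- Lifting at S ∖ f and then mapping to S differs from mapping first and lifting at S only by
      -- an element of the image of `mul`, which `mul` kills.
      conv_rhs => rw [← O.map_lift hSf (v (insert e (S.erase f))), K.map_map,
        ← K.map_map (Finset.erase_subset f S) (Finset.subset_insert e S), O.mul_lift_map hS]
    · rw [hv'.2 _ hA]
      simp
  · rw [diff_insert K a fun h => heB (hS h), ha S hS, O.map_insert_mul hS, smul_zero, zero_add]
    refine Finset.sum_eq_zero fun f _ => ?_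
    rw [ha' _ (hins _), map_zero, smul_zero]

/-- The inverse of the shift, on cochains which vanish on the sets containing the bridge and are
killed by adding the bridge. -/
theorem KoszulOperators.exists_shift_up (O : K.KoszulOperators B e) (heB : e ∉ B)
    (hlt : ∀ f ∈ B, f ∉ A → f < e) {x : ∀ S, K.obj S} (hx : x ∈ K.chainAbove A i j)
    (hker : ∀ S ⊆ B, K.map (Finset.subset_insert e S) (x S) = 0) :
    ∃ w ∈ K.chainAbove (insert e A) (i + 1) (j - 1),
      (∀ S ⊆ B, w (insert e S) = K.map (Finset.subset_insert e S) (O.contract S (x S))) ∧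
        ∀ S ⊆ B, ∃ u, K.diff w (insert e S) = K.map (Finset.subset_insert e S) u ∧
          O.mul S u = K.diff x S := by
  classical
  have hx' := mem_chainAbove.1 hx
  let y : ∀ S, K.obj S := fun S => O.contract S (x S)
  let w : ∀ S, K.obj S := fun T =>
    if e ∈ T ∧ T.erase e ⊆ B then K.map (Finset.erase_subset e T) (y (T.erase e)) else 0
  have hw : ∀ S ⊆ B, w (insert e S) = K.map (Finset.subset_insert e S) (y S) := by
    intro S hS
    have hS' : (insert e S).erase e = S := Finset.erase_insert fun h => heB (hS h)
    have : w (insert e S) = K.map (Finset.erase_subset e _) (y ((insert e S).erase e)) :=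
      if_pos ⟨Finset.mem_insert_self e S, by rwa [hS']⟩
    rw [this, K.map_congr y hS']
  have hw' : ∀ S, e ∉ S → w S = 0 := fun S hS => if_neg fun h => hS h.1
  refine ⟨w, mem_chainAbove.2 ⟨fun S => ⟨?_, fun h => ?_⟩, fun S hS => ?_⟩, hw, fun S hS => ?_⟩
  · simp only [w]
    split_ifs with h
    · exact K.map_mem _ _ _ (O.contract_mem h.2 (hx'.1 _).1)
    · exact Submodule.zero_mem _
  · simp only [w]
    split_ifs with h'
    · have h0 : y (S.erase e) = 0 := by
        simp only [y]
        rw [(hx'.1 _).2, map_zero]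
        have := Finset.card_erase_add_one h'.1
        omega
      rw [h0, map_zero]
    · rfl
  · simp only [w]
    split_ifs with h'
    · have h0 : y (S.erase e) = 0 := by
        simp only [y]
        rw [hx'.2, map_zero]
        intro hA
        exact hS (Finset.insert_subset h'.1 (hA.trans (Finset.erase_subset _ _)))
      rw [h0, map_zero]
    · rfl
  · have heS : e ∉ S := fun h => heB (hS h)
    -- The witness u is the differential of the contracted cochain `y`, restricted to sets without
    -- e. As `contract` need not commute with the cube maps, only `mul` u is compared with the
    -- differential of x.
    refine ⟨∑ f ∈ S, edgeSign (S.erase f) f • K.map (Finset.erase_subset f S) (y (S.erase f)),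
      ?_, ?_⟩
    · rw [diff_insert K w heS, hw' S heS, map_zero, smul_zero, zero_add, map_sum]
      refine Finset.sum_congr rfl fun f hf => ?_
      rw [hw _ ((Finset.erase_subset _ _).trans hS), map_zsmul, K.map_map, K.map_map]
      by_cases hA : A ⊆ S.erase f
      · rw [edgeSign_insert_of_lt]
        exact hlt f (hS hf) fun hfA => Finset.notMem_erase f S (hA hfA)
      · have h0 : y (S.erase f) = 0 := by
          simp only [y]
          rw [hx'.2 _ hA, map_zero]
        simp [h0]
    · rw [map_sum, diff_apply]
      refine Finset.sum_congr rfl fun f hf => ?_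
      have hSf := (Finset.erase_subset f S).trans hS
      rw [map_zsmul, ← O.map_mul _ hS, O.eq_mul_contract hSf (hker _ hSf)]

/-- The cohomology of a graph with a bridge is that of its contraction, with a shift. -/
theorem ConcentratedOn.of_contract
    (htf : ∀ (S : Finset E) (n : R) (x : K.obj S), n ≠ 0 → n • x = 0 → x = 0)
    (O : K.KoszulOperators B e) (heA : e ∉ A) (heB : e ∉ B)
    (hlt : ∀ f ∈ B, f ∉ A → f < e)
    (hc : K.ConcentratedOn (insert e A) (insert e B) (j - 1) (k + 1)) :
    K.ConcentratedOn A (insert e B) j k := by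
  have hsub : B ⊆ insert e B := Finset.subset_insert e B
  -- Modulo coboundaries a cochain may be assumed to vanish on sets containing e; a cocycle then
  -- takes values in the kernels of the maps adding e, where the shift is invertible.
  have hclear := fun {i : ℤ} {x : ∀ S, K.obj S} => exists_sub_diff_insert_eq_zero (K := K)
    (i := i) (j := j) (x := x) heA heB fun S _ hS y hy => ⟨_, O.lift_mem hS hy, O.map_lift hS y⟩
  have hfinish : ∀ {i : ℤ} {x a w v : ∀ S, K.obj S}, a ∈ K.chainAbove A (i - 1) j →
      (∀ S ⊆ B, (x - K.diff a) (insert e S) = 0) →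
      (∀ S ⊆ B, K.map (Finset.subset_insert e S) ((x - K.diff a) S) = 0) →
      (∀ S ⊆ B, w (insert e S) =
        K.map (Finset.subset_insert e S) (O.contract S ((x - K.diff a) S))) →
      v ∈ K.chainAbove (insert e A) (i + 1 - 1) (j - 1) →
      (∀ T ⊆ insert e B, K.diff v T = w T) →
      ∃ z ∈ K.chainAbove A (i - 1) j, ∀ T ⊆ insert e B, K.diff z T = x T := by
    intro i x a w v ha hxa hker hw hv hvw
    obtain ⟨b, hb, hb1, hb2⟩ := O.exists_shift_down heA heB hlt hv
    rw [add_sub_cancel_right] at hb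
    refine ⟨a + b, add_mem ha hb, forall_subset_insert (fun S hS => ?_) fun S hS => ?_⟩
    · rw [map_add, Pi.add_apply, hb1 S hS, hvw _ (Finset.insert_subset_insert e hS), hw S hS,
        O.mul_lift_map hS, O.eq_mul_contract hS (hker S hS), Pi.sub_apply, add_sub_cancel]
    · rw [map_add, Pi.add_apply, hb2 S hS, add_zero]
      exact (sub_eq_zero.1 (hxa S hS)).symm
  constructor
  · intro i hi x hx hdx
    obtain ⟨a, ha, hxa⟩ := hclear hx
    have hmem : x - K.diff a ∈ K.chainAbove A i j := sub_mem hx (diff_mem_chainAbove (by ring) ha)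
    have hd : ∀ T ⊆ insert e B, K.diff (x - K.diff a) T = 0 := fun T hT => by
      rw [map_sub, diff_diff, sub_zero, hdx T hT]
    have hker : ∀ S ⊆ B, K.map (Finset.subset_insert e S) ((x - K.diff a) S) = 0 :=
      fun S hS => map_eq_zero_of_forall_eq_zero heB hxa hS
      (hd _ (Finset.insert_subset_insert e hS))
    obtain ⟨w, hw, hw1, hw2⟩ := O.exists_shift_up heB hlt hmem hker
    -- The shifted cochain is a cocycle: its differential at S ∪ e is the image of some u with `mul`
    -- u = 0, and such a u maps to zero.
    obtain ⟨v, hv, hvw⟩ := hc.exact (i + 1) (by omega) w hw <| by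
      refine forall_subset_insert (fun S hS => ?_) fun S hS => ?_
      · exact subset_insert_of_mem_chainAbove_eq_zero heB (diff_mem_chainAbove rfl hw) hS
      · obtain ⟨u, hu, hu'⟩ := hw2 S hS
        rw [hd S (hS.trans hsub)] at hu'
        rw [hu, O.map_eq_zero_of_mul_eq_zero hS hu']
    exact hfinish ha hxa hker hw1 hv hvw
  · intro n hn x hx y hy hxy
    have hdx : ∀ T ⊆ insert e B, K.diff x T = 0 := fun T hT => htf _ n _ hn <| by
      rw [← Pi.smul_apply, ← map_smul]
      exact K.diff_eq_zero_of_diff_eq hxy hT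
    obtain ⟨a, ha, hxa⟩ := hclear hx
    have hmem : x - K.diff a ∈ K.chainAbove A k j := sub_mem hx (diff_mem_chainAbove (by ring) ha)
    have hd : ∀ T ⊆ insert e B, K.diff (x - K.diff a) T = 0 := fun T hT => by
      rw [map_sub, diff_diff, sub_zero, hdx T hT]
    have hker : ∀ S ⊆ B, K.map (Finset.subset_insert e S) ((x - K.diff a) S) = 0 :=
      fun S hS => map_eq_zero_of_forall_eq_zero heB hxa hS
      (hd _ (Finset.insert_subset_insert e hS))
    have hya : y - n • a ∈ K.chainAbove A (k - 1) j := sub_mem hy (Submodule.smul_mem _ _ ha)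
    obtain ⟨b, hb, hyb⟩ := hclear hya
    have hmem' : y - n • a - K.diff b ∈ K.chainAbove A (k - 1) j :=
      sub_mem hya (diff_mem_chainAbove (by ring) hb)
    have hdy : ∀ T ⊆ insert e B, K.diff (y - n • a - K.diff b) T = n • (x - K.diff a) T :=
      fun T hT => by
        rw [map_sub, diff_diff, sub_zero, map_sub, map_smul, Pi.sub_apply, Pi.smul_apply,
          hxy T hT, Pi.sub_apply, smul_sub]
    have hkery : ∀ S ⊆ B, K.map (Finset.subset_insert e S) ((y - n • a - K.diff b) S) = 0 :=
      fun S hS => map_eq_zero_of_forall_eq_zero heB hyb hS <| by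
      rw [hdy _ (Finset.insert_subset_insert e hS), hxa S hS, smul_zero]
    obtain ⟨w, hw, hw1, hw2⟩ := O.exists_shift_up heB hlt hmem hker
    obtain ⟨v₀, hv, hv1, hv2⟩ := O.exists_shift_up heB hlt hmem' hkery
    have hk : k - 1 + 1 = k + 1 - 1 := by ring
    rw [hk] at hv
    -- The shifts of the corrected x and y satisfy the relation d v₀ = n w on the contraction, so
    -- saturation there divides by n.
    obtain ⟨v, hv', hvw⟩ := hc.saturated n hn w hw v₀ hv <| by
      refine forall_subset_insert (fun S hS => ?_) fun S hS => ?_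
      · rw [subset_insert_of_mem_chainAbove_eq_zero heB (diff_mem_chainAbove rfl hv) hS,
          subset_insert_of_mem_chainAbove_eq_zero heB hw hS, smul_zero]
      · obtain ⟨u, hu, hu'⟩ := hv2 S hS
        rw [hdy S (hS.trans hsub)] at hu'
        rw [hu, hw1 S hS, ← sub_eq_zero, ← map_smul, ← map_sub]
        refine O.map_eq_zero_of_mul_eq_zero hS ?_
        rw [map_sub, hu', map_smul, O.eq_mul_contract hS (hker S hS), sub_self]
    exact hfinish ha hxa hker hw1 hv' hvw

end Bridge

/-! ### Concentration for matroidal cubes -/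

/-- The properties of the cube of a matroid with rank function `r` and rank `ρ` which determine
where its cohomology is concentrated. -/
structure IsMatroidal (K : GradedCube R E) (r : Finset E → ℕ) (ρ : ℕ) : Prop where
  rank_mono : ∀ {S T}, S ⊆ T → r S ≤ r T
  rank_le : ∀ S, r S ≤ ρ
  rank_insert_le : ∀ S e, r (insert e S) ≤ r S + 1
  rank_insert_eq : ∀ {S T e}, S ⊆ T → r (insert e S) = r S → r (insert e T) = r T
  torsionFree : ∀ (S : Finset E) (n : R) (x : K.obj S), n ≠ 0 → n • x = 0 → x = 0
  eq_zero : ∀ {S j x}, r S = ρ → j ≠ 0 → x ∈ K.deg j S → x = 0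
  map_injective : ∀ {S e}, r (insert e S) = r S →
    Function.Injective (K.map (Finset.subset_insert e S))
  map_surjective : ∀ {S e}, r (insert e S) = r S → ∀ j, ∀ y ∈ K.deg j (insert e S),
    ∃ x ∈ K.deg j S, K.map (Finset.subset_insert e S) x = y
  koszul : ∀ {S e}, e ∉ S → r (insert e S) = r S + 1 → Nonempty (K.KoszulOperators S e)

/-- Induction on |B ∖ A|. The number |A| - r(A) is unchanged by contracting a non-loop, so deletion
and contraction share the degree k, while for a bridge the internal degree j - 1 goes with k + 1.
The hypothesis r(B) = ρ survives deletion exactly when e is not a bridge. -/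
theorem IsMatroidal.concentratedOn {K : GradedCube R E} {r : Finset E → ℕ} {ρ : ℕ}
    (hK : K.IsMatroidal r ρ) {A B : Finset E} (hAB : A ⊆ B) (hB : r B = ρ) (j : ℤ) :
    K.ConcentratedOn A B j (A.card + ρ - r A - j) := by
  induction hn : (B \ A).card generalizing A B j with
  | zero =>
    obtain rfl : A = B := hAB.antisymm
      (Finset.sdiff_eq_empty_iff_subset.1 (Finset.card_eq_zero.1 hn))
    have hT : ∀ {i j} {x : ∀ S, K.obj S}, x ∈ K.chainAbove A i j → x A = 0 →
        ∀ T ⊆ A, x T = 0 := fun {i j x} hx h0 T hT => by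
      by_cases h : A ⊆ T
      · rwa [← h.antisymm hT]
      · exact (mem_chainAbove.1 hx).2 T h
    have h0 : ∀ {T}, K.diff (0 : ∀ S, K.obj S) T = 0 := by simp
    constructor
    · intro i hi x hx _
      refine ⟨0, Submodule.zero_mem _, fun T hTA => ?_⟩
      rw [h0, hT hx _ T hTA]
      have hxA := (mem_chainAbove.1 hx).1 A
      -- The only set in the interval is A, of full rank, so only j = 0 contributes; then k = |A|,
      -- and in any other degree a chain vanishes at A.
      by_cases hj : j = 0
      · refine hxA.2 fun h => hi ?_
        omega
      · exact hK.eq_zero hB hj hxA.1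
    · intro n hn x hx y hy hxy
      refine ⟨0, Submodule.zero_mem _, fun T hTA => ?_⟩
      rw [h0, hT hx _ T hTA]
      refine hK.torsionFree _ n _ hn ?_
      rw [← hxy A subset_rfl, diff_apply]
      refine Finset.sum_eq_zero fun e he => ?_
      rw [(mem_chainAbove.1 hy).2 _ fun h => Finset.notMem_erase e A (h he), map_zero, smul_zero]
  | succ n ih =>
    obtain ⟨e, heB, heA, hlt⟩ : ∃ e ∈ B, e ∉ A ∧ ∀ f ∈ B, f ≠ e → f ∉ A → f < e := by
      have hne : (B \ A).Nonempty := Finset.card_pos.1 (by omega)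
      have hmem := Finset.mem_sdiff.1 ((B \ A).max'_mem hne)
      exact ⟨_, hmem.1, hmem.2, fun f hf hfe hfA =>
        lt_of_le_of_ne ((B \ A).le_max' f (Finset.mem_sdiff.2 ⟨hf, hfA⟩)) hfe⟩
    obtain ⟨C, heC, rfl⟩ : ∃ C, e ∉ C ∧ B = insert e C :=
      ⟨B.erase e, Finset.notMem_erase e B, (Finset.insert_erase heB).symm⟩
    replace hlt : ∀ f ∈ C, f ∉ A → f < e := fun f hf =>
      hlt f (Finset.mem_insert_of_mem hf) fun h => heC (h ▸ hf)
    have hAC : A ⊆ C := (Finset.subset_insert_iff_of_notMem heA).1 hAB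
    have hcard : (C \ A).card = n := by
      rw [Finset.insert_sdiff_of_notMem _ heA, Finset.card_insert_of_notMem (by simp [heC])] at hn
      omega
    have hcard' : (insert e C \ insert e A).card = n := by
      rw [← hcard]
      congr 1
      ext f
      by_cases hf : f = e
      · simp [hf, heC]
      · simp [hf]
    have hcA := Finset.card_insert_of_notMem heA
    -- If e is a loop after contracting A, it adds no rank to any larger set, so all maps adding e
    -- above A are bijective.
    by_cases hloop : r (insert e A) = r A
    · refine concentratedOn_of_bijective hK.torsionFree heA heC (fun S hS => ?_) fun S hS => ?_
      · exact hK.map_injective (hK.rank_insert_eq hS hloop)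
      · exact hK.map_surjective (hK.rank_insert_eq hS hloop) j
    · have hrA : r (insert e A) = r A + 1 := by
        have := hK.rank_insert_le A e
        have := hK.rank_mono (Finset.subset_insert e A)
        omega
      have hc := fun j => ih (j := j) (Finset.insert_subset_insert e hAC) hB hcard'
      by_cases hrC : r C = ρ
      · refine .of_delete_contract heC ?_ (ih hAC hrC j hcard)
        convert hc j using 1
        omega
      · obtain ⟨O⟩ := hK.koszul heC (by
          have := hK.rank_insert_le C e
          have := hK.rank_le C
          omega)
        refine .of_contract hK.torsionFree O heA heC hlt ?_
        convert hc (j - 1) using 1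
        omega

end GradedCube

/-! ### Splittings over a principal ideal domain -/

section Splitting

variable {R : Type*} [CommRing R]

theorem LinearMap.exists_equiv_prod_of_surjective {M P : Type*} [AddCommGroup M] [Module R M]
    [AddCommGroup P] [Module R P] [Module.Projective R P] (f : M →ₗ[R] P)
    (hf : Function.Surjective f) :
    ∃ e : M ≃ₗ[R] LinearMap.ker f × P, (∀ x, (e x).2 = f x) ∧
      ∀ x : LinearMap.ker f, e x = (x, 0) := by
  obtain ⟨l, hl⟩ := f.exists_rightInverse_of_surjective (LinearMap.range_eq_top.2 hf)
  have hex : Function.Exact (LinearMap.ker f).subtype f := LinearMap.exact_subtype_ker_map f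
  obtain ⟨e, he1, he2⟩ := hex.splitSurjectiveEquiv (Submodule.subtype_injective _) ⟨l, hl⟩
  refine ⟨e, fun x => (LinearMap.congr_fun he2 x).symm, fun x => ?_⟩
  have := LinearMap.congr_fun he1 x
  simp only [Submodule.subtype_apply, LinearMap.comp_apply, LinearMap.inl_apply,
    LinearEquiv.coe_coe] at this
  rw [this, LinearEquiv.apply_symm_apply]

variable [IsDomain R] [IsPrincipalIdealRing R]

/-- A linear map splits, relative to a saturated submodule of its kernel. -/
theorem LinearMap.exists_splitting {M N : Type*} [AddCommGroup M] [Module R M]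
    [Module.Finite R M] [AddCommGroup N] [Module R N] [Module.IsTorsionFree R N] (f : M →ₗ[R] N)
    {B : Submodule R M} (hB : B ≤ LinearMap.ker f)
    (hsat : ∀ n : R, n ≠ 0 → ∀ x, f x = 0 → n • x ∈ B → x ∈ B) {P : Submodule R N}
    (hP : LinearMap.range f = P) :
    ∃ (n : ℕ) (e : M ≃ₗ[R] B × (Fin n → R) × P),
      (∀ x, ((e x).2.2 : N) = f x) ∧ ∀ b : B, e b = (b, 0, 0) := by
  subst hP
  have htf : Module.IsTorsionFree R (M ⧸ B) := by
    -- If n x ∈ B with n ≠ 0, then n f(x) = 0, so f(x) = 0 because N is torsion-free, and saturation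
    -- applies. Thus M/B is torsion-free, hence free, and splits off.
    refine .of_smul_eq_zero fun n x hx => ?_
    induction x using Submodule.Quotient.induction_on with
    | H x =>
      rw [or_iff_not_imp_left]
      intro hn
      rw [← Submodule.Quotient.mk_smul, Submodule.Quotient.mk_eq_zero] at hx
      rw [Submodule.Quotient.mk_eq_zero]
      refine hsat n hn x ?_ hx
      have := hB hx
      rw [LinearMap.mem_ker, map_smul] at this
      exact (smul_eq_zero.1 this).resolve_left hn
  obtain ⟨e₁, h₁, h₁'⟩ := B.mkQ.exists_equiv_prod_of_surjective B.mkQ_surjective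
  let g : (M ⧸ B) →ₗ[R] LinearMap.range f := B.liftQ f.rangeRestrict (by simpa using hB)
  have hg : Function.Surjective g := by
    rintro ⟨_, x, rfl⟩
    exact ⟨B.mkQ x, rfl⟩
  obtain ⟨e₂, h₂, -⟩ := g.exists_equiv_prod_of_surjective hg
  have : Module.Finite R (LinearMap.ker g) := Module.Finite.of_injective
    (LinearMap.ker g).subtype (Submodule.subtype_injective _)
  let e₃ := (Module.finBasis R (LinearMap.ker g)).equivFun
  let e₀ : LinearMap.ker B.mkQ ≃ₗ[R] B := LinearEquiv.ofEq _ _ B.ker_mkQ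
  let e := e₁.trans (e₀.prodCongr (e₂.trans (e₃.prodCongr (LinearEquiv.refl R _))))
  refine ⟨_, e, fun x => ?_, fun b => ?_⟩
  · change ((e₂ (e₁ x).2).2 : N) = f x
    rw [h₂, h₁]
    rfl
  · have hb : (b : M) ∈ LinearMap.ker B.mkQ := by simp
    have := h₁' ⟨b, hb⟩
    change (e₀ (e₁ b).1, e₃ (e₂ (e₁ b).2).1, (e₂ (e₁ b).2).2) = _
    rw [this]
    simp only [map_zero, Prod.fst_zero, Prod.snd_zero]
    rfl

end Splitting

/-! ### Classification of complexes concentrated in one degree -/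

/-- A bounded complex of finitely generated free modules, whose cohomology is torsion-free and
concentrated in degree `k`. -/
structure CochainComplex.IsConcentrated {R : Type*} [CommRing R]
    (C : CochainComplex (ModuleCat R) ℤ) (m n k : ℤ) : Prop where
  free : ∀ i, Module.Free R (C.X i)
  finite : ∀ i, Module.Finite R (C.X i)
  eq_zero_of_lt : ∀ i < m, ∀ x : C.X i, x = 0
  eq_zero_of_gt : ∀ i > n, ∀ x : C.X i, x = 0
  exact : ∀ i, i ≠ k → ∀ x, (C.d i (i + 1)).hom x = 0 → ∃ y, (C.d (i - 1) i).hom y = x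
  saturated : ∀ a : R, a ≠ 0 → ∀ x y, (C.d (k - 1) k).hom y = a • x →
    ∃ z, (C.d (k - 1) k).hom z = x

namespace CochainComplex.IsConcentrated

universe u v

variable {R : Type u} [CommRing R] {C D : CochainComplex (ModuleCat.{v} R) ℤ} {m n k : ℤ}

/-- The coboundaries in degree `i`. -/
def boundaries (C : CochainComplex (ModuleCat.{v} R) ℤ) (i : ℤ) : Submodule R (C.X i) :=
  LinearMap.range (C.d (i - 1) i).hom

theorem range_d (C : CochainComplex (ModuleCat.{v} R) ℤ) (i : ℤ) :
    LinearMap.range (C.d i (i + 1)).hom = boundaries C (i + 1) := by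
  -- The index `i + 1 - 1` in `boundaries C (i + 1)` is not definitionally `i`; generalizing it
  -- avoids rewriting inside dependent types.
  have : ∀ a, a = i → LinearMap.range (C.d i (i + 1)).hom =
      LinearMap.range (C.d a (i + 1)).hom := by
    rintro _ rfl
    rfl
  exact this _ (by ring)

theorem boundaries_le (C : CochainComplex (ModuleCat.{v} R) ℤ) (i : ℤ) :
    boundaries C i ≤ LinearMap.ker (C.d i (i + 1)).hom := by
  rintro _ ⟨y, rfl⟩
  exact LinearMap.congr_fun (congrArg ModuleCat.Hom.hom (C.d_comp_d (i - 1) i (i + 1))) y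

variable [IsDomain R]

/-- Away from k the cocycles are the coboundaries, so this is rank-nullity for the differential. -/
theorem finrank_eq (hC : C.IsConcentrated m n k) {i : ℤ} (hi : i ≠ k) :
    Module.finrank R (C.X i) = Module.finrank R (boundaries C i) +
      Module.finrank R (boundaries C (i + 1)) := by
  have := hC.free i
  have := hC.finite i
  have := hC.free (i + 1)
  have := hC.finite (i + 1)
  have h : boundaries C i = LinearMap.ker (C.d i (i + 1)).hom :=
    (boundaries_le C i).antisymm fun x hx => hC.exact i hi x hx
  have h1 := Submodule.finrank_quotient_add_finrank (LinearMap.ker (C.d i (i + 1)).hom)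
  rw [((C.d i (i + 1)).hom.quotKerEquivRange).finrank_eq, range_d, ← h] at h1
  omega

/-- The ranks of the coboundaries are recovered from the ranks of the terms, working upwards from
the lower end for degrees at most k and downwards from the upper end for degrees above k. Neither
recursion uses the rank formula at k itself, where cohomology would enter. -/
theorem finrank_boundaries_eq (hC : C.IsConcentrated m n k) (hD : D.IsConcentrated m n k)
    (h : ∀ i, Module.finrank R (C.X i) = Module.finrank R (D.X i)) (i : ℤ) :
    Module.finrank R (boundaries C i) = Module.finrank R (boundaries D i) := by
  have hzero : ∀ i, (i < m ∨ n < i) →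
      Module.finrank R (boundaries C i) = Module.finrank R (boundaries D i) := by
    intro i hi
    have h1 : boundaries C i = ⊥ := (Submodule.eq_bot_iff _).2 fun x _ =>
      hi.elim (fun hi => hC.eq_zero_of_lt i hi x) fun hi => hC.eq_zero_of_gt i hi x
    have h2 : boundaries D i = ⊥ := (Submodule.eq_bot_iff _).2 fun x _ =>
      hi.elim (fun hi => hD.eq_zero_of_lt i hi x) fun hi => hD.eq_zero_of_gt i hi x
    rw [h1, h2, finrank_bot, finrank_bot]
  have hup : ∀ (l : ℕ) (i : ℤ), i = m - 1 + l → i ≤ k →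
      Module.finrank R (boundaries C i) = Module.finrank R (boundaries D i) := by
    intro l
    induction l with
    | zero => exact fun i hi _ => hzero i (.inl (by push_cast at hi; omega))
    | succ l ih =>
      intro i hi hik
      obtain ⟨i, rfl⟩ : ∃ i', i = i' + 1 := ⟨i - 1, by ring⟩
      have h1 := ih i (by push_cast at hi; omega) (by omega)
      have h2 := hC.finrank_eq (i := i) (by omega)
      have h3 := hD.finrank_eq (i := i) (by omega)
      have := h i
      omega
  have hdown : ∀ (l : ℕ) (i : ℤ), i = n + 1 - l → k < i →
      Module.finrank R (boundaries C i) = Module.finrank R (boundaries D i) := by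
    intro l
    induction l with
    | zero => exact fun i hi _ => hzero i (.inr (by push_cast at hi; omega))
    | succ l ih =>
      intro i hi hik
      have h1 := ih (i + 1) (by push_cast at hi; omega) (by omega)
      have h2 := hC.finrank_eq (i := i) (by omega)
      have h3 := hD.finrank_eq (i := i) (by omega)
      have := h i
      omega
  by_cases hm : i < m
  · exact hzero i (.inl hm)
  by_cases hn : n < i
  · exact hzero i (.inr hn)
  by_cases hk : i ≤ k
  · exact hup (i - m + 1).toNat i (by omega) hk
  · exact hdown (n + 1 - i).toNat i (by omega) (by omega)

variable [IsPrincipalIdealRing R]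

/-- Each term is coboundaries ⊕ cohomology ⊕ coboundaries of the next degree. Coboundaries are
saturated in cocycles: they are equal away from k, and at k the cohomology is torsion-free. -/
theorem exists_splitting (hC : C.IsConcentrated m n k) (i : ℤ) :
    ∃ (r : ℕ) (e : C.X i ≃ₗ[R] boundaries C i × (Fin r → R) × boundaries C (i + 1)),
      (∀ x, ((e x).2.2 : C.X (i + 1)) = (C.d i (i + 1)).hom x) ∧
        ∀ b : boundaries C i, e b = (b, 0, 0) := by
  have := hC.free (i + 1)
  have := hC.finite i
  refine LinearMap.exists_splitting _ (boundaries_le C i) (fun a ha x hx hax => ?_) (range_d C i)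
  by_cases hi : i = k
  · subst hi
    obtain ⟨y, hy⟩ := hax
    exact hC.saturated a ha x y hy
  · exact hC.exact i hi x hx

/-- Two complexes with the same ranks, whose cohomology is torsion-free and concentrated in the
same degree, are isomorphic. -/
theorem nonempty_iso (hC : C.IsConcentrated m n k) (hD : D.IsConcentrated m n k)
    (h : ∀ i, Module.finrank R (C.X i) = Module.finrank R (D.X i)) : Nonempty (C ≅ D) := by
  have := hC.free
  have := hC.finite
  have := hD.free
  have := hD.finite
  have hb := finrank_boundaries_eq hC hD h
  choose r e he he' using hC.exists_splitting
  choose s f hf hf' using hD.exists_splitting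
  have hrs : ∀ i, r i = s i := by
    intro i
    have h1 := (e i).finrank_eq
    have h2 := (f i).finrank_eq
    rw [Module.finrank_prod, Module.finrank_prod, Module.finrank_fin_fun] at h1 h2
    have := h i
    have := hb i
    have := hb (i + 1)
    omega
  let β : ∀ i, boundaries C i ≃ₗ[R] boundaries D i := fun i =>
    LinearEquiv.ofFinrankEq _ _ (hb i)
  -- The same `β` is used for the outgoing part in degree i and the incoming part in degree i + 1.
  -- The differential only carries one to the other, so these equivalences commute with it.
  let φ : ∀ i, C.X i ≃ₗ[R] D.X i := fun i => (e i).trans <|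
    ((β i).prodCongr ((LinearEquiv.funCongrLeft R R (finCongr (hrs i).symm)).prodCongr
      (β (i + 1)))).trans (f i).symm
  have hφ : ∀ i (b : boundaries C i), φ i b = β i b := by
    intro i b
    change (f i).symm (β i (e i b).1, _, β (i + 1) (e i b).2.2) = _
    rw [LinearEquiv.symm_apply_eq, hf', he']
    simp [he']
  have hd : ∀ i x, (D.d i (i + 1)).hom (φ i x) = φ (i + 1) ((C.d i (i + 1)).hom x) := by
    intro i x
    rw [← hf, ← he, hφ]
    congr 1
    change ((f i) ((f i).symm (β i (e i x).1, _, β (i + 1) (e i x).2.2))).2.2 = _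
    rw [LinearEquiv.apply_symm_apply]
  refine ⟨HomologicalComplex.Hom.isoOfComponents (fun i => (φ i).toModuleIso) ?_⟩
  rintro i _ rfl
  ext x
  exact hd i x

end CochainComplex.IsConcentrated

/-! ### From the interval [∅, E] to the cochain complex -/

namespace GradedCube

universe u v w

variable {R : Type u} [CommRing R] {E : Type v}

theorem chainAbove_empty (K : GradedCube R E) (i j : ℤ) : K.chainAbove ∅ i j = K.chain i j := by
  ext x
  simp [mem_chainAbove]

variable [LinearOrder E]

theorem complex_d_apply (K : GradedCube R E) (j : ℤ) {i i' : ℤ} (h : i + 1 = i')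
    (x : K.chain i j) : (((K.complex j).d i i').hom x : K.chain i' j).1 = K.diff x.1 := by
  simp only [complex, dif_pos h]
  rfl

variable [IsDomain R] [IsPrincipalIdealRing R] [Fintype E]

theorem ConcentratedOn.isConcentrated {K : GradedCube R E} {j k : ℤ}
    (h : K.ConcentratedOn ∅ Finset.univ j k) (hfree : ∀ S, Module.Free R (K.obj S))
    (hfin : ∀ S, Module.Finite R (K.obj S)) :
    (K.complex j).IsConcentrated 0 (Fintype.card E) k where
  free i := inferInstanceAs (Module.Free R (K.chain i j))
  finite i := inferInstanceAs (Module.Finite R (K.chain i j))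
  eq_zero_of_lt i hi x := Subtype.ext <| funext fun S => (x.2 S).2 (by omega)
  eq_zero_of_gt i hi x := Subtype.ext <| funext fun S => (x.2 S).2 (by
    have := S.card_le_univ
    omega)
  exact i hi x hx := by
    obtain ⟨x, hx'⟩ := x
    have hd : K.diff x = 0 := by
      rw [← K.complex_d_apply j rfl ⟨x, hx'⟩, hx]
      rfl
    obtain ⟨y, hy, hyx⟩ := h.exact i hi x (by rwa [chainAbove_empty]) fun T _ => by
      rw [hd, Pi.zero_apply]
    rw [chainAbove_empty] at hy
    refine ⟨⟨y, hy⟩, Subtype.ext ?_⟩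
    rw [K.complex_d_apply j (sub_add_cancel i 1) ⟨y, hy⟩]
    exact funext fun T => hyx T (Finset.subset_univ T)
  saturated a ha x y hxy := by
    obtain ⟨x, hx'⟩ := x
    obtain ⟨y, hy'⟩ := y
    have hd : K.diff y = a • x := by
      rw [← K.complex_d_apply j (sub_add_cancel k 1) ⟨y, hy'⟩, hxy]
      rfl
    obtain ⟨z, hz, hzx⟩ := h.saturated a ha x (by rwa [chainAbove_empty]) y
      (by rwa [chainAbove_empty]) fun T _ => by rw [hd, Pi.smul_apply]
    rw [chainAbove_empty] at hz
    refine ⟨⟨z, hz⟩, Subtype.ext ?_⟩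
    rw [K.complex_d_apply j (sub_add_cancel k 1) ⟨z, hz⟩]
    exact funext fun T => hzx T (Finset.subset_univ T)

end GradedCube

/-! ### Operators on labellings -/

namespace Labelling

open Classical

variable {R : Type*} [CommRing R] {α β : Type*}

/-- Multiplication by the label `x` at `a`, on the free module with basis the finite sets of
elements labelled `x`. -/
def ins (R : Type*) [CommRing R] (a : α) : (Finset α →₀ R) →ₗ[R] (Finset α →₀ R) :=
  Finsupp.linearCombination R fun X => if a ∈ X then 0 else Finsupp.single (insert a X) 1

/-- Removal of the label `x` at `a`. -/
def del (R : Type*) [CommRing R] (a : α) : (Finset α →₀ R) →ₗ[R] (Finset α →₀ R) :=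
  Finsupp.linearCombination R fun X => if a ∈ X then Finsupp.single (X.erase a) 1 else 0

/-- The sign `(-1) ^ #{a ∈ X | p a}`. -/
def sgn (R : Type*) [CommRing R] (p : α → Prop) : (Finset α →₀ R) →ₗ[R] (Finset α →₀ R) :=
  Finsupp.linearCombination R fun X => Finsupp.single X ((-1) ^ (X.filter p).card)

/-- The map of labellings induced by a map of sets, where `x * x = 0`. -/
def push (R : Type*) [CommRing R] (h : α → β) : (Finset α →₀ R) →ₗ[R] (Finset β →₀ R) :=
  Finsupp.linearCombination R fun X =>
    if Set.InjOn h X then Finsupp.single (X.image h) 1 else 0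

theorem ins_single (a : α) (X : Finset α) :
    ins R a (Finsupp.single X 1) = if a ∈ X then 0 else Finsupp.single (insert a X) 1 := by
  simp [ins]

theorem del_single (a : α) (X : Finset α) :
    del R a (Finsupp.single X 1) = if a ∈ X then Finsupp.single (X.erase a) 1 else 0 := by
  simp [del]

theorem sgn_single (p : α → Prop) (X : Finset α) :
    sgn R p (Finsupp.single X 1) = (-1 : R) ^ (X.filter p).card • Finsupp.single X 1 := by
  simp [sgn]

theorem push_single (h : α → β) (X : Finset α) : push R h (Finsupp.single X 1) =
    if Set.InjOn h X then Finsupp.single (X.image h) 1 else 0 := by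
  simp [push]

theorem hom_ext {M : Type*} [AddCommGroup M] [Module R M] {f g : (Finset α →₀ R) →ₗ[R] M}
    (h : ∀ X, f (Finsupp.single X 1) = g (Finsupp.single X 1)) : f = g :=
  Finsupp.lhom_ext' fun X => LinearMap.ext_ring (h X)

theorem ins_del_add (a : α) (x : Finset α →₀ R) :
    ins R a (del R a x) + del R a (ins R a x) = x := by
  refine LinearMap.congr_fun (f := ins R a ∘ₗ del R a + del R a ∘ₗ ins R a) (g := .id)
    (hom_ext fun X => ?_) x
  by_cases h : a ∈ X
  · simp [ins_single, del_single, h]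
  · simp [ins_single, del_single, h]

theorem ins_ins (a : α) (x : Finset α →₀ R) : ins R a (ins R a x) = 0 := by
  refine LinearMap.congr_fun (f := ins R a ∘ₗ ins R a) (g := 0) (hom_ext fun X => ?_) x
  by_cases h : a ∈ X
  · simp [ins_single, h]
  · simp [ins_single, h]

theorem del_ins_of_ne {a b : α} (hab : a ≠ b) (x : Finset α →₀ R) :
    del R a (ins R b x) = ins R b (del R a x) := by
  refine LinearMap.congr_fun (f := del R a ∘ₗ ins R b) (g := ins R b ∘ₗ del R a)
    (hom_ext fun X => ?_) x
  by_cases ha : a ∈ X <;> by_cases hb : b ∈ X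
  · simp [ins_single, del_single, ha, hb, hab.symm]
  · simp [ins_single, del_single, ha, hb, Finset.erase_insert_of_ne hab.symm]
  · simp [ins_single, del_single, ha, hb]
  · simp [ins_single, del_single, ha, hb, hab]

theorem sgn_sgn (p : α → Prop) (x : Finset α →₀ R) : sgn R p (sgn R p x) = x := by
  refine LinearMap.congr_fun (f := sgn R p ∘ₗ sgn R p) (g := .id) (hom_ext fun X => ?_) x
  rw [LinearMap.comp_apply, sgn_single, map_smul, sgn_single, smul_smul, ← pow_add,
    Even.neg_one_pow (Even.add_self _), one_smul, LinearMap.id_apply]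

theorem sgn_ins_of_pos {p : α → Prop} {a : α} (ha : p a) (x : Finset α →₀ R) :
    sgn R p (ins R a x) = - ins R a (sgn R p x) := by
  refine LinearMap.congr_fun (f := sgn R p ∘ₗ ins R a) (g := - (ins R a ∘ₗ sgn R p))
    (hom_ext fun X => ?_) x
  simp only [LinearMap.comp_apply, LinearMap.neg_apply, sgn_single, map_smul, ins_single]
  split_ifs with h
  · simp
  · rw [sgn_single, Finset.filter_insert, if_pos ha, Finset.card_insert_of_notMem (by simp [h]),
      pow_succ]
    simp

theorem sgn_ins_of_neg {p : α → Prop} {a : α} (ha : ¬ p a) (x : Finset α →₀ R) :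
    sgn R p (ins R a x) = ins R a (sgn R p x) := by
  refine LinearMap.congr_fun (f := sgn R p ∘ₗ ins R a) (g := ins R a ∘ₗ sgn R p)
    (hom_ext fun X => ?_) x
  simp only [LinearMap.comp_apply, sgn_single, map_smul, ins_single]
  split_ifs with h
  · simp
  · rw [sgn_single, Finset.filter_insert, if_neg ha]

theorem sgn_del_of_pos {p : α → Prop} {a : α} (ha : p a) (x : Finset α →₀ R) :
    sgn R p (del R a x) = - del R a (sgn R p x) := by
  refine LinearMap.congr_fun (f := sgn R p ∘ₗ del R a) (g := - (del R a ∘ₗ sgn R p))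
    (hom_ext fun X => ?_) x
  simp only [LinearMap.comp_apply, LinearMap.neg_apply, sgn_single, map_smul, del_single]
  split_ifs with h
  · have hX : (X.filter p).card = ((X.erase a).filter p).card + 1 := by
      rw [Finset.filter_erase, Finset.card_erase_add_one (Finset.mem_filter.2 ⟨h, ha⟩)]
    rw [sgn_single, hX, pow_succ]
    simp
  · simp

/-- Merging labels commutes with multiplication by x at a point, by associativity and commutativity.
In the set encoding both sides vanish if a is already labelled, or if h is not injective on the
labels or sends a to the image of a label. -/
theorem push_ins (h : α → β) (a : α) (x : Finset α →₀ R) :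
    push R h (ins R a x) = ins R (h a) (push R h x) := by
  refine LinearMap.congr_fun (f := push R h ∘ₗ ins R a) (g := ins R (h a) ∘ₗ push R h)
    (hom_ext fun X => ?_) x
  simp only [LinearMap.comp_apply, push_single, ins_single]
  by_cases ha : a ∈ X
  · rw [if_pos ha, map_zero]
    split_ifs
    · rw [ins_single, if_pos (Finset.mem_image_of_mem h ha)]
    · rw [map_zero]
  · have hins : Set.InjOn h (insert a X : Finset α) ↔ Set.InjOn h X ∧ h a ∉ X.image h := by
      rw [Finset.coe_insert, Set.injOn_insert (by simpa using ha)]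
      simp
    rw [if_neg ha, push_single]
    by_cases h1 : Set.InjOn h X
    · by_cases h2 : h a ∈ X.image h
      · rw [if_neg fun h' => (hins.1 h').2 h2, if_pos h1, ins_single, if_pos h2]
      · rw [if_pos (hins.2 ⟨h1, h2⟩), if_pos h1, ins_single, if_neg h2, Finset.image_insert]
    · rw [if_neg fun h' => h1 (hins.1 h').1, if_neg h1, map_zero]

theorem push_sgn (h : α → β) {p : α → Prop} {q : β → Prop} (hpq : ∀ a, q (h a) ↔ p a)
    (x : Finset α →₀ R) : push R h (sgn R p x) = sgn R q (push R h x) := by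
  refine LinearMap.congr_fun (f := push R h ∘ₗ sgn R p) (g := sgn R q ∘ₗ push R h)
    (hom_ext fun X => ?_) x
  simp only [LinearMap.comp_apply, push_single, sgn_single, map_smul]
  split_ifs with hX
  · have : (X.image h).filter q = (X.filter p).image h := by
      ext b
      simp only [Finset.mem_filter, Finset.mem_image]
      constructor
      · rintro ⟨⟨a, ha, rfl⟩, hb⟩
        exact ⟨a, ⟨ha, (hpq a).1 hb⟩, rfl⟩
      · rintro ⟨a, ⟨ha, hp⟩, rfl⟩
        exact ⟨⟨a, ha, rfl⟩, (hpq a).2 hp⟩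
    rw [sgn_single, this, Finset.card_image_of_injOn
      (hX.mono (Finset.coe_subset.2 (Finset.filter_subset p X)))]
  · simp

theorem push_push {γ : Type*} (h : α → β) (h' : β → γ) (x : Finset α →₀ R) :
    push R h' (push R h x) = push R (h' ∘ h) x := by
  refine LinearMap.congr_fun (f := push R h' ∘ₗ push R h) (g := push R (h' ∘ h))
    (hom_ext fun X => ?_) x
  simp only [LinearMap.comp_apply, push_single]
  by_cases h1 : Set.InjOn h X
  · have h2 : Set.InjOn h' (X.image h : Finset β) ↔ Set.InjOn (h' ∘ h) X := by
      rw [Finset.coe_image]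
      exact ⟨fun h2 => (Set.InjOn.comp_iff h1).2 h2, fun h2 => (Set.InjOn.comp_iff h1).1 h2⟩
    simp only [if_pos h1, push_single, h2, Finset.image_image]
  · rw [if_neg h1, map_zero, if_neg fun h2 => h1 (Set.InjOn.of_comp h2)]

theorem push_id (x : Finset α →₀ R) : push R id x = x := by
  refine LinearMap.congr_fun (f := push R id) (g := .id) (hom_ext fun X => ?_) x
  rw [push_single, if_pos (Set.injOn_id _), Finset.image_id, LinearMap.id_apply]

/-- Moving the label of `v` to `u`. -/
theorem push_update {u v : α} (huv : u ≠ v) (x : Finset α →₀ R) :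
    push R (Function.update id v u) x = x - (ins R v - ins R u) (del R v x) := by
  refine LinearMap.congr_fun (f := push R (Function.update id v u))
    (g := .id - (ins R v - ins R u) ∘ₗ del R v) (hom_ext fun X => ?_) x
  simp only [LinearMap.comp_apply, LinearMap.sub_apply, LinearMap.id_apply, push_single, del_single]
  have hne : ∀ a ∈ X.erase v, Function.update id v u a = a := fun a ha => by
    rw [Function.update_of_ne (Finset.ne_of_mem_erase ha), id]
  by_cases hv : v ∈ X
  · rw [if_pos hv, ins_single, ins_single, if_neg (Finset.notMem_erase v X), Finset.insert_erase hv,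
      sub_sub_cancel]
    by_cases hu : u ∈ X
    · rw [if_pos (Finset.mem_erase.2 ⟨huv, hu⟩), if_neg]
      intro h
      refine huv (h hu hv ?_)
      rw [Function.update_self, Function.update_of_ne huv, id]
    · have hu' : u ∉ X.erase v := fun h => hu (Finset.mem_of_mem_erase h)
      rw [if_neg hu', if_pos]
      · conv_lhs => rw [← Finset.insert_erase hv]
        rw [Finset.image_insert, Function.update_self, Finset.image_congr (g := id) hne,
          Finset.image_id]
      · rw [← Finset.insert_erase hv, Finset.coe_insert, Set.injOn_insert (by simp)]
        refine ⟨fun a ha b hb hab => by rwa [hne a ha, hne b hb] at hab, ?_⟩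
        rintro ⟨a, ha, hau⟩
        rw [hne a ha, Function.update_self] at hau
        exact hu' (hau ▸ ha)
  · rw [if_neg hv, map_zero, map_zero, sub_zero, sub_zero, ← Finset.erase_eq_of_notMem hv, if_pos,
      Finset.image_congr (g := id) hne, Finset.image_id]
    exact fun a ha b hb hab => by rwa [hne a ha, hne b hb] at hab

/-- A linear map preserves supports if it does so on basis elements. -/
theorem map_mem_supported {f : (Finset α →₀ R) →ₗ[R] (Finset β →₀ R)} {s : Set (Finset α)}
    {t : Set (Finset β)} (h : ∀ X ∈ s, f (Finsupp.single X 1) ∈ Finsupp.supported R R t)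
    {x : Finset α →₀ R} (hx : x ∈ Finsupp.supported R R s) : f x ∈ Finsupp.supported R R t := by
  rw [Finsupp.supported_eq_span_single] at hx
  refine Submodule.span_le (p := (Finsupp.supported R R t).comap f).2 ?_ hx
  rintro _ ⟨X, hX, rfl⟩
  exact h X hX

end Labelling

/-! ### Components and rank when an edge is added -/

namespace Graph

variable {α β : Type*} {G : Graph α β}

section Rank

variable [Finite V(G)]

theorem graphicRank_insert_le [Finite E(G)] (S : Set E(G)) (e : E(G)) :
    G.graphicRank (insert e S) ≤ G.graphicRank S + 1 := by
  have h1 := G.graphicRank_submod S {e}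
  have h2 := G.graphicRank_le_ncard {e}
  rw [Set.ncard_singleton] at h2
  rw [Set.union_singleton] at h1
  omega

theorem graphicRank_insert_eq_of_subset {S T : Set E(G)} {e : E(G)} (h : S ⊆ T)
    (hr : G.graphicRank (insert e S) = G.graphicRank S) :
    G.graphicRank (insert e T) = G.graphicRank T := by
  have h1 := G.graphicRank_submod T (insert e S)
  have h2 := G.graphicRank_mono S (T ∩ insert e S) (Set.subset_inter h (Set.subset_insert e S))
  have h3 := G.graphicRank_mono T (insert e T) (Set.subset_insert e T)
  have h4 : T ∪ insert e S = insert e T := by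
    rw [Set.union_insert, Set.union_eq_left.2 h]
  rw [h4] at h1
  omega

/-- Equal rank forces `rhoTilde S = rhoTilde T`, so the difference of two vertices joined in T
already vanishes in the free module on Conn(S). -/
theorem connMap_bijective_of_rank_eq {S T : Set E(G)} (h : S ⊆ T)
    (hr : G.graphicRank S = G.graphicRank T) : Function.Bijective (G.connMap h) := by
  refine ⟨?_, G.connMap_surjective h⟩
  intro F F'
  induction F using SimpleGraph.ConnectedComponent.ind with | h v
  induction F' using SimpleGraph.ConnectedComponent.ind with | h w
  intro hF
  rw [connMap_mk, connMap_mk] at hF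
  have hmem := G.single_sub_mem_rhoTilde (SimpleGraph.ConnectedComponent.exact hF)
  rw [← G.rhoTilde_eq_of_rank_eq h hr, ← ker_toConn, LinearMap.mem_ker, map_sub, toConn_single,
    toConn_single, sub_eq_zero] at hmem
  exact Finsupp.single_left_injective one_ne_zero hmem

/-- An edge which raises the rank joins two components, one of which does not contain a given
vertex. -/
theorem exists_isLink_of_rank_lt (v₀ : V(G)) {S : Set E(G)} {e : E(G)}
    (hr : G.graphicRank S < G.graphicRank (insert e S)) :
    ∃ u v : V(G), G.IsLink e u v ∧ ¬ (G.spanning S).Reachable v u ∧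
      ¬ (G.spanning S).Reachable v v₀ := by
  obtain ⟨a, b, hab⟩ := G.exists_isLink_of_mem_edgeSet e.2
  obtain ⟨u, hu⟩ : ∃ u : V(G), (u : α) = a := ⟨⟨a, hab.left_mem⟩, rfl⟩
  obtain ⟨v, hv⟩ : ∃ v : V(G), (v : α) = b := ⟨⟨b, hab.right_mem⟩, rfl⟩
  subst hu hv
  have hne : ¬ (G.spanning S).Reachable u v := by
    intro h
    refine hr.not_ge ?_
    rw [← finrank_rhoTilde, ← finrank_rhoTilde]
    refine Submodule.finrank_mono (Submodule.span_le.2 ?_)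
    rintro x ⟨f, hf | hf, w, w', hl, rfl⟩
    · subst hf
      rcases hl.eq_and_eq_or_eq_and_eq hab with ⟨h1, h2⟩ | ⟨h1, h2⟩
      · obtain rfl := Subtype.ext h1
        obtain rfl := Subtype.ext h2
        exact G.single_sub_mem_rhoTilde h
      · obtain rfl := Subtype.ext h1
        obtain rfl := Subtype.ext h2
        exact G.single_sub_mem_rhoTilde h.symm
    · exact Submodule.subset_span ⟨f, hf, w, w', hl, rfl⟩
  by_cases h0 : (G.spanning S).Reachable v v₀
  · exact ⟨v, u, hab.symm, hne, fun h => hne (h.trans h0.symm)⟩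
  · exact ⟨u, v, hab, fun h => hne h.symm, h0⟩

end Rank

/-- The components of `[G:S ∪ e]` are the components of `[G:S]` other than that of `v`. -/
theorem exists_conn_section {S T : Set E(G)} {e : E(G)} {u v : V(G)} (hl : G.IsLink e u v)
    (hT : T = insert e S) (hST : S ⊆ T) :
    ∃ t : G.Conn T → G.Conn S, (∀ F, G.connMap hST (t F) = F) ∧ ∀ F, t (G.connMap hST F) =
      open Classical in Function.update id ((G.spanning S).connectedComponentMk v)
        ((G.spanning S).connectedComponentMk u) F := by
  subst hT
  classical
  -- Redirecting the component of v to that of u makes the two ends of e agree, so `q` is constant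
  -- along the edges of S ∪ e and descends to Conn(S ∪ e).
  set q : G.Conn S → G.Conn S := Function.update id ((G.spanning S).connectedComponentMk v)
          ((G.spanning S).connectedComponentMk u) with hq
  have huv : q ((G.spanning S).connectedComponentMk u) =
      q ((G.spanning S).connectedComponentMk v) := by
    rw [hq, Function.update_self]
    by_cases h : (G.spanning S).connectedComponentMk u = (G.spanning S).connectedComponentMk v
    · rw [h, Function.update_self]
    · rw [Function.update_of_ne h, id]
  have hadj : ∀ w w', (G.spanning (insert e S)).Adj w w' →
      q ((G.spanning S).connectedComponentMk w) = q ((G.spanning S).connectedComponentMk w') := by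
    rintro w w' ⟨hne, f, hf | hf, hl'⟩
    · subst hf
      rcases hl'.eq_and_eq_or_eq_and_eq hl with ⟨h1, h2⟩ | ⟨h1, h2⟩
      · rw [Subtype.ext h1, Subtype.ext h2, huv]
      · rw [Subtype.ext h1, Subtype.ext h2, huv]
    · congr 1
      exact SimpleGraph.ConnectedComponent.sound
        (SimpleGraph.Adj.reachable (G := G.spanning S) ⟨hne, f, hf, hl'⟩)
  have hlink : (G.spanning (insert e S)).connectedComponentMk u =
      (G.spanning (insert e S)).connectedComponentMk v := by
    by_cases h : u = v
    · rw [h]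
    · exact SimpleGraph.ConnectedComponent.sound (SimpleGraph.Adj.reachable
        (G := G.spanning (insert e S)) ⟨h, e, Set.mem_insert e S, hl⟩)
  let t : G.Conn (insert e S) → G.Conn S := SimpleGraph.ConnectedComponent.lift
    (fun w => q ((G.spanning S).connectedComponentMk w)) (by
      intro w w' p _
      induction p with
      | nil => rfl
      | cons h _ ih =>
        rename_i hp
        exact (hadj _ _ h).trans (ih hp.of_cons))
  have ht : ∀ w, t ((G.spanning (insert e S)).connectedComponentMk w) =
      q ((G.spanning S).connectedComponentMk w) := fun w => rfl
  refine ⟨t, fun F => ?_, fun F => ?_⟩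
  · induction F using SimpleGraph.ConnectedComponent.ind with | h w
    rw [ht, hq]
    by_cases hw : (G.spanning S).connectedComponentMk w = (G.spanning S).connectedComponentMk v
    · rw [hw, Function.update_self, connMap_mk, hlink, ← G.connMap_mk (Set.subset_insert e S) w, hw,
        connMap_mk]
    · rw [Function.update_of_ne hw, id, connMap_mk]
  · induction F using SimpleGraph.ConnectedComponent.ind with | h w
    rw [connMap_mk, ht]

/-! ### The rooted chromatic cube is matroidal -/

section Rooted

variable (G)

/-- The chromatic cube, restricted to the states in which the component of the root `v₀` has the
label `x`. -/
def rootedCube (v₀ : V(G)) : GradedCube ℤ E(G) where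
  obj := G.chromaticCube.obj
  addCommGroup := G.chromaticCube.addCommGroup
  module := G.chromaticCube.module
  map := G.chromaticCube.map
  map_map := G.chromaticCube.map_map
  deg j S := Finsupp.supported ℤ ℤ {X | (G.spanning (S : Set E(G))).connectedComponentMk v₀ ∈ X ∧
    (X.card : ℤ) = j + 1}
  map_mem {S T} h j x hx := by
    classical
    refine Labelling.map_mem_supported (f := G.mergeLabels (Finset.coe_subset.2 h))
      (fun X hX => ?_) hx
    rw [mergeLabels, Finsupp.linearCombination_single, one_smul]
    split_ifs with hinj
    · refine Finsupp.single_mem_supported ℤ _ ⟨?_, ?_⟩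
      · exact Finset.mem_image_of_mem (G.connMap (Finset.coe_subset.2 h)) hX.1
      · rw [Finset.card_image_of_injOn hinj, hX.2]
    · exact Submodule.zero_mem _

variable {G}

/-- Multiplication by the difference of the ends of a bridge, with a sign which counts the labels
on one side of the bridge. -/
theorem nonempty_koszulOperators_rootedCube [Finite V(G)] [LinearOrder E(G)] (v₀ : V(G))
    {B : Finset E(G)} {e : E(G)}
    (hr : G.graphicRank B < G.graphicRank (insert e (B : Set E(G)))) :
    Nonempty ((G.rootedCube v₀).KoszulOperators B e) := by
  obtain ⟨u, v, hl, hvu, hv₀⟩ := exists_isLink_of_rank_lt v₀ hr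
  let c : ∀ (S : Finset E(G)) (w : V(G)), G.Conn (S : Set E(G)) := fun S w =>
    (G.spanning (S : Set E(G))).connectedComponentMk w
  -- `p` marks the components on the side of v of the bridge, as seen in B. Being read off in B
  -- makes it compatible with all maps S ⊆ T ⊆ B; for S ⊄ B it is vacuously true and plays no role.
  let p : ∀ S : Finset E(G), G.Conn (S : Set E(G)) → Prop := fun S F =>
    ∀ h : S ⊆ B, G.connMap (Finset.coe_subset.2 h) F = c B v
  choose t ht1 ht2 using fun S : Finset E(G) => exists_conn_section (S := (S : Set E(G)))
    (T := ((insert e S : Finset E(G)) : Set E(G))) hl (Finset.coe_insert e S)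
    (Finset.coe_subset.2 (Finset.subset_insert e S))
  have hpv : ∀ S, S ⊆ B → p S (c S v) := fun S hS _ => rfl
  have hpu : ∀ S, S ⊆ B → ¬ p S (c S u) := fun S hS h =>
    hvu (SimpleGraph.ConnectedComponent.exact (h hS)).symm
  have huv : ∀ S, S ⊆ B → c S u ≠ c S v := fun S hS h => hpu S hS (h ▸ hpv S hS)
  -- The end v lies on the side away from v₀, so removing the label at v keeps a state rooted.
  have hv0 : ∀ S, S ⊆ B → c S v₀ ≠ c S v := fun S hS h =>
    hv₀ (SimpleGraph.ConnectedComponent.exact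
      (congrArg (G.connMap (Finset.coe_subset.2 hS)) h.symm))
  have htconn : ∀ S : Finset E(G),
      t S ∘ G.connMap (Finset.coe_subset.2 (Finset.subset_insert e S)) =
      open Classical in Function.update id (c S v) (c S u) := fun S => funext (ht2 S)
  have hlink : ∀ S : Finset E(G), c (insert e S) v = c (insert e S) u := by
    intro S
    by_cases h : u = v
    · rw [h]
    · exact SimpleGraph.ConnectedComponent.sound (SimpleGraph.Adj.reachable
        (G := G.spanning ((insert e S : Finset E(G)) : Set E(G)))
        ⟨h, e, Finset.mem_coe.2 (Finset.mem_insert_self e S), hl⟩).symm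
  -- Without a sign, `del` at v commutes with `ins` at u and the cross terms would add up. The sign
  -- changes when the label at v is removed but not when one at u is inserted, so the cross terms
  -- cancel and only `ins_del_add` at v remains.
  let mul : ∀ S : Finset E(G), (Finset (G.Conn (S : Set E(G))) →₀ ℤ) →ₗ[ℤ]
      (Finset (G.Conn (S : Set E(G))) →₀ ℤ) := fun S =>
    (Labelling.ins ℤ (c S v) - Labelling.ins ℤ (c S u)) ∘ₗ Labelling.sgn ℤ (p S)
  let con : ∀ S : Finset E(G), (Finset (G.Conn (S : Set E(G))) →₀ ℤ) →ₗ[ℤ]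
      (Finset (G.Conn (S : Set E(G))) →₀ ℤ) := fun S =>
    Labelling.sgn ℤ (p S) ∘ₗ Labelling.del ℤ (c S v)
  let lift : ∀ S : Finset E(G), (Finset (G.Conn ((insert e S : Finset E(G)) : Set E(G))) →₀ ℤ) →ₗ[ℤ]
      (Finset (G.Conn (S : Set E(G))) →₀ ℤ) := fun S => Labelling.push ℤ (t S)
  have hmul : ∀ S x, mul S x = Labelling.ins ℤ (c S v) (Labelling.sgn ℤ (p S) x) -
    Labelling.ins ℤ (c S u) (Labelling.sgn ℤ (p S) x) := fun S x => rfl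
  have hcon : ∀ S x, con S x = Labelling.sgn ℤ (p S) (Labelling.del ℤ (c S v) x) := fun S x => rfl
  have htroot : ∀ S : Finset E(G), S ⊆ B → t S (c (insert e S) v₀) = c S v₀ := fun S hS =>
    (ht2 S (c S v₀)).trans (by
      classical exact Function.update_of_ne (hv0 S hS) _ _)
  refine ⟨{
    mul := mul
    contract := con
    lift := lift
    mul_mem := ?_
    contract_mem := ?_
    lift_mem := ?_
    map_mul := ?_
    map_lift := ?_
    lift_map := ?_
    map_insert_mul := ?_
    mul_contract_add := ?_ }⟩
  · intro S hS j x hx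
    classical
    refine Labelling.map_mem_supported (f := mul S) (fun X hX => ?_) hx
    have hmem : ∀ w, Labelling.ins ℤ (c S w) (Finsupp.single X 1) ∈ Finsupp.supported ℤ ℤ
        {X | c S v₀ ∈ X ∧ (X.card : ℤ) = j + 1 + 1} := by
      intro w
      rw [Labelling.ins_single]
      split_ifs with h
      · exact Submodule.zero_mem _
      · refine Finsupp.single_mem_supported ℤ _ ⟨Finset.mem_insert_of_mem hX.1, ?_⟩
        rw [Finset.card_insert_of_notMem h]
        push_cast
        rw [hX.2]
    rw [hmul, Labelling.sgn_single, map_smul, map_smul]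
    exact sub_mem (Submodule.smul_mem _ _ (hmem v)) (Submodule.smul_mem _ _ (hmem u))
  · intro S hS j x hx
    classical
    refine Labelling.map_mem_supported (f := con S) (fun X hX => ?_) hx
    rw [hcon, Labelling.del_single]
    split_ifs with h
    · rw [Labelling.sgn_single]
      refine Submodule.smul_mem _ _ (Finsupp.single_mem_supported ℤ _ ⟨?_, ?_⟩)
      · exact Finset.mem_erase.2 ⟨hv0 S hS, hX.1⟩
      · have := Finset.card_erase_add_one h
        have := hX.2
        omega
    · rw [map_zero]
      exact Submodule.zero_mem _
  · intro S hS j x hx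
    classical
    refine Labelling.map_mem_supported (f := lift S) (fun X hX => ?_) hx
    simp only [lift]
    rw [Labelling.push_single, if_pos (Function.LeftInverse.injective (ht1 S)).injOn]
    refine Finsupp.single_mem_supported ℤ _ ⟨?_, ?_⟩
    · exact Finset.mem_image.2 ⟨_, hX.1, htroot S hS⟩
    · rw [Finset.card_image_of_injective _ (Function.LeftInverse.injective (ht1 S)), hX.2]
  · intro S T h hT (x : Finset (G.Conn (S : Set E(G))) →₀ ℤ)
    have hS : S ⊆ B := h.trans hT
    change Labelling.push ℤ _ (mul S x) = mul T (Labelling.push ℤ _ x)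
    have hpq : ∀ F, p T (G.connMap (Finset.coe_subset.2 h) F) ↔ p S F := fun F => by
      simp only [p, connMap_connMap]
      exact ⟨fun H _ => H hT, fun H _ => H hS⟩
    rw [hmul, hmul, map_sub, Labelling.push_ins, Labelling.push_ins, Labelling.push_sgn _ hpq]
    rfl
  · intro S hS (x : Finset (G.Conn ((insert e S : Finset E(G)) : Set E(G))) →₀ ℤ)
    change Labelling.push ℤ _ (Labelling.push ℤ (t S) x) = x
    rw [Labelling.push_push]
    conv_rhs => rw [← Labelling.push_id x]
    congr 2
    exact funext (ht1 S)
  · intro S hS (x : Finset (G.Conn (S : Set E(G))) →₀ ℤ)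
    change Labelling.push ℤ (t S) (Labelling.push ℤ _ x) = x - mul S (con S x)
    rw [Labelling.push_push, htconn, Labelling.push_update (huv S hS), hmul, hcon,
      Labelling.sgn_sgn, LinearMap.sub_apply]
  · intro S hS (x : Finset (G.Conn (S : Set E(G))) →₀ ℤ)
    change Labelling.push ℤ _ (mul S x) = 0
    rw [hmul, map_sub, Labelling.push_ins, Labelling.push_ins, sub_eq_zero]
    congr 2
    exact hlink S
  · intro S hS (x : Finset (G.Conn (S : Set E(G))) →₀ ℤ)
    change mul S (con S x) + con S (mul S x) = x
    rw [hmul, hmul, hcon, hcon, Labelling.sgn_sgn, map_sub, map_sub,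
      Labelling.del_ins_of_ne (huv S hS).symm, Labelling.sgn_ins_of_neg (hpu S hS),
      Labelling.sgn_del_of_pos (hpv S hS), Labelling.sgn_del_of_pos (hpv S hS),
      Labelling.sgn_ins_of_pos (hpv S hS), Labelling.sgn_sgn, map_neg, map_neg, neg_neg]
    conv_rhs => rw [← Labelling.ins_del_add (c S v) x]
    abel

/-- Rooting is what makes `eq_zero` true: at full rank there is a single component and it must be
labelled x, so one degree survives. The whole chromatic cube has two there, and its cohomology need
not be concentrated. -/
theorem isMatroidal_rootedCube [Finite V(G)] [Finite E(G)] [LinearOrder E(G)] (hG : G.IsConn)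
    (v₀ : V(G)) :
    (G.rootedCube v₀).IsMatroidal (fun S => G.graphicRank S) (G.graphicRank Set.univ) where
  rank_mono h := G.graphicRank_mono _ _ (Finset.coe_subset.2 h)
  rank_le S := G.graphicRank_mono _ _ (Set.subset_univ _)
  rank_insert_le S e := by
    rw [Finset.coe_insert]
    exact graphicRank_insert_le _ e
  rank_insert_eq {S T e} h hr := by
    rw [Finset.coe_insert] at hr ⊢
    exact graphicRank_insert_eq_of_subset (Finset.coe_subset.2 h) hr
  torsionFree S n x hn hx := by
    exact (smul_eq_zero (M := Finset (G.Conn (S : Set E(G))) →₀ ℤ).1 hx).resolve_left hn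
  eq_zero {S j x} hr hj hx := by
    have hb := connMap_bijective_of_rank_eq (Set.subset_univ (S : Set E(G))) hr
    have hsub : ∀ F, F = (G.spanning (S : Set E(G))).connectedComponentMk v₀ := fun F => hb.1 (by
      have := hG.preconnected.subsingleton_connectedComponent
      exact Subsingleton.elim _ _)
    refine Finsupp.ext fun X => ?_
    by_contra hX
    have h := hx (Finsupp.mem_support_iff.2 hX)
    refine hj ?_
    have hcard : X.card = 1 := Finset.card_eq_one.2
      ⟨_, Finset.eq_singleton_iff_unique_mem.2 ⟨h.1, fun F _ => hsub F⟩⟩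
    have := h.2
    rw [hcard] at this
    push_cast at this
    omega
  map_injective {S e} hr := by
    have hb := connMap_bijective_of_rank_eq (Finset.coe_subset.2 (Finset.subset_insert e S)) hr.symm
    obtain ⟨t, ht1, ht2⟩ := Function.bijective_iff_has_inverse.1 hb
    refine Function.LeftInverse.injective (g := Labelling.push ℤ t) fun x => ?_
    change Labelling.push ℤ t (Labelling.push ℤ _ x) = x
    rw [Labelling.push_push, ht1.id, Labelling.push_id]
  map_surjective {S e} hr j y hy := by
    have hb := connMap_bijective_of_rank_eq (Finset.coe_subset.2 (Finset.subset_insert e S)) hr.symm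
    obtain ⟨t, ht1, ht2⟩ := Function.bijective_iff_has_inverse.1 hb
    classical
    refine ⟨Labelling.push ℤ t y, ?_, ?_⟩
    · refine Labelling.map_mem_supported (f := Labelling.push ℤ t) (fun X hX => ?_) hy
      rw [Labelling.push_single, if_pos ht2.injective.injOn]
      refine Finsupp.single_mem_supported ℤ _ ⟨Finset.mem_image.2 ⟨_, hX.1, ?_⟩, ?_⟩
      · exact ht1 ((G.spanning (S : Set E(G))).connectedComponentMk v₀)
      · rw [Finset.card_image_of_injective _ ht2.injective, hX.2]
    · refine (Labelling.push_push _ _ _).trans ?_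
      rw [ht2.id]
      exact Labelling.push_id _
  koszul {S e} _ hr := nonempty_koszulOperators_rootedCube v₀ (by
    rw [← Finset.coe_insert, hr]
    exact Nat.lt_succ_self _)

end Rooted

end Graph

/-! ### Contraction, degrees and bases in exterior algebras -/

namespace ExteriorAlgebra

variable {R : Type*} [CommRing R] {M : Type*} [AddCommGroup M] [Module R M]

/-- Contraction of the exterior algebra with a linear form. -/
def contract (φ : M →ₗ[R] R) : ExteriorAlgebra R M →ₗ[R] ExteriorAlgebra R M :=
  CliffordAlgebra.contractLeft φ

theorem contract_ι_mul (φ : M →ₗ[R] R) (m : M) (x : ExteriorAlgebra R M) :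
    contract φ (ι R m * x) = φ m • x - ι R m * contract φ x :=
  CliffordAlgebra.contractLeft_ι_mul _ _ _

theorem contract_algebraMap (φ : M →ₗ[R] R) (r : R) :
    contract φ (algebraMap R (ExteriorAlgebra R M) r) = 0 :=
  CliffordAlgebra.contractLeft_algebraMap _ _ _

/-- Left multiplication by vectors generates everything from scalars; in the inductive step the
extra terms cancel since m squares to zero and anticommutes with a. If φ(m) = 1 the linear map is
projection along m, which yields the axiom `lift_map`. -/
theorem map_sub_smulRight (φ : M →ₗ[R] R) (m : M) (x : ExteriorAlgebra R M) :
    map (LinearMap.id - φ.smulRight m) x = x - ι R m * contract φ x := by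
  induction x using CliffordAlgebra.left_induction with
  | algebraMap r =>
    have := contract_algebraMap φ r
    rw [this, mul_zero, sub_zero]
    exact AlgHom.commutes _ r
  | add x y hx hy => rw [map_add, hx, hy, map_add, mul_add]; abel
  | ι_mul x a hx =>
    change map _ (ι R a * x) = ι R a * x - ι R m * contract φ (ι R a * x)
    have h1 : ι R a * (ι R m * contract φ x) = - (ι R m * (ι R a * contract φ x)) := by
      rw [← mul_assoc, ← mul_assoc, eq_neg_of_add_eq_zero_left (ι_add_mul_swap a m), neg_mul]
    have h2 : ι R m * (ι R m * contract φ x) = 0 := by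
      rw [← mul_assoc, ι_sq_zero, zero_mul]
    rw [map_mul, hx, map_apply_ι, contract_ι_mul, LinearMap.sub_apply, LinearMap.id_apply,
      LinearMap.smulRight_apply, map_sub, map_smul, sub_mul, mul_sub, mul_sub, mul_sub, h1,
      smul_mul_assoc, smul_mul_assoc, h2, smul_zero, mul_smul_comm]
    abel

theorem ι_mul_mem_exteriorDegree (m : M) {j : ℤ} {x : ExteriorAlgebra R M}
    (hx : x ∈ exteriorDegree R M j) : ι R m * x ∈ exteriorDegree R M (j + 1) := by
  cases j with
  | ofNat n =>
    change _ ∈ ⋀[R]^(n + 1) M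
    rw [exteriorPower, pow_succ']
    exact Submodule.mul_mem_mul (LinearMap.mem_range_self _ _) hx
  | negSucc n =>
    have : x = 0 := hx
    rw [this, mul_zero]
    exact Submodule.zero_mem _

/-- Induction on the degree by the Leibniz rule. A scalar contracts to 0, the only element of degree
-1. -/
theorem contract_mem_exteriorDegree (φ : M →ₗ[R] R) {j : ℤ} {x : ExteriorAlgebra R M}
    (hx : x ∈ exteriorDegree R M j) : contract φ x ∈ exteriorDegree R M (j - 1) := by
  cases j with
  | negSucc n =>
    have : x = 0 := hx
    rw [this, map_zero]
    exact Submodule.zero_mem _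
  | ofNat n =>
    change x ∈ ⋀[R]^n M at hx
    change _ ∈ exteriorDegree R M ((n : ℤ) - 1)
    induction n generalizing x with
    | zero =>
      rw [exteriorPower, pow_zero, Submodule.mem_one] at hx
      obtain ⟨r, rfl⟩ := hx
      rw [contract_algebraMap]
      exact Submodule.zero_mem _
    | succ n ih =>
      rw [exteriorPower, pow_succ'] at hx
      have hn : ((n + 1 : ℕ) : ℤ) - 1 = Int.ofNat n := by push_cast; simp
      induction hx using Submodule.mul_induction_on' with
      | mem_mul_mem a ha y hy =>
        obtain ⟨m, rfl⟩ := ha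
        rw [contract_ι_mul, hn]
        refine sub_mem (Submodule.smul_mem _ _ hy) ?_
        have := ι_mul_mem_exteriorDegree m (ih hy)
        rwa [sub_add_cancel] at this
      | add a _ b _ ha hb =>
        rw [map_add]
        exact add_mem ha hb

theorem exteriorDegree_eq_zero_of_subsingleton [Subsingleton M] {j : ℤ} (hj : j ≠ 0)
    {x : ExteriorAlgebra R M} (hx : x ∈ exteriorDegree R M j) : x = 0 := by
  match j, hx with
  | Int.negSucc n, hx => exact hx
  | Int.ofNat 0, hx => exact absurd rfl hj
  | Int.ofNat (n + 1), hx =>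
    change x ∈ ⋀[R]^(n + 1) M at hx
    have hι : LinearMap.range (ι R : M →ₗ[R] ExteriorAlgebra R M) = ⊥ := by
      rw [Submodule.eq_bot_iff]
      rintro _ ⟨m, rfl⟩
      rw [Subsingleton.elim m 0, map_zero]
    rw [exteriorPower, pow_succ', hι, Submodule.bot_mul] at hx
    exact hx

/-- The basis of the exterior algebra, in terms of ordered products. -/
theorem basis_eq_prod_sort {I : Type*} [LinearOrder I] (b : Module.Basis I R M) (s : Finset I) :
    b.ExteriorAlgebra s = ((s.sort (· ≤ ·)).map fun i => ι R (b i)).prod := by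
  rw [basis_apply_ofCard b rfl, ιMulti_family, ιMulti_apply, ← s.listMap_orderEmbOfFin_finRange rfl,
    List.map_map, List.ofFn_eq_map]
  rfl

theorem basis_mem_exteriorDegree {I : Type*} [LinearOrder I] (b : Module.Basis I R M)
    (s : Finset I) : b.ExteriorAlgebra s ∈ exteriorDegree R M s.card := by
  rw [basis_apply_ofCard b rfl]
  exact ιMulti_range R s.card (Set.mem_range_self _)

theorem mem_span_of_mem_exteriorDegree {I : Type*} [LinearOrder I] (b : Module.Basis I R M)
    {j : ℤ} {x : ExteriorAlgebra R M} (hx : x ∈ exteriorDegree R M j) :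
    x ∈ Submodule.span R (b.ExteriorAlgebra '' {s | (s.card : ℤ) = j}) := by
  cases j with
  | negSucc n =>
    have : x = 0 := hx
    rw [this]
    exact Submodule.zero_mem _
  | ofNat n =>
    change x ∈ ⋀[R]^n M at hx
    have h : (⟨x, hx⟩ : ⋀[R]^n M) ∈ Submodule.span R (Set.range (b.exteriorPower n)) := by
      rw [(b.exteriorPower n).span_eq]
      exact Submodule.mem_top
    have h' := Submodule.mem_map_of_mem (f := (⋀[R]^n M).subtype) h
    rw [Submodule.map_span] at h'
    refine Submodule.span_mono ?_ h'
    rintro _ ⟨_, ⟨s, rfl⟩, rfl⟩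
    refine ⟨s, ?_, basis_eq_coe_basis b s⟩
    have := s.2
    exact congrArg (Nat.cast : ℕ → ℤ) this

end ExteriorAlgebra

theorem Submodule.factor_self {R M : Type*} [Ring R] [AddCommGroup M] [Module R M]
    {p : Submodule R M} (h : p ≤ p) : Submodule.factor h = LinearMap.id :=
  Submodule.linearMap_qext _ rfl

/-! ### Koszul operators on the cube of a quasi-representation -/

namespace QuasiRepresentation

variable {R : Type*} [CommRing R] [IsDomain R] [IsPrincipalIdealRing R] {N : Type*}
  [AddCommGroup N] [Module R N] [Module.Finite R N] {E : Type*} {M : Matroid E}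
  (Q : QuasiRepresentation R N M)

/-- Multiplication by and contraction of the vector of a bridge. -/
theorem nonempty_koszulOperators [LinearOrder E] {B : Finset E} {e : E} (m : N) (φ : N →ₗ[R] R)
    (hm : φ m = 1) (hφ : ∀ x ∈ Q.ρ B, φ x = 0)
    (hρ : ∀ S : Finset E, Q.ρ (insert e (S : Set E)) = Q.ρ S ⊔ Submodule.span R {m}) :
    Nonempty (Q.cube.KoszulOperators B e) := by
  have hφ' : ∀ S : Finset E, S ⊆ B → ∀ x ∈ Q.ρ S, φ x = 0 := fun S hS x hx =>
    hφ x (Q.mono (Finset.coe_subset.2 hS) hx)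
  -- For S ⊄ B the form φ may not descend to N/ρ(S). The value 0 is harmless, since the axioms on
  -- `contract` concern only S ⊆ B; the same default is used for the section below.
  have hφS : ∀ S : Finset E, ∃ ψ : (N ⧸ Q.ρ S) →ₗ[R] R,
      S ⊆ B → ∀ x, ψ ((Q.ρ S).mkQ x) = φ x := by
    intro S
    by_cases hS : S ⊆ B
    · exact ⟨(Q.ρ S).liftQ φ (hφ' S hS), fun _ x => rfl⟩
    · exact ⟨0, fun h => absurd h hS⟩
  choose ψ hψ using hφS
  have hsec : ∀ S : Finset E, ∃ s : (N ⧸ Q.ρ ((insert e S : Finset E) : Set E)) →ₗ[R] N ⧸ Q.ρ S,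
      S ⊆ B → ∀ x, s ((Q.ρ ((insert e S : Finset E) : Set E)).mkQ x) =
        (Q.ρ S).mkQ (x - φ x • m) := by
    intro S
    by_cases hS : S ⊆ B
    · refine ⟨(Q.ρ _).liftQ ((Q.ρ S).mkQ ∘ₗ (LinearMap.id - φ.smulRight m)) ?_, fun _ x => rfl⟩
      rw [Finset.coe_insert, hρ, sup_le_iff, Submodule.span_singleton_le_iff_mem]
      constructor
      · intro x hx
        simpa [hφ' S hS x hx] using hx
      · simp [hm]
    · exact ⟨0, fun h => absurd h hS⟩
  choose s hs using hsec
  let π : ∀ S : Finset E, (N ⧸ Q.ρ S) →ₗ[R] N ⧸ Q.ρ ((insert e S : Finset E) : Set E) := fun S =>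
    Submodule.factor (Q.mono (Finset.coe_subset.2 (Finset.subset_insert e S)))
  have hπs : ∀ S ⊆ B, π S ∘ₗ s S = LinearMap.id := by
    intro S hS
    refine Submodule.linearMap_qext _ (LinearMap.ext fun x => ?_)
    change π S (s S (Submodule.mkQ _ x)) = Submodule.mkQ _ x
    rw [hs S hS]
    change Submodule.mkQ (Q.ρ ((insert e S : Finset E) : Set E)) (x - φ x • m) = _
    rw [map_sub, sub_eq_self, Submodule.mkQ_apply, Submodule.Quotient.mk_eq_zero, Finset.coe_insert,
      hρ]
    exact Submodule.smul_mem _ _ (Submodule.mem_sup_right (Submodule.mem_span_singleton_self m))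
  have hsπ : ∀ S ⊆ B, s S ∘ₗ π S = LinearMap.id - (ψ S).smulRight ((Q.ρ S).mkQ m) := by
    intro S hS
    refine Submodule.linearMap_qext _ (LinearMap.ext fun x => ?_)
    change s S (Submodule.mkQ _ x) = (Q.ρ S).mkQ x - ψ S ((Q.ρ S).mkQ x) • (Q.ρ S).mkQ m
    rw [hs S hS, hψ S hS, map_sub, map_smul]
  have hπm : ∀ S, π S ((Q.ρ S).mkQ m) = 0 := by
    intro S
    change Submodule.mkQ (Q.ρ ((insert e S : Finset E) : Set E)) m = 0
    rw [Submodule.mkQ_apply, Submodule.Quotient.mk_eq_zero, Finset.coe_insert, hρ]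
    exact Submodule.mem_sup_right (Submodule.mem_span_singleton_self m)
  refine ⟨{
    mul := fun S => LinearMap.mulLeft R (ExteriorAlgebra.ι R ((Q.ρ S).mkQ m))
    contract := fun S => ExteriorAlgebra.contract (ψ S)
    lift := fun S => (ExteriorAlgebra.map (s S)).toLinearMap
    mul_mem := fun _ _ _ hx => ExteriorAlgebra.ι_mul_mem_exteriorDegree _ hx
    contract_mem := fun _ _ _ hx => ExteriorAlgebra.contract_mem_exteriorDegree _ hx
    lift_mem := fun _ _ _ hx => exteriorDegree_map _ _ _ hx
    map_mul := ?_
    map_lift := ?_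
    lift_map := ?_
    map_insert_mul := ?_
    mul_contract_add := ?_ }⟩
  · intro S T h _ (x : ExteriorAlgebra R (N ⧸ Q.ρ S))
    change ExteriorAlgebra.map _ (ExteriorAlgebra.ι R ((Q.ρ S).mkQ m) * x) = _
    rw [map_mul, ExteriorAlgebra.map_apply_ι]
    rfl
  · intro S hS x
    change ExteriorAlgebra.map (π S) (ExteriorAlgebra.map (s S) x) = x
    have := ExteriorAlgebra.map_comp_map (s S) (π S)
    rw [hπs S hS, ExteriorAlgebra.map_id] at this
    exact DFunLike.congr_fun this x
  · intro S hS x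
    change ExteriorAlgebra.map (s S) (ExteriorAlgebra.map (π S) x) = _
    have := DFunLike.congr_fun (ExteriorAlgebra.map_comp_map (π S) (s S)) x
    rw [hsπ S hS] at this
    exact this.trans (ExteriorAlgebra.map_sub_smulRight _ _ _)
  · intro S hS (x : ExteriorAlgebra R (N ⧸ Q.ρ S))
    change ExteriorAlgebra.map (π S) (ExteriorAlgebra.ι R ((Q.ρ S).mkQ m) * x) = 0
    rw [map_mul, ExteriorAlgebra.map_apply_ι, hπm, map_zero, zero_mul]
  · intro S hS (x : ExteriorAlgebra R (N ⧸ Q.ρ S))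
    change ExteriorAlgebra.ι R ((Q.ρ S).mkQ m) * ExteriorAlgebra.contract (ψ S) x +
      ExteriorAlgebra.contract (ψ S) (ExteriorAlgebra.ι R ((Q.ρ S).mkQ m) * x) = x
    rw [ExteriorAlgebra.contract_ι_mul, hψ S hS, hm, one_smul, add_sub_cancel]

end QuasiRepresentation

/-! ### Bases from minimal vertices; the matroid cube is matroidal -/

namespace Graph

variable {α β : Type*} {G : Graph α β}

theorem rhoTilde_insert {S : Set E(G)} {e : E(G)} {u v : V(G)} (hl : G.IsLink e u v) :
    G.rhoTilde (insert e S) = G.rhoTilde S ⊔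
      Submodule.span ℤ {Finsupp.single v 1 - Finsupp.single u 1} := by
  apply le_antisymm
  · refine Submodule.span_le.2 ?_
    rintro x ⟨f, hf | hf, w, w', hl', rfl⟩
    · subst hf
      refine Submodule.mem_sup_right (Submodule.mem_span_singleton.2 ?_)
      rcases hl'.eq_and_eq_or_eq_and_eq hl with ⟨h1, h2⟩ | ⟨h1, h2⟩
      · exact ⟨-1, by rw [Subtype.ext h1, Subtype.ext h2]; simp⟩
      · exact ⟨1, by rw [Subtype.ext h1, Subtype.ext h2]; simp⟩
    · exact Submodule.mem_sup_left (Submodule.subset_span ⟨f, hf, w, w', hl', rfl⟩)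
  · refine sup_le (G.rhoTilde_mono (Set.subset_insert e S)) ?_
    rw [Submodule.span_singleton_le_iff_mem]
    exact Submodule.subset_span ⟨e, Set.mem_insert e S, v, u, hl.symm, rfl⟩

section Root

variable [LinearOrder V(G)] {v₀ : V(G)}

theorem isMinVertex_univ_iff (hG : G.IsConn) (hv₀ : IsBot v₀) {v : V(G)} :
    G.IsMinVertex Set.univ v ↔ v = v₀ := by
  constructor
  · exact fun h => le_antisymm (h v₀ (hG.preconnected v v₀)) (hv₀ v)
  · rintro rfl w _
    exact hv₀ w

theorem minSubmodule_eq_span (hG : G.IsConn) (hv₀ : IsBot v₀) :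
    G.minSubmodule = Submodule.span ℤ {Finsupp.single v₀ 1} := by
  have : {v | G.IsMinVertex Set.univ v} = {v₀} := by
    ext v
    exact isMinVertex_univ_iff hG hv₀
  rw [minSubmodule, this, Set.image_singleton]

/-- The indices of the basis of `N / ρ(S)` formed by the classes of the minimal vertices of the
components of `[G:S]` which do not contain `v₀`. -/
abbrev MinIndex (v₀ : V(G)) (S : Set E(G)) : Type _ := {v : V(G) // G.IsMinVertex S v ∧ v ≠ v₀}

theorem IsMinVertex.eq_of_reachable {S : Set E(G)} {v w : V(G)} (hv : G.IsMinVertex S v)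
    (hw : G.IsMinVertex S w) (h : (G.spanning S).Reachable v w) : v = w :=
  le_antisymm (hv w h) (hw v h.symm)

theorem isMinVertex_of_isBot (hv₀ : IsBot v₀) (S : Set E(G)) : G.IsMinVertex S v₀ :=
  fun w _ => hv₀ w

/-- The set of the components of the vertices in `Y`. -/
def components (v₀ : V(G)) (S : Set E(G)) (Y : Finset (MinIndex v₀ S)) : Finset (G.Conn S) :=
  open Classical in Y.image fun v => (G.spanning S).connectedComponentMk v.1

theorem injective_connectedComponentMk_minIndex (S : Set E(G)) : Function.Injective
    fun v : MinIndex v₀ S => (G.spanning S).connectedComponentMk v.1 := fun v w h =>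
  Subtype.ext (v.2.1.eq_of_reachable w.2.1 (SimpleGraph.ConnectedComponent.exact h))

theorem card_components (S : Set E(G)) (Y : Finset (MinIndex v₀ S)) :
    (components v₀ S Y).card = Y.card := by
  classical
  exact Finset.card_image_of_injective _ (injective_connectedComponentMk_minIndex S)

theorem root_notMem_components (hv₀ : IsBot v₀) (S : Set E(G)) (Y : Finset (MinIndex v₀ S)) :
    (G.spanning S).connectedComponentMk v₀ ∉ components v₀ S Y := by
  classical
  intro h
  obtain ⟨v, -, hv⟩ := Finset.mem_image.1 h
  exact v.2.2 (v.2.1.eq_of_reachable (isMinVertex_of_isBot hv₀ S)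
    (SimpleGraph.ConnectedComponent.exact hv))

variable [Finite V(G)]

/-- The linear form on `N` which takes the value `1` on the vertices in the component of `v` in
`[G:S]` and the value `0` on all other vertices. -/
theorem exists_componentForm (hG : G.IsConn) (hv₀ : IsBot v₀) [Finite E(G)] (S : Set E(G))
    {v : V(G)} (hv : ¬ (G.spanning S).Reachable v v₀) :
    ∃ φ : ((V(G) →₀ ℤ) ⧸ G.minSubmodule) →ₗ[ℤ] ℤ,
      (∀ w, (G.spanning S).Reachable w v → φ (G.minSubmodule.mkQ (Finsupp.single w 1)) = 1) ∧
      (∀ w, ¬ (G.spanning S).Reachable w v → φ (G.minSubmodule.mkQ (Finsupp.single w 1)) = 0) ∧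
      ∀ x ∈ G.canonical.ρ S, φ x = 0 := by
  classical
  -- The form sums coefficients over the component of v; since v₀ lies outside that component, it
  -- descends to N.
  let ψ : (V(G) →₀ ℤ) →ₗ[ℤ] ℤ :=
    Finsupp.lapply ((G.spanning S).connectedComponentMk v) ∘ₗ G.toConn S
  have hψ : ∀ w, ψ (Finsupp.single w 1) = if (G.spanning S).connectedComponentMk w =
      (G.spanning S).connectedComponentMk v then 1 else 0 := by
    intro w
    simp only [ψ, LinearMap.comp_apply, toConn_single, Finsupp.lapply_apply]
    rw [Finsupp.single_apply]
  have h1 : ∀ w, (G.spanning S).Reachable w v → ψ (Finsupp.single w 1) = 1 := fun w hw => by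
    rw [hψ, if_pos (SimpleGraph.ConnectedComponent.sound hw)]
  have h0 : ∀ w, ¬ (G.spanning S).Reachable w v → ψ (Finsupp.single w 1) = 0 := fun w hw => by
    rw [hψ, if_neg fun h => hw (SimpleGraph.ConnectedComponent.exact h)]
  have hker : G.minSubmodule ≤ LinearMap.ker ψ := by
    rw [minSubmodule_eq_span hG hv₀, Submodule.span_singleton_le_iff_mem, LinearMap.mem_ker]
    exact h0 v₀ fun h => hv h.symm
  refine ⟨G.minSubmodule.liftQ ψ hker, h1, h0, ?_⟩
  rintro _ ⟨x, hx, rfl⟩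
  rw [SetLike.mem_coe, ← ker_toConn, LinearMap.mem_ker] at hx
  change ψ x = 0
  simp only [ψ, LinearMap.comp_apply]
  rw [hx, map_zero]

theorem exists_isMinVertex (S : Set E(G)) (v : V(G)) :
    ∃ w, G.IsMinVertex S w ∧ (G.spanning S).Reachable v w := by
  obtain ⟨w, hw, hmin⟩ := Set.exists_min_image {w | (G.spanning S).Reachable v w} id
    (Set.toFinite _) ⟨v, SimpleGraph.Reachable.refl v⟩
  exact ⟨w, fun u hu => hmin u (SimpleGraph.Reachable.trans hw hu), hw⟩

theorem exists_components_eq (S : Set E(G)) {X : Finset (G.Conn S)}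
    (hX : (G.spanning S).connectedComponentMk v₀ ∉ X) : ∃ Y, components v₀ S Y = X := by
  classical
  refine ⟨(Set.toFinite {v : MinIndex v₀ S | (G.spanning S).connectedComponentMk v.1 ∈ X}).toFinset,
    ?_⟩
  ext F
  simp only [components, Finset.mem_image, Set.Finite.mem_toFinset, Set.mem_ofPred_eq]
  constructor
  · rintro ⟨v, hv, rfl⟩
    exact hv
  · intro hF
    induction F using SimpleGraph.ConnectedComponent.ind with | h v
    obtain ⟨w, hw, hvw⟩ := exists_isMinVertex S v
    have h := SimpleGraph.ConnectedComponent.sound hvw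
    rw [h] at hF ⊢
    exact ⟨⟨w, hw, fun h0 => hX (h0 ▸ hF)⟩, hF, rfl⟩

variable [Finite E(G)]

/-- The forms of the components are dual to the minimal vertices, which gives independence. They
span because a vertex is congruent to the minimum of its component, and v₀ is zero in N. -/
theorem exists_quotientBasis (hG : G.IsConn) (hv₀ : IsBot v₀) (S : Set E(G)) :
    ∃ b : Module.Basis (MinIndex v₀ S) ℤ (((V(G) →₀ ℤ) ⧸ G.minSubmodule) ⧸ G.canonical.ρ S),
      ∀ v, b v = (G.canonical.ρ S).mkQ (G.minSubmodule.mkQ (Finsupp.single v.1 1)) := by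
  have hnr : ∀ v : MinIndex v₀ S, ¬ (G.spanning S).Reachable v.1 v₀ := fun v h =>
    v.2.2 (v.2.1.eq_of_reachable (isMinVertex_of_isBot hv₀ S) h)
  choose φ hφ1 hφ0 hφ using fun v : MinIndex v₀ S => exists_componentForm hG hv₀ S (hnr v)
  let ψ : ∀ v : MinIndex v₀ S, Module.Dual ℤ (((V(G) →₀ ℤ) ⧸ G.minSubmodule) ⧸ G.canonical.ρ S) :=
    fun v => (G.canonical.ρ S).liftQ (φ v) (hφ v)
  let f : MinIndex v₀ S → ((V(G) →₀ ℤ) ⧸ G.minSubmodule) ⧸ G.canonical.ρ S := fun v =>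
    (G.canonical.ρ S).mkQ (G.minSubmodule.mkQ (Finsupp.single v.1 1))
  have hli : LinearIndependent ℤ f := by
    refine LinearIndependent.of_pairwise_dual_eq_zero_one f ψ (fun v w hvw => ?_) fun v => ?_
    · exact hφ0 v w.1 fun h => hvw (Subtype.ext (v.2.1.eq_of_reachable w.2.1 h.symm))
    · exact hφ1 v v.1 (SimpleGraph.Reachable.refl _)
  have hspan : ⊤ ≤ Submodule.span ℤ (Set.range f) := by
    have hmem : ∀ v : V(G), (G.canonical.ρ S).mkQ (G.minSubmodule.mkQ (Finsupp.single v 1)) ∈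
        Submodule.span ℤ (Set.range f) := by
      intro v
      obtain ⟨w, hw, hvw⟩ := exists_isMinVertex S v
      have h : (G.canonical.ρ S).mkQ (G.minSubmodule.mkQ (Finsupp.single v 1)) =
          (G.canonical.ρ S).mkQ (G.minSubmodule.mkQ (Finsupp.single w 1)) := by
        rw [← sub_eq_zero, ← map_sub, ← map_sub, Submodule.mkQ_apply, Submodule.Quotient.mk_eq_zero]
        exact ⟨_, G.single_sub_mem_rhoTilde hvw, rfl⟩
      rw [h]
      by_cases hw0 : w = v₀
      · have h0 : G.minSubmodule.mkQ (Finsupp.single w 1) = 0 := by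
          rw [Submodule.mkQ_apply, Submodule.Quotient.mk_eq_zero, minSubmodule_eq_span hG hv₀, hw0]
          exact Submodule.mem_span_singleton_self _
        rw [h0, map_zero]
        exact Submodule.zero_mem _
      · exact Submodule.subset_span ⟨⟨w, hw, hw0⟩, rfl⟩
    rintro x -
    obtain ⟨x, rfl⟩ := (G.canonical.ρ S).mkQ_surjective x
    obtain ⟨x, rfl⟩ := G.minSubmodule.mkQ_surjective x
    induction x using Finsupp.induction_linear with
    | zero => simp
    | add x y hx hy =>
      rw [map_add, map_add]
      exact add_mem hx hy
    | single v a =>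
      have : (Finsupp.single v a : V(G) →₀ ℤ) = a • Finsupp.single v 1 := by simp
      rw [this, map_smul, map_smul]
      exact Submodule.smul_mem _ _ (hmem v)
  exact ⟨Module.Basis.mk hli hspan, fun v => Module.Basis.mk_apply hli hspan v⟩

/-- The products of minimal vertices form a basis of the exterior algebra. -/
theorem exists_wedgeBasis (hG : G.IsConn) (hv₀ : IsBot v₀) (S : Set E(G)) :
    ∃ b : Module.Basis (MinIndex v₀ S) ℤ (((V(G) →₀ ℤ) ⧸ G.minSubmodule) ⧸ G.canonical.ρ S),
      ∀ Y, b.ExteriorAlgebra Y = G.wedge S (components v₀ S Y) := by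
  classical
  obtain ⟨b, hb⟩ := exists_quotientBasis hG hv₀ S
  refine ⟨b, fun Y => ?_⟩
  set A := (Set.toFinite {v | G.IsMinVertex S v ∧
    (G.spanning S).connectedComponentMk v ∈ components v₀ S Y}).toFinset with hA
  have hmem : ∀ v, v ∈ A ↔ ∃ w ∈ Y, w.1 = v := by
    intro v
    rw [hA, Set.Finite.mem_toFinset]
    constructor
    · rintro ⟨hv, hv'⟩
      obtain ⟨w, hw, hwv⟩ := Finset.mem_image.1 hv'
      exact ⟨w, hw, w.2.1.eq_of_reachable hv (SimpleGraph.ConnectedComponent.exact hwv)⟩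
    · rintro ⟨w, hw, rfl⟩
      exact ⟨w.2.1, Finset.mem_image_of_mem _ hw⟩
  have hAY : A = Y.map (Function.Embedding.subtype _) := by
    ext v
    rw [hmem]
    simp
  have hcard : A.card = Y.card := by rw [hAY, Finset.card_map]
  -- The order on indices is that of the vertices, so both products list the factors in the same
  -- order and no sign appears.
  have hemb : (fun i => (Y.orderEmbOfFin rfl i).1) = A.orderEmbOfFin hcard :=
    Finset.orderEmbOfFin_unique hcard (fun i => (hmem _).2 ⟨_, Y.orderEmbOfFin_mem rfl i, rfl⟩)
      fun i j hij => (Y.orderEmbOfFin rfl).strictMono hij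
  have hsort : A.sort (· ≤ ·) = (Y.sort (· ≤ ·)).map Subtype.val := by
    rw [← A.listMap_orderEmbOfFin_finRange hcard, ← Y.listMap_orderEmbOfFin_finRange rfl,
      List.map_map, ← hemb]
    rfl
  rw [ExteriorAlgebra.basis_eq_prod_sort, wedge, ← hA, hsort, List.map_map]
  congr 2
  funext v
  rw [hb, Function.comp_apply]

theorem wedge_eq_zero (hG : G.IsConn) (hv₀ : IsBot v₀) {S : Set E(G)} {X : Finset (G.Conn S)}
    (hX : (G.spanning S).connectedComponentMk v₀ ∈ X) : G.wedge S X = 0 := by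
  refine List.prod_eq_zero (List.mem_map.2 ⟨v₀, ?_, ?_⟩)
  · rw [Finset.mem_sort, Set.Finite.mem_toFinset]
    exact ⟨isMinVertex_of_isBot hv₀ S, hX⟩
  · have h0 : G.minSubmodule.mkQ (Finsupp.single v₀ 1) = 0 := by
      rw [Submodule.mkQ_apply, Submodule.Quotient.mk_eq_zero, minSubmodule_eq_span hG hv₀]
      exact Submodule.mem_span_singleton_self _
    rw [h0, map_zero, map_zero]

theorem canonical_ρ_eq {S T : Set E(G)} (h : S ⊆ T) (hr : G.graphicRank S = G.graphicRank T) :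
    G.canonical.ρ S = G.canonical.ρ T :=
  congrArg (Submodule.map G.minSubmodule.mkQ) (G.rhoTilde_eq_of_rank_eq h hr)

/-- At full rank N/ρ(S) = 0 and only scalars remain. Edges that add no rank leave ρ(S) unchanged.
For a bridge from u to v the Koszul vector is v - u, and the dual form is that of the component of
v, the side without v₀. -/
theorem isMatroidal_canonical [LinearOrder E(G)] (hG : G.IsConn) (hv₀ : IsBot v₀) :
    G.canonical.cube.IsMatroidal (fun S => G.graphicRank S) (G.graphicRank Set.univ) where
  rank_mono h := G.graphicRank_mono _ _ (Finset.coe_subset.2 h)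
  rank_le S := G.graphicRank_mono _ _ (Set.subset_univ _)
  rank_insert_le S e := by
    rw [Finset.coe_insert]
    exact graphicRank_insert_le _ e
  rank_insert_eq {S T e} h hr := by
    rw [Finset.coe_insert] at hr ⊢
    exact graphicRank_insert_eq_of_subset (Finset.coe_subset.2 h) hr
  torsionFree S n x hn hx := by
    obtain ⟨b, -⟩ := exists_quotientBasis hG hv₀ (S : Set E(G))
    have := Module.Free.of_basis b.ExteriorAlgebra
    exact (smul_eq_zero (M := ExteriorAlgebra ℤ
      (((V(G) →₀ ℤ) ⧸ G.minSubmodule) ⧸ G.canonical.ρ S)).1 hx).resolve_left hn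
  eq_zero {S j x} hr hj hx := by
    have htop : G.canonical.ρ S = ⊤ := by
      rw [canonical_ρ_eq (Set.subset_univ _) hr, G.canonical.univ]
    have : Subsingleton (((V(G) →₀ ℤ) ⧸ G.minSubmodule) ⧸ G.canonical.ρ S) :=
      Submodule.Quotient.subsingleton_iff.2 htop
    exact ExteriorAlgebra.exteriorDegree_eq_zero_of_subsingleton hj hx
  map_injective {S e} hr := by
    have hle := (canonical_ρ_eq (Finset.coe_subset.2 (Finset.subset_insert e S)) hr.symm).ge
    refine Function.LeftInverse.injective
      (g := ExteriorAlgebra.map (Submodule.factor hle)) fun x => ?_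
    have := ExteriorAlgebra.map_comp_map (Submodule.factor (G.canonical.mono
      (Finset.coe_subset.2 (Finset.subset_insert e S)))) (Submodule.factor hle)
    rw [Submodule.factor_comp, Submodule.factor_self, ExteriorAlgebra.map_id] at this
    exact DFunLike.congr_fun this x
  map_surjective {S e} hr j y hy := by
    have hle := (canonical_ρ_eq (Finset.coe_subset.2 (Finset.subset_insert e S)) hr.symm).ge
    refine ⟨ExteriorAlgebra.map (Submodule.factor hle) y, exteriorDegree_map _ _ _ hy, ?_⟩
    have := ExteriorAlgebra.map_comp_map (Submodule.factor hle) (Submodule.factor (G.canonical.mono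
      (Finset.coe_subset.2 (Finset.subset_insert e S))))
    rw [Submodule.factor_comp, Submodule.factor_self, ExteriorAlgebra.map_id] at this
    exact DFunLike.congr_fun this y
  koszul {S e} _ hr := by
    have hr' : G.graphicRank S < G.graphicRank (insert e (S : Set E(G))) := by
      rw [← Finset.coe_insert, hr]
      exact Nat.lt_succ_self _
    obtain ⟨u, v, hl, hvu, hv⟩ := exists_isLink_of_rank_lt v₀ hr'
    obtain ⟨φ, hφ1, hφ0, hφ⟩ := exists_componentForm hG hv₀ (S : Set E(G)) hv
    refine G.canonical.nonempty_koszulOperators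
      (G.minSubmodule.mkQ (Finsupp.single v 1 - Finsupp.single u 1)) φ ?_ hφ fun T => ?_
    · rw [map_sub, map_sub, hφ1 v (SimpleGraph.Reachable.refl v), hφ0 u fun h => hvu h.symm,
        sub_zero]
    · change Submodule.map _ (G.rhoTilde _) = Submodule.map _ (G.rhoTilde _) ⊔ _
      rw [rhoTilde_insert hl, Submodule.map_sup, Submodule.map_span, Set.image_singleton]

end Root

end Graph

/-! ### Inserting and removing the label of the root component -/

namespace Graph

variable {α β : Type*} {G : Graph α β} {v₀ : V(G)}

variable (G) in
/-- Multiplication by the label `x` at the component of `v₀`, in every spanning subgraph. -/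
def insRoot (v₀ : V(G)) : (∀ S, G.chromaticCube.obj S) →ₗ[ℤ] (∀ S, G.chromaticCube.obj S) :=
  LinearMap.pi fun S => (Labelling.ins ℤ ((G.spanning (S : Set E(G))).connectedComponentMk v₀) :
    (Finset (G.Conn (S : Set E(G))) →₀ ℤ) →ₗ[ℤ] (Finset (G.Conn (S : Set E(G))) →₀ ℤ)) ∘ₗ
      LinearMap.proj S

variable (G) in
/-- Removal of the label `x` at the component of `v₀`, in every spanning subgraph. -/
def delRoot (v₀ : V(G)) : (∀ S, G.chromaticCube.obj S) →ₗ[ℤ] (∀ S, G.chromaticCube.obj S) :=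
  LinearMap.pi fun S => (Labelling.del ℤ ((G.spanning (S : Set E(G))).connectedComponentMk v₀) :
    (Finset (G.Conn (S : Set E(G))) →₀ ℤ) →ₗ[ℤ] (Finset (G.Conn (S : Set E(G))) →₀ ℤ)) ∘ₗ
      LinearMap.proj S

theorem insRoot_delRoot_add (x : ∀ S, G.chromaticCube.obj S) :
    G.insRoot v₀ (G.delRoot v₀ x) + G.delRoot v₀ (G.insRoot v₀ x) = x :=
  funext fun S => Labelling.ins_del_add _ (x S : Finset (G.Conn (S : Set E(G))) →₀ ℤ)

theorem insRoot_insRoot (x : ∀ S, G.chromaticCube.obj S) :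
    G.insRoot v₀ (G.insRoot v₀ x) = 0 :=
  funext fun S => Labelling.ins_ins _ (x S : Finset (G.Conn (S : Set E(G))) →₀ ℤ)

theorem diff_insRoot [LinearOrder E(G)] (x : ∀ S, G.chromaticCube.obj S) :
    G.chromaticCube.diff (G.insRoot v₀ x) = G.insRoot v₀ (G.chromaticCube.diff x) := by
  funext T
  change _ = (Labelling.ins ℤ ((G.spanning (T : Set E(G))).connectedComponentMk v₀) :
    (Finset (G.Conn (T : Set E(G))) →₀ ℤ) →ₗ[ℤ] (Finset (G.Conn (T : Set E(G))) →₀ ℤ))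
      (G.chromaticCube.diff x T)
  rw [GradedCube.diff_apply, GradedCube.diff_apply]
  refine Eq.trans ?_ (map_sum _ _ _).symm
  refine Finset.sum_congr rfl fun e _ => ?_
  refine Eq.trans ?_ (map_zsmul _ _ _).symm
  congr 1
  exact Labelling.push_ins (G.connMap (Finset.coe_subset.2 (T.erase_subset e))) _ _

theorem insRoot_mem_chain {i j : ℤ} {x : ∀ S, G.chromaticCube.obj S}
    (hx : x ∈ G.chromaticCube.chain i j) : G.insRoot v₀ x ∈ (G.rootedCube v₀).chain i j := by
  classical
  refine fun S => ⟨?_, fun hS => ?_⟩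
  · refine Labelling.map_mem_supported (f := Labelling.ins ℤ
      ((G.spanning (S : Set E(G))).connectedComponentMk v₀)) (fun X hX => ?_) (hx S).1
    rw [Labelling.ins_single]
    split_ifs with h
    · exact Submodule.zero_mem _
    · refine Finsupp.single_mem_supported ℤ _ ⟨Finset.mem_insert_self _ _, ?_⟩
      rw [Finset.card_insert_of_notMem h, Nat.cast_succ, hX]
  · change (Labelling.ins ℤ _ : (Finset (G.Conn (S : Set E(G))) →₀ ℤ) →ₗ[ℤ] _) (x S) = 0
    rw [(hx S).2 hS]
    exact map_zero _

theorem delRoot_mem_chain {i j : ℤ} {x : ∀ S, G.chromaticCube.obj S}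
    (hx : x ∈ (G.rootedCube v₀).chain i j) : G.delRoot v₀ x ∈ G.chromaticCube.chain i j := by
  classical
  refine fun S => ⟨?_, fun hS => ?_⟩
  · refine Labelling.map_mem_supported (f := Labelling.del ℤ
      ((G.spanning (S : Set E(G))).connectedComponentMk v₀)) (fun X hX => ?_) (hx S).1
    rw [Labelling.del_single, if_pos hX.1]
    refine Finsupp.single_mem_supported ℤ _ ?_
    have := Finset.card_erase_add_one hX.1
    have := hX.2
    rw [Set.mem_ofPred_eq]
    omega
  · change (Labelling.del ℤ _ : (Finset (G.Conn (S : Set E(G))) →₀ ℤ) →ₗ[ℤ] _) (x S) = 0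
    rw [(hx S).2 hS]
    exact map_zero _

theorem insRoot_eq_zero_of_mem_chain {i j : ℤ} {x : ∀ S, G.chromaticCube.obj S}
    (hx : x ∈ (G.rootedCube v₀).chain i j) : G.insRoot v₀ x = 0 := by
  classical
  funext S
  have h := Labelling.map_mem_supported (t := ∅) (f := Labelling.ins ℤ
      ((G.spanning (S : Set E(G))).connectedComponentMk v₀)) (fun X hX => by
    rw [Labelling.ins_single, if_pos hX.1]
    exact Submodule.zero_mem _) (hx S).1
  rwa [Finsupp.supported_empty] at h

theorem rootedCube_chain_le (v₀ : V(G)) (i j : ℤ) :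
    (G.rootedCube v₀).chain i (j - 1) ≤ G.chromaticCube.chain i j := fun x hx S =>
  ⟨Finsupp.supported_mono (fun X hX => by
    have := hX.2
    rw [Set.mem_ofPred_eq]
    omega) (hx S).1, (hx S).2⟩

/-- As insertion after removal plus removal after insertion is the identity, a cochain killed by
insertion is an insertion, hence supported on rooted states. -/
theorem mem_rootedCube_chain {i j : ℤ} {x : ∀ S, G.chromaticCube.obj S}
    (hx : x ∈ G.chromaticCube.chain i j) (h : G.insRoot v₀ x = 0) :
    x ∈ (G.rootedCube v₀).chain i (j - 1) := by
  classical
  have hd := insRoot_delRoot_add (v₀ := v₀) x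
  rw [h, map_zero, add_zero] at hd
  refine fun S => ⟨?_, (hx S).2⟩
  have hS : (Labelling.ins ℤ ((G.spanning (S : Set E(G))).connectedComponentMk v₀))
      (Labelling.del ℤ ((G.spanning (S : Set E(G))).connectedComponentMk v₀)
        (x S : Finset (G.Conn (S : Set E(G))) →₀ ℤ)) = x S := congrFun hd S
  rw [← hS]
  refine Labelling.map_mem_supported (f := Labelling.ins ℤ
      ((G.spanning (S : Set E(G))).connectedComponentMk v₀) ∘ₗ Labelling.del ℤ
      ((G.spanning (S : Set E(G))).connectedComponentMk v₀)) (fun X hX => ?_) (hx S).1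
  rw [LinearMap.comp_apply, Labelling.del_single]
  split_ifs with hF
  · rw [Labelling.ins_single, if_neg (Finset.notMem_erase _ _), Finset.insert_erase hF]
    refine Finsupp.single_mem_supported ℤ _ ⟨hF, ?_⟩
    rw [hX, sub_add_cancel]
  · rw [map_zero]
    exact Submodule.zero_mem _

/-- The linear map from the exterior algebra of `N / ρ(S)` to the labellings of the components of
`[G:S]`, which sends the product of the minimal vertices of the components in `X` to the labelling
`X`, multiplied by the label `x` at the component of `v₀`. -/
theorem exists_stateMap [LinearOrder V(G)] [Finite V(G)] [Finite E(G)]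
    (hG : G.IsConn) (hv₀ : IsBot v₀) (S : Set E(G)) :
    ∃ t : ExteriorAlgebra ℤ (((V(G) →₀ ℤ) ⧸ G.minSubmodule) ⧸ G.canonical.ρ S) →ₗ[ℤ]
        (Finset (G.Conn S) →₀ ℤ),
      (∀ X, t (G.wedge S X) =
        Labelling.ins ℤ ((G.spanning S).connectedComponentMk v₀) (Finsupp.single X 1)) ∧
      (∀ x, Finsupp.linearCombination ℤ (G.wedge S)
        (Labelling.del ℤ ((G.spanning S).connectedComponentMk v₀) (t x)) = x) ∧
      (∀ j, ∀ x ∈ exteriorDegree ℤ (((V(G) →₀ ℤ) ⧸ G.minSubmodule) ⧸ G.canonical.ρ S) j,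
        t x ∈ Finsupp.supported ℤ ℤ {X | (G.spanning S).connectedComponentMk v₀ ∈ X ∧
          (X.card : ℤ) = j + 1}) ∧
      ∀ j, ∀ y ∈ Finsupp.supported ℤ ℤ {X : Finset (G.Conn S) | (X.card : ℤ) = j},
        Finsupp.linearCombination ℤ (G.wedge S) y ∈
          exteriorDegree ℤ (((V(G) →₀ ℤ) ⧸ G.minSubmodule) ⧸ G.canonical.ρ S) j := by
  classical
  obtain ⟨b, hb⟩ := exists_wedgeBasis hG hv₀ S
  set F := (G.spanning S).connectedComponentMk v₀ with hF
  -- The components of Y avoid the root, so on basis vectors `t` really inserts the root label, and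
  -- removing it afterwards recovers Y.
  let t := b.ExteriorAlgebra.constr ℤ fun Y =>
    Labelling.ins ℤ F (Finsupp.single (components v₀ S Y) 1)
  have hroot : ∀ Y, F ∉ components v₀ S Y := root_notMem_components hv₀ S
  have htb : ∀ Y, t (b.ExteriorAlgebra Y) =
      Labelling.ins ℤ F (Finsupp.single (components v₀ S Y) 1) := fun Y =>
    b.ExteriorAlgebra.constr_basis ℤ _ Y
  refine ⟨t, fun X => ?_, fun x => ?_, fun j x hx => ?_, fun j y hy => ?_⟩
  · by_cases hX : F ∈ X
    · rw [wedge_eq_zero hG hv₀ hX, map_zero, Labelling.ins_single, if_pos hX]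
    · obtain ⟨Y, rfl⟩ := exists_components_eq S hX
      rw [← hb, htb]
  · refine LinearMap.congr_fun (f := Finsupp.linearCombination ℤ (G.wedge S) ∘ₗ
      Labelling.del ℤ F ∘ₗ t) (g := .id) (b.ExteriorAlgebra.ext fun Y => ?_) x
    simp only [LinearMap.comp_apply, LinearMap.id_apply]
    rw [htb, Labelling.ins_single, if_neg (hroot Y), Labelling.del_single,
      if_pos (Finset.mem_insert_self _ _), Finset.erase_insert (hroot Y),
      Finsupp.linearCombination_single, one_smul, hb]
  · have hx' := Submodule.mem_map_of_mem (f := t)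
      (ExteriorAlgebra.mem_span_of_mem_exteriorDegree b hx)
    rw [Submodule.map_span] at hx'
    refine Submodule.span_le.2 ?_ hx'
    rintro _ ⟨_, ⟨Y, hY, rfl⟩, rfl⟩
    rw [htb, Labelling.ins_single, if_neg (hroot Y)]
    refine Finsupp.single_mem_supported ℤ _ ⟨Finset.mem_insert_self _ _, ?_⟩
    rw [Finset.card_insert_of_notMem (hroot Y), card_components, Nat.cast_succ, hY]
  · rw [Finsupp.supported_eq_span_single] at hy
    have hy' := Submodule.mem_map_of_mem (f := Finsupp.linearCombination ℤ (G.wedge S)) hy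
    rw [Submodule.map_span] at hy'
    refine Submodule.span_le.2 ?_ hy'
    rintro _ ⟨_, ⟨X, hX, rfl⟩, rfl⟩
    rw [Finsupp.linearCombination_single, one_smul, SetLike.mem_coe]
    by_cases hFX : F ∈ X
    · rw [wedge_eq_zero hG hv₀ hFX]
      exact Submodule.zero_mem _
    · obtain ⟨Y, rfl⟩ := exists_components_eq S hFX
      rw [Set.mem_ofPred_eq, card_components] at hX
      rw [← hb, ← hX]
      exact ExteriorAlgebra.basis_mem_exteriorDegree b Y

end Graph

/-! ### The map τ and the short exact sequences -/

namespace Graph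

variable {α β : Type*} {G : Graph α β} {v₀ : V(G)}

section Tau

variable [LinearOrder V(G)] [Finite V(G)] [Finite E(G)]

/-- The map `τ`; its composite with `θ` on either side is described by the operators which insert
and remove the label of the component of `v₀`. -/
theorem exists_tau (hG : G.IsConn) (hv₀ : IsBot v₀) :
    ∃ τ : (∀ S, G.canonical.cube.obj S) →ₗ[ℤ] (∀ S, G.chromaticCube.obj S),
      G.IsTau v₀ τ ∧ (∀ x, τ (G.theta x) = G.insRoot v₀ x) ∧
      (∀ x, G.theta (G.delRoot v₀ (τ x)) = x) ∧
      (∀ i j, ∀ x ∈ G.canonical.cube.chain i j, τ x ∈ (G.rootedCube v₀).chain i j) ∧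
      ∀ i j, ∀ x ∈ G.chromaticCube.chain i j, G.theta x ∈ G.canonical.cube.chain i j := by
  classical
  choose t ht1 ht2 ht3 ht4 using fun S : Finset E(G) => exists_stateMap hG hv₀ (S : Set E(G))
  have ht : ∀ (S : Finset E(G)) (x : Finset (G.Conn (S : Set E(G))) →₀ ℤ),
      t S (Finsupp.linearCombination ℤ (G.wedge S) x) =
        Labelling.ins ℤ ((G.spanning (S : Set E(G))).connectedComponentMk v₀) x := fun S x =>
    LinearMap.congr_fun (f := t S ∘ₗ Finsupp.linearCombination ℤ (G.wedge S))
      (g := Labelling.ins ℤ ((G.spanning (S : Set E(G))).connectedComponentMk v₀))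
      (Labelling.hom_ext fun X => by
        rw [LinearMap.comp_apply, Finsupp.linearCombination_single, one_smul, ht1]) x
  refine ⟨LinearMap.pi fun S => (t S) ∘ₗ LinearMap.proj S, fun S X => ?_,
    fun x => funext fun S => ht S (x S), fun x => funext fun S => ht2 S (x S),
    fun i j x hx S => ⟨ht3 S j _ (hx S).1, fun hS => ?_⟩,
    fun i j x hx S => ⟨ht4 S j _ (hx S).1, fun hS => ?_⟩⟩
  · funext T
    by_cases hT : T = S
    · subst hT
      refine (congrArg (t T) (Pi.single_eq_same (M := G.canonical.cube.obj) T _)).trans ?_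
      refine (ht1 T X).trans ?_
      rw [Labelling.ins_single]
      split_ifs
      · rfl
      · exact (Pi.single_eq_same (M := G.chromaticCube.obj) T _).symm
    · refine (congrArg (t T) (Pi.single_eq_of_ne (M := G.canonical.cube.obj) hT _)).trans ?_
      refine (map_zero (t T)).trans ?_
      split_ifs
      · rfl
      · exact (Pi.single_eq_of_ne (M := G.chromaticCube.obj) hT _).symm
  · change t S (x S) = 0
    rw [(hx S).2 hS]
    exact map_zero (t S)
  · change Finsupp.linearCombination ℤ (G.wedge S) (x S) = 0
    rw [(hx S).2 hS]
    exact map_zero (Finsupp.linearCombination ℤ (G.wedge S))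

end Tau

section RootedSequence

variable [LinearOrder E(G)]

variable (G) in
/-- The inclusion of the states in which the component of `v₀` is labelled `x`. -/
def rootedInclusion (v₀ : V(G)) (j : ℤ) :
    (G.rootedCube v₀).complex (j - 1) ⟶ G.chromaticComplex j where
  f i := ModuleCat.ofHom (Submodule.inclusion (rootedCube_chain_le v₀ i j))
  comm' i i' h := by
    ext x
    refine Subtype.ext ?_
    refine (G.chromaticCube.complex_d_apply j h ⟨x.1, rootedCube_chain_le v₀ i j x.2⟩).trans ?_
    exact ((G.rootedCube v₀).complex_d_apply (j - 1) h x).symm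

variable (G) in
/-- Multiplication by the label `x` at the component of `v₀`. -/
def rootedProjection (v₀ : V(G)) (j : ℤ) :
    G.chromaticComplex j ⟶ (G.rootedCube v₀).complex j where
  f i := ModuleCat.ofHom ((G.insRoot v₀).restrict fun _ => insRoot_mem_chain)
  comm' i i' h := by
    ext x
    refine Subtype.ext ?_
    refine ((G.rootedCube v₀).complex_d_apply j h ⟨_, insRoot_mem_chain x.2⟩).trans ?_
    refine (diff_insRoot x.1).trans (congrArg (G.insRoot v₀) ?_)
    exact (G.chromaticCube.complex_d_apply j h x).symm

theorem range_rootedInclusion (v₀ : V(G)) (i j : ℤ) :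
    (LinearMap.range ((G.rootedInclusion v₀ j).f i).hom).map (G.chromaticCube.chain i j).subtype =
      (G.rootedCube v₀).chain i (j - 1) := by
  ext x
  constructor
  · rintro ⟨_, ⟨y, rfl⟩, rfl⟩
    exact y.2
  · exact fun hx => ⟨⟨x, rootedCube_chain_le v₀ i j hx⟩, ⟨⟨x, hx⟩, rfl⟩, rfl⟩

theorem ker_rootedProjection (v₀ : V(G)) (i j : ℤ) :
    (LinearMap.ker ((G.rootedProjection v₀ j).f i).hom).map (G.chromaticCube.chain i j).subtype =
      G.chromaticCube.chain i j ⊓ LinearMap.ker (G.insRoot v₀) := by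
  ext x
  constructor
  · rintro ⟨y, hy, rfl⟩
    have h : ((G.rootedProjection v₀ j).f i).hom y = 0 := hy
    exact ⟨y.2, congrArg Subtype.val h⟩
  · rintro ⟨hx, hx'⟩
    have h : (⟨G.insRoot v₀ x, insRoot_mem_chain hx⟩ : (G.rootedCube v₀).chain i j) = 0 :=
      Subtype.ext hx'
    exact ⟨⟨x, hx⟩, h, rfl⟩

theorem rootedInclusion_comp_rootedProjection (v₀ : V(G)) (j : ℤ) :
    G.rootedInclusion v₀ j ≫ G.rootedProjection v₀ j = 0 := by
  ext i x
  exact Subtype.ext (insRoot_eq_zero_of_mem_chain x.2)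

/-- Exactness in the middle is `mem_rootedCube_chain`. Removing the root label is a section of the
projection in each degree, though it need not commute with d. -/
theorem shortExact_rooted (v₀ : V(G)) (j : ℤ) :
    (ShortComplex.mk (G.rootedInclusion v₀ j) (G.rootedProjection v₀ j)
      (rootedInclusion_comp_rootedProjection v₀ j)).ShortExact := by
  refine HomologicalComplex.shortExact_of_degreewise_shortExact _ fun i => ?_
  refine ShortComplex.ShortExact.mk' ?_ ?_ ?_
  · rw [ShortComplex.moduleCat_exact_iff]
    intro x hx
    exact ⟨⟨x.1, mem_rootedCube_chain x.2 (congrArg Subtype.val hx)⟩, rfl⟩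
  · rw [ModuleCat.mono_iff_injective]
    exact Submodule.inclusion_injective (rootedCube_chain_le v₀ i j)
  · rw [ModuleCat.epi_iff_surjective]
    intro y
    refine ⟨⟨G.delRoot v₀ y.1, delRoot_mem_chain y.2⟩, Subtype.ext ?_⟩
    have := insRoot_delRoot_add (v₀ := v₀) y.1
    rwa [insRoot_eq_zero_of_mem_chain y.2, map_zero, add_zero] at this

end RootedSequence

section Iso

variable [LinearOrder V(G)] [Finite V(G)] [Finite E(G)]

/-- A rooted x is the insertion of the root label into `delRoot` x, that is, τ of θ of `delRoot` x.
With τ injective this also compares the ranks of the two complexes. -/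
theorem chain_map_tau {τ : (∀ S, G.canonical.cube.obj S) →ₗ[ℤ] (∀ S, G.chromaticCube.obj S)}
    (hτθ : ∀ x, τ (G.theta x) = G.insRoot v₀ x)
    (hτ : ∀ i j, ∀ x ∈ G.canonical.cube.chain i j, τ x ∈ (G.rootedCube v₀).chain i j)
    (hθ : ∀ i j, ∀ x ∈ G.chromaticCube.chain i j, G.theta x ∈ G.canonical.cube.chain i j)
    (i j : ℤ) :
    (G.canonical.cube.chain i j).map τ = (G.rootedCube v₀).chain i j := by
  refine le_antisymm (Submodule.map_le_iff_le_comap.2 (hτ i j)) fun x hx => ?_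
  refine ⟨G.theta (G.delRoot v₀ x), hθ i j _ (delRoot_mem_chain hx), ?_⟩
  have := insRoot_delRoot_add (v₀ := v₀) x
  rw [insRoot_eq_zero_of_mem_chain hx, map_zero, add_zero] at this
  rw [hτθ, this]

variable [LinearOrder E(G)]

/-- Here τ serves only to compare ranks. The isomorphism itself is the abstract one for complexes
with torsion-free cohomology concentrated in the same degree, and it is not τ in general. -/
theorem nonempty_iso_rootedCube (hG : G.IsConn) (hv₀ : IsBot v₀) (j : ℤ) :
    Nonempty (G.matroidComplex j ≅ (G.rootedCube v₀).complex j) := by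
  obtain ⟨τ, -, hτθ, hθτ, hτ, hθ⟩ := exists_tau hG hv₀
  have hinj : Function.Injective τ := Function.LeftInverse.injective
    (g := fun y => G.theta (G.delRoot v₀ y)) hθτ
  have := Fintype.ofFinite E(G)
  have hr : G.graphicRank ((Finset.univ : Finset E(G)) : Set E(G)) = G.graphicRank Set.univ := by
    rw [Finset.coe_univ]
  have h1 := (isMatroidal_canonical hG hv₀).concentratedOn (Finset.empty_subset _) hr j
  have h2 := (isMatroidal_rootedCube hG v₀).concentratedOn (Finset.empty_subset _) hr j
  refine (h1.isConcentrated (fun S => ?_) fun S => ?_).nonempty_iso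
    (h2.isConcentrated (fun S => ?_) fun S => ?_) fun i => ?_
  · obtain ⟨b, -⟩ := exists_wedgeBasis hG hv₀ (S : Set E(G))
    exact Module.Free.of_basis b.ExteriorAlgebra
  · obtain ⟨b, -⟩ := exists_wedgeBasis hG hv₀ (S : Set E(G))
    exact Module.Finite.of_basis b.ExteriorAlgebra
  · exact inferInstanceAs (Module.Free ℤ (Finset (G.Conn (S : Set E(G))) →₀ ℤ))
  · exact inferInstanceAs (Module.Finite ℤ (Finset (G.Conn (S : Set E(G))) →₀ ℤ))
  · have := (Submodule.equivMapOfInjective τ hinj (G.canonical.cube.chain i j)).finrank_eq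
    rw [chain_map_tau hτθ hτ hθ] at this
    exact this

end Iso

end Graph

end

theorem theorem6p5 {α β : Type*} (G : Graph α β) [Finite V(G)] [Finite E(G)] [LinearOrder V(G)]
    [LinearOrder E(G)] (hG : G.IsConn) (v₀ : V(G)) (hv₀ : IsBot v₀) :
    ∃ τ : (∀ S, G.canonical.cube.obj S) →ₗ[ℤ] (∀ S, G.chromaticCube.obj S),
      G.IsTau v₀ τ ∧
      Function.Injective τ ∧ Function.Exact τ G.theta ∧ Function.Surjective G.theta ∧
      (∀ i j : ℤ, (G.canonical.cube.chain i (j - 1)).map τ ≤ G.chromaticCube.chain i j ∧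
        (G.chromaticCube.chain i j).map G.theta ≤ G.canonical.cube.chain i j) ∧
      ∀ j : ℤ,
        ∃ (f : G.matroidComplex (j - 1) ⟶ G.chromaticComplex j)
          (g : G.chromaticComplex j ⟶ G.matroidComplex j) (w : f ≫ g = 0)
          (h : (ShortComplex.mk f g w).ShortExact),
          (∀ i : ℤ, (LinearMap.range (f.f i).hom).map (G.chromaticCube.chain i j).subtype =
            (G.canonical.cube.chain i (j - 1)).map τ) ∧
          (∀ i : ℤ, (LinearMap.ker (g.f i).hom).map (G.chromaticCube.chain i j).subtype =
            G.chromaticCube.chain i j ⊓ LinearMap.ker G.theta) ∧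
          ∀ i : ℤ,
            Function.Exact (HomologicalComplex.homologyMap f i).hom
              (HomologicalComplex.homologyMap g i).hom ∧
            Function.Exact (HomologicalComplex.homologyMap g i).hom (h.δ i (i + 1) rfl).hom ∧
            Function.Exact (h.δ i (i + 1) rfl).hom
              (HomologicalComplex.homologyMap f (i + 1)).hom := by
  obtain ⟨τ, hisTau, hτθ, hθτ, hτ, hθ⟩ := Graph.exists_tau hG hv₀
  have hinj : Function.Injective τ := Function.LeftInverse.injective
    (g := fun y => G.theta (G.delRoot v₀ y)) hθτ
  have hmap := Graph.chain_map_tau hτθ hτ hθ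
  -- τ is injective and τ ∘ θ inserts the root label, so θ and insertion have the same kernel.
  have hker : LinearMap.ker G.theta = LinearMap.ker (G.insRoot v₀) := by
    ext x
    rw [LinearMap.mem_ker, LinearMap.mem_ker, ← hτθ]
    exact (map_eq_zero_iff τ hinj).symm
  refine ⟨τ, hisTau, hinj, fun x => ⟨fun hx => ?_, ?_⟩,
    fun x => ⟨G.delRoot v₀ (τ x), hθτ x⟩, fun i j => ⟨?_, ?_⟩, fun j => ?_⟩
  · refine ⟨G.theta (G.delRoot v₀ x), ?_⟩
    have h0 : G.insRoot v₀ x = 0 := by rw [← hτθ, hx, map_zero]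
    have := Graph.insRoot_delRoot_add (v₀ := v₀) x
    rwa [h0, map_zero, add_zero, ← hτθ] at this
  · rintro ⟨y, rfl⟩
    refine hinj ?_
    rw [hτθ, map_zero, ← hθτ y, hτθ, Graph.insRoot_insRoot]
  · exact (hmap i (j - 1)).le.trans (Graph.rootedCube_chain_le v₀ i j)
  · exact Submodule.map_le_iff_le_comap.2 (hθ i j)
  · obtain ⟨φ⟩ := Graph.nonempty_iso_rootedCube hG hv₀ (j - 1)
    obtain ⟨ψ⟩ := Graph.nonempty_iso_rootedCube hG hv₀ j
    -- Precomposing the inclusion and postcomposing the projection with isomorphisms changes neither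
    -- the image nor the kernel, so the description by τ and θ persists.
    have w : (φ.hom ≫ G.rootedInclusion v₀ j) ≫ G.rootedProjection v₀ j ≫ ψ.inv = 0 := by
      rw [Category.assoc, reassoc_of% (Graph.rootedInclusion_comp_rootedProjection v₀ j),
        Limits.zero_comp, Limits.comp_zero]
    let e : ShortComplex.mk _ _ (Graph.rootedInclusion_comp_rootedProjection v₀ j) ≅
        ShortComplex.mk _ _ w :=
      ShortComplex.isoMk φ.symm (Iso.refl _) ψ.symm (by simp) (by simp)
    have h : (ShortComplex.mk _ _ w).ShortExact :=
      ShortComplex.shortExact_of_iso e (Graph.shortExact_rooted v₀ j)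
    refine ⟨_, _, w, h, fun i => ?_, fun i => ?_, fun i => ⟨?_, ?_, ?_⟩⟩
    · rw [hmap, ← Graph.range_rootedInclusion, HomologicalComplex.comp_f, ModuleCat.hom_comp,
        LinearMap.range_comp_of_range_eq_top]
      exact LinearMap.range_eq_top.2 ((ModuleCat.epi_iff_surjective (φ.hom.f i)).1 inferInstance)
    · refine Eq.trans ?_ ((Graph.ker_rootedProjection v₀ i j).trans
        (congrArg (G.chromaticCube.chain i j ⊓ ·) hker.symm))
      rw [HomologicalComplex.comp_f, ModuleCat.hom_comp,
        LinearMap.ker_comp_of_ker_eq_bot]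
      exact LinearMap.ker_eq_bot.2 ((ModuleCat.mono_iff_injective (ψ.inv.f i)).1 inferInstance)
    · exact (ShortComplex.ShortExact.moduleCat_exact_iff_function_exact _).1 (h.homology_exact₂ i)
    · exact (ShortComplex.ShortExact.moduleCat_exact_iff_function_exact _).1
        (h.homology_exact₃ i (i + 1) rfl)
    · exact (ShortComplex.ShortExact.moduleCat_exact_iff_function_exact _).1
        (h.homology_exact₁ i (i + 1) rfl)
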